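/- An instance of the 2-covariate min-imbalance problem consists of $n$ treatment samples and $n'$ control samples, where covariate $p\in\{1,2\}$ assigns to every sample one of $k_p$ levels. Assume $1\le n\le n'$ and that every level of each covariate contains at least one (treatment or control) sample. Let $\ell_{p,i}$ be the number of treatment samples, and $L'_{p,i}$ the set of control samples, at level $i$ of covariate $p$, and put $u_{i_1,i_2}=|L'_{1,i_1}\cap L'_{2,i_2}|$. The problem is to find a set $S$ of exactly $n$ control samples that minimizes the imbalance $IM(S)=\sum_{p=1}^2\sum_{i=1}^{k_p}\bigl(e_{p,i}(S)+d_{p,i}(S)\bigr)$, where $e_{p,i}(S)=\max\{0,|S\cap L'_{p,i}|-\ell_{p,i}\}$ and $d_{p,i}(S)=\max\{0,\ell_{p,i}-|S\cap L'_{p,i}|\}$. Let (MI) be the linear program in real variables $x_{i_1,i_2},e_{p,i},d_{p,i}$ $$\min \sum_{p=1}^2\sum_{i=1}^{k_p}(e_{p,i}+d_{p,i})$$ subject to $\sum_{i_2}x_{i_1,i_2}+d_{1,i_1}-e_{1,i_1}=\ell_{1,i_1}$ for all $i_1$, $-\sum_{i_1}x_{i_1,i_2}-d_{2,i_2}+e_{2,i_2}=-\ell_{2,i_2}$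 for all $i_2$, $-\sum_i d_{1,i}+\sum_i e_{1,i}=0$, $\sum_i d_{2,i}-\sum_i e_{2,i}=0$, $e_{p,i},d_{p,i}\ge 0$ and $0\le x_{i_1,i_2}\le u_{i_1,i_2}$. (a) (MI) is a minimum cost network flow problem. Its network has a node $(p,i)$ for each level and two further nodes $1$ and $2$; the supply is $\ell_{1,i}$ at $(1,i)$, $-\ell_{2,i}$ at $(2,i)$, and $0$ at the nodes $1$ and $2$. There is an arc $(1,i_1)\to(2,i_2)$ of cost $0$ and capacity $u_{i_1,i_2}$ whenever $u_{i_1,i_2}>0$, with flow $x_{i_1,i_2}$; and there are arcs of cost $1$ and infinite capacity $1\to(1,i)$, $(1,i)\to 1$, $(2,i)\to 2$, $2\to(2,i)$, with flows $e_{1,i},d_{1,i},e_{2,i},d_{2,i}$. This correspondence is a bijection between the feasible solutions of (MI) and the feasible flows, and it preserves the cost. (b) (MI) is a formulation of the min-imbalance problem. Every set $S$ of $n$ control samples gives a feasible solution of (MI) with $x_{i_1,i_2}=|S\cap L'_{1,i_1}\cap L'_{2,i_2}|$, $e_{p,i}=e_{p,i}(S)$, $d_{p,i}=d_{p,i}(S)$,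 of objective value $IM(S)$. For every feasible solution of (MI) with integral $x$ there is a set $S$ of $n$ control samples with $|S\cap L'_{1,i_1}\cap L'_{2,i_2}|=x_{i_1,i_2}$ for all $i_1,i_2$, and with $IM(S)$ at most the objective value. A set $S$ is optimal for the min-imbalance problem if and only if the solution it gives is optimal for (MI). (c) The network has $O(k_1+k_2)$ nodes and $O(\min\{n',k_1k_2\})$ arcs. (d) There is a word RAM program (words of $O(\log(n+n'+k_1+k_2))$ bits, unit cost per operation) that solves the min-imbalance problem by the successive shortest path algorithm on this network. Starting from the zero flow, each iteration sends a positive integral amount of flow along a shortest path of the residual network from a node with remaining supply to a node with unfulfilled demand. There are at most $n$ iterations, and each takes $O(|A|+|V|\log|V|)$ time, where $V$ and $A$ are the sets of nodes and arcs. The program ends with an integral optimal flow for (MI) and an optimal set $S$, and its total running time is $O(n\cdot(n'+n\log n))$. All constants are absolute. -/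

import Mathlib

namespace MinImbalance

/-! ## Minimum cost network flow -/

/-- A minimum cost network flow instance with node set `V` and arc set `A`; all lower bounds on
the arc flows are `0`, an upper bound may be infinite, and a negative supply is a demand. -/
structure Network (V A : Type) where
  src : A → V
  tgt : A → V
  cost : A → ℤ
  cap : A → ℕ∞
  supply : V → ℤ

namespace Network

variable {V A : Type} [DecidableEq V] [Fintype A] [DecidableEq A]

/-- Outflow minus inflow at a node. -/
def netOut {R : Type} [AddCommGroup R] (N : Network V A) (f : A → R) (v : V) : R :=
  (∑ a with N.src a = v, f a) - ∑ a with N.tgt a = v, f a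

/-- Feasible (real-valued) flows: capacity and flow balance constraints. -/
def Feasible (N : Network V A) (f : A → ℝ) : Prop :=
  (∀ a, 0 ≤ f a ∧ ∀ u : ℕ, N.cap a = (u : ℕ∞) → f a ≤ u) ∧
    ∀ v, N.netOut f v = (N.supply v : ℝ)

def totalCost (N : Network V A) (f : A → ℝ) : ℝ := ∑ a, (N.cost a : ℝ) * f a

def Optimal (N : Network V A) (f : A → ℝ) : Prop :=
  N.Feasible f ∧ ∀ g, N.Feasible g → N.totalCost f ≤ N.totalCost g

/-! ### Successive shortest paths

A residual arc is a pair `(a, b)`: the arc `a` in its own direction for `b = true`, and against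
it for `b = false`. -/

def resTail (N : Network V A) (r : A × Bool) : V := if r.2 then N.src r.1 else N.tgt r.1

def resHead (N : Network V A) (r : A × Bool) : V := if r.2 then N.tgt r.1 else N.src r.1

def resCost (N : Network V A) (r : A × Bool) : ℤ := if r.2 then N.cost r.1 else -N.cost r.1

/-- The residual arc `r` can carry `δ` more units on top of the flow `f`. -/
def ResCapGE (N : Network V A) (f : A → ℕ) (δ : ℕ) (r : A × Bool) : Prop :=
  if r.2 then ((f r.1 + δ : ℕ) : ℕ∞) ≤ N.cap r.1 else δ ≤ f r.1

/-- `P` is a walk from `s` to `t` along arcs of positive residual capacity. -/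
def IsResWalk (N : Network V A) (f : A → ℕ) : V → List (A × Bool) → V → Prop
  | s, [], t => s = t
  | s, r :: P, t => N.resTail r = s ∧ N.ResCapGE f 1 r ∧ IsResWalk N f (N.resHead r) P t

/-- A residual path: a residual walk without repeated nodes. -/
def IsResPath (N : Network V A) (f : A → ℕ) (s : V) (P : List (A × Bool)) (t : V) : Prop :=
  N.IsResWalk f s P t ∧ (s :: P.map N.resHead).Nodup

def pathCost (N : Network V A) (P : List (A × Bool)) : ℤ := (P.map N.resCost).sum

def IsShortestResPath (N : Network V A) (f : A → ℕ) (s : V) (P : List (A × Bool)) (t : V) :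
    Prop :=
  N.IsResPath f s P t ∧ ∀ Q, N.IsResPath f s Q t → N.pathCost P ≤ N.pathCost Q

/-- Supply of `v` that `f` has not sent out yet; if negative, its absolute value is the demand
of `v` that is not fulfilled yet. -/
def remaining (N : Network V A) (f : A → ℕ) (v : V) : ℤ :=
  N.supply v - N.netOut (fun a => (f a : ℤ)) v

/-- One iteration of the successive shortest path algorithm: a positive amount `δ` of flow is
sent along a shortest path of the residual network from a node `s` with remaining supply to a
node `t` with unfulfilled demand. -/
def SSPStep (N : Network V A) (f g : A → ℕ) : Prop :=
  ∃ (s t : V) (P : List (A × Bool)) (δ : ℕ),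
    0 < δ ∧ (δ : ℤ) ≤ N.remaining f s ∧ (δ : ℤ) ≤ -N.remaining f t ∧
    N.IsShortestResPath f s P t ∧ (∀ r ∈ P, N.ResCapGE f δ r) ∧
    ∀ a, (g a : ℤ) = f a + δ * (P.count (a, true) : ℤ) - δ * (P.count (a, false) : ℤ)

end Network

/-! ## The min-imbalance problem with two covariates -/

/-- `nT` treatment samples and `nC` control samples with their levels under the two covariates,
which have `k₁` and `k₂` levels. -/
structure Instance where
  nT : ℕ
  nC : ℕ
  k₁ : ℕ
  k₂ : ℕ
  treat₁ : Fin nT → Fin k₁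
  treat₂ : Fin nT → Fin k₂
  ctrl₁ : Fin nC → Fin k₁
  ctrl₂ : Fin nC → Fin k₂

namespace Instance

/-- There is a treatment sample, the control group is at least as large as the treatment group,
and every level of either covariate contains a sample. -/
def Regular (I : Instance) : Prop :=
  1 ≤ I.nT ∧ I.nT ≤ I.nC ∧
    (∀ i, (∃ j, I.treat₁ j = i) ∨ ∃ j, I.ctrl₁ j = i) ∧
    ∀ i, (∃ j, I.treat₂ j = i) ∨ ∃ j, I.ctrl₂ j = i

variable (I : Instance)

/-- Sizes of the levels of the treatment group. -/
def ell₁ (i : Fin I.k₁) : ℕ := (Finset.univ.filter fun j => I.treat₁ j = i).card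

def ell₂ (i : Fin I.k₂) : ℕ := (Finset.univ.filter fun j => I.treat₂ j = i).card

/-- Number of members of `S` in an intersection of two levels of the control group. -/
def cellCount (S : Finset (Fin I.nC)) (i₁ : Fin I.k₁) (i₂ : Fin I.k₂) : ℕ :=
  (S.filter fun j => I.ctrl₁ j = i₁ ∧ I.ctrl₂ j = i₂).card

/-- Sizes of the level-intersections of the control group. -/
def u (i₁ : Fin I.k₁) (i₂ : Fin I.k₂) : ℕ := I.cellCount Finset.univ i₁ i₂

/-- Discrepancy of the selection `S` at a level. -/
def dis₁ (S : Finset (Fin I.nC)) (i : Fin I.k₁) : ℤ :=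
  ((S.filter fun j => I.ctrl₁ j = i).card : ℤ) - I.ell₁ i

def dis₂ (S : Finset (Fin I.nC)) (i : Fin I.k₂) : ℤ :=
  ((S.filter fun j => I.ctrl₂ j = i).card : ℤ) - I.ell₂ i

/-- Total excess and deficit of the selection `S` over all levels of both covariates. -/
def imbalance (S : Finset (Fin I.nC)) : ℤ :=
  (∑ i, (max 0 (I.dis₁ S i) + max 0 (-I.dis₁ S i))) +
    ∑ i, (max 0 (I.dis₂ S i) + max 0 (-I.dis₂ S i))

/-- Optimal solutions of the min-imbalance problem: selections of size `nT` with the least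
imbalance. -/
def OptimalSelection (S : Finset (Fin I.nC)) : Prop :=
  S.card = I.nT ∧ ∀ S' : Finset (Fin I.nC), S'.card = I.nT → I.imbalance S ≤ I.imbalance S'

/-! ### The formulation (MI) -/

/-- Level-intersection sizes `x`, excesses `e₁`, `e₂` and deficits `d₁`, `d₂`. -/
structure MIVars where
  x : Fin I.k₁ → Fin I.k₂ → ℝ
  e₁ : Fin I.k₁ → ℝ
  d₁ : Fin I.k₁ → ℝ
  e₂ : Fin I.k₂ → ℝ
  d₂ : Fin I.k₂ → ℝ

def MIFeasible (v : I.MIVars) : Prop :=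
  (∀ i₁, (∑ i₂, v.x i₁ i₂) + v.d₁ i₁ - v.e₁ i₁ = I.ell₁ i₁) ∧
  (∀ i₂, -(∑ i₁, v.x i₁ i₂) - v.d₂ i₂ + v.e₂ i₂ = -(I.ell₂ i₂ : ℝ)) ∧
  -(∑ i, v.d₁ i) + ∑ i, v.e₁ i = 0 ∧
  (∑ i, v.d₂ i) - ∑ i, v.e₂ i = 0 ∧
  (∀ i, 0 ≤ v.e₁ i ∧ 0 ≤ v.d₁ i) ∧
  (∀ i, 0 ≤ v.e₂ i ∧ 0 ≤ v.d₂ i) ∧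
  ∀ i₁ i₂, 0 ≤ v.x i₁ i₂ ∧ v.x i₁ i₂ ≤ I.u i₁ i₂

def MIObjective (v : I.MIVars) : ℝ := (∑ i, (v.e₁ i + v.d₁ i)) + ∑ i, (v.e₂ i + v.d₂ i)

def MIOptimal (v : I.MIVars) : Prop :=
  I.MIFeasible v ∧ ∀ w, I.MIFeasible w → I.MIObjective v ≤ I.MIObjective w

/-- The values of the variables of (MI) that belong to a selection. -/
def ofSelection (S : Finset (Fin I.nC)) : I.MIVars where
  x i₁ i₂ := I.cellCount S i₁ i₂
  e₁ i := (max 0 (I.dis₁ S i) : ℤ)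
  d₁ i := (max 0 (-I.dis₁ S i) : ℤ)
  e₂ i := (max 0 (I.dis₂ S i) : ℤ)
  d₂ i := (max 0 (-I.dis₂ S i) : ℤ)

/-! ### The network of (MI) -/

/-- `lev₁ i`, `lev₂ i` stand for the levels; `hub₁`, `hub₂` are the nodes `1` and `2`. -/
inductive Node
  | lev₁ (i : Fin I.k₁)
  | lev₂ (i : Fin I.k₂)
  | hub₁
  | hub₂
  deriving DecidableEq, Fintype

/-- An arc for each nonempty level-intersection, each excess and each deficit. -/
inductive Arc
  | cross (c : {c : Fin I.k₁ × Fin I.k₂ // 0 < I.u c.1 c.2})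
  | exc₁ (i : Fin I.k₁)
  | def₁ (i : Fin I.k₁)
  | exc₂ (i : Fin I.k₂)
  | def₂ (i : Fin I.k₂)
  deriving DecidableEq, Fintype

def network : Network I.Node I.Arc where
  src
    | .cross c => .lev₁ c.1.1
    | .exc₁ _ => .hub₁
    | .def₁ i => .lev₁ i
    | .exc₂ i => .lev₂ i
    | .def₂ _ => .hub₂
  tgt
    | .cross c => .lev₂ c.1.2
    | .exc₁ i => .lev₁ i
    | .def₁ _ => .hub₁
    | .exc₂ _ => .hub₂
    | .def₂ i => .lev₂ i
  cost
    | .cross _ => 0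
    | _ => 1
  cap
    | .cross c => I.u c.1.1 c.1.2
    | _ => ⊤
  supply
    | .lev₁ i => I.ell₁ i
    | .lev₂ i => -I.ell₂ i
    | .hub₁ => 0
    | .hub₂ => 0

/-- The arc flows given by values of the variables of (MI). -/
def toFlow (v : I.MIVars) : I.Arc → ℝ
  | .cross c => v.x c.1.1 c.1.2
  | .exc₁ i => v.e₁ i
  | .def₁ i => v.d₁ i
  | .exc₂ i => v.e₂ i
  | .def₂ i => v.d₂ i

end Instance

/-! ## Word RAM

Programs work on registers and arrays of natural numbers; the names of registers and arrays are
constants of the program. No number larger than the word bound `W` may ever be computed, and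
each operation, memory access and branch costs one step. -/

structure Store where
  reg : ℕ → ℕ
  arr : ℕ → ℕ → ℕ

/-- Arithmetic operations: `sub` is truncated, `div` rounds down, and `lt` and `eq` return
`1` for true and `0` for false. -/
inductive Op
  | add
  | sub
  | mul
  | div
  | lt
  | eq

def Op.eval : Op → ℕ → ℕ → ℕ
  | .add, a, b => a + b
  | .sub, a, b => a - b
  | .mul, a, b => a * b
  | .div, a, b => a / b
  | .lt, a, b => if a < b then 1 else 0
  | .eq, a, b => if a = b then 1 else 0

inductive Expr
  | lit (c : ℕ)
  | reg (r : ℕ)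
  | load (a : ℕ) (idx : Expr)
  | op (o : Op) (x y : Expr)

namespace Expr

def eval (σ : Store) : Expr → ℕ
  | lit c => c
  | reg r => σ.reg r
  | load a idx => σ.arr a (idx.eval σ)
  | op o x y => o.eval (x.eval σ) (y.eval σ)

/-- Number of steps for the evaluation. -/
def time : Expr → ℕ
  | lit _ => 1
  | reg _ => 1
  | load _ idx => idx.time + 1
  | op _ x y => x.time + y.time + 1

/-- No value in the evaluation, array indices included, exceeds `W`. -/
def Fits (W : ℕ) (σ : Store) : Expr → Prop
  | lit c => c ≤ W
  | reg r => σ.reg r ≤ W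
  | load a idx => idx.Fits W σ ∧ σ.arr a (idx.eval σ) ≤ W
  | op o x y => x.Fits W σ ∧ y.Fits W σ ∧ o.eval (x.eval σ) (y.eval σ) ≤ W

end Expr

def Store.setReg (σ : Store) (r v : ℕ) : Store :=
  { σ with reg := Function.update σ.reg r v }

def Store.setArr (σ : Store) (a i v : ℕ) : Store :=
  { σ with arr := Function.update σ.arr a (Function.update (σ.arr a) i v) }

inductive Prog
  | skip
  | assign (r : ℕ) (x : Expr)
  | store (a : ℕ) (idx x : Expr)
  | seq (p q : Prog)
  | ite (c : Expr) (p q : Prog)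
  | loop (c : Expr) (p : Prog)

/-- `Run W p σ T τ`: with word bound `W`, the program `p` started in `σ` halts in `τ` after `T`
steps. A condition counts as true if its value is not `0`. -/
inductive Run (W : ℕ) : Prog → Store → ℕ → Store → Prop
  | skip (σ : Store) : Run W .skip σ 1 σ
  | assign (σ : Store) (r : ℕ) (x : Expr) : x.Fits W σ →
      Run W (.assign r x) σ (x.time + 1) (σ.setReg r (x.eval σ))
  | store (σ : Store) (a : ℕ) (idx x : Expr) : idx.Fits W σ → x.Fits W σ →
      Run W (.store a idx x) σ (idx.time + x.time + 1) (σ.setArr a (idx.eval σ) (x.eval σ))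
  | seq (p q : Prog) (σ₀ σ₁ σ₂ : Store) (T₁ T₂ : ℕ) : Run W p σ₀ T₁ σ₁ → Run W q σ₁ T₂ σ₂ →
      Run W (.seq p q) σ₀ (T₁ + T₂) σ₂
  | iteTrue (c : Expr) (p q : Prog) (σ τ : Store) (T : ℕ) : c.Fits W σ → c.eval σ ≠ 0 →
      Run W p σ T τ → Run W (.ite c p q) σ (c.time + 1 + T) τ
  | iteFalse (c : Expr) (p q : Prog) (σ τ : Store) (T : ℕ) : c.Fits W σ → c.eval σ = 0 →
      Run W q σ T τ → Run W (.ite c p q) σ (c.time + 1 + T) τ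
  | loopDone (c : Expr) (p : Prog) (σ : Store) : c.Fits W σ → c.eval σ = 0 →
      Run W (.loop c p) σ (c.time + 1) σ
  | loopStep (c : Expr) (p : Prog) (σ₀ σ₁ σ₂ : Store) (T₁ T₂ : ℕ) : c.Fits W σ₀ →
      c.eval σ₀ ≠ 0 → Run W p σ₀ T₁ σ₁ → Run W (.loop c p) σ₁ T₂ σ₂ →
      Run W (.loop c p) σ₀ (c.time + 1 + T₁ + T₂) σ₂

namespace Instance

variable (I : Instance)

/-- The initial store: the four sizes in registers `0, …, 3`, the levels of the treatment
samples in arrays `0, 1` and those of the control samples in arrays `2, 3`, and `0` elsewhere. -/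
def input : Store where
  reg
    | 0 => I.nT
    | 1 => I.nC
    | 2 => I.k₁
    | 3 => I.k₂
    | _ => 0
  arr
    | 0, j => if h : j < I.nT then I.treat₁ ⟨j, h⟩ else 0
    | 1, j => if h : j < I.nT then I.treat₂ ⟨j, h⟩ else 0
    | 2, j => if h : j < I.nC then I.ctrl₁ ⟨j, h⟩ else 0
    | 3, j => if h : j < I.nC then I.ctrl₂ ⟨j, h⟩ else 0
    | _, _ => 0

/-- The selection kept in a store: array `4` is its indicator function. -/
def storedSelection (σ : Store) : Finset (Fin I.nC) :=
  Finset.univ.filter fun j => σ.arr 4 j = 1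

/-- The flow kept in a store: the level-intersection sizes of the stored selection, and the
excesses and deficits in arrays `5, …, 8`. -/
def storedFlow (σ : Store) : I.Arc → ℕ
  | .cross c => I.cellCount (I.storedSelection σ) c.1.1 c.1.2
  | .exc₁ i => σ.arr 5 i
  | .def₁ i => σ.arr 6 i
  | .exc₂ i => σ.arr 7 i
  | .def₂ i => σ.arr 8 i

/-- Polynomially bounded words, i.e. words of `O(log (nT + nC + k₁ + k₂))` bits. -/
def wordBound (a : ℕ) : ℕ := (I.nT + I.nC + I.k₁ + I.k₂) ^ a

end Instance

end MinImbalance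

open MinImbalance

/-! The linear program and selections. If nonnegative `e`, `d` satisfy `e - d = z`, then `e + d` is
at least `|z|`, with equality for the positive and negative parts of `z`. So a selection gives a
feasible point whose value is its imbalance. Conversely, a feasible point with integral `x`
dominates any selection made by picking `x i₁ i₂` samples in every cell (`exists_selection`,
`imbalance_le_objective`); the balance at the hubs is what forces the selection to have `nT`
members. The constraints of (MI) are flow balance equations. The variables of empty cells, which
have no arc, are forced to vanish, so that dropping them loses nothing (`bijOn_toFlow`).

That optimal selections are the same as optimal points of (MI) requires an integral optimum of the
linear program. It is supplied by the algorithm: its final flow is integral, and optimal among all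
real flows by complementary slackness (`Potential.optimal`, `Inv.imbalance_le`,
`optimalSelection_iff`).

The algorithm is of primal-dual type. It keeps integral node labels that give no residual arc a
negative reduced cost, equal to `0` at all remaining supplies and to one number `D` at all
unfulfilled demands. A breadth-first search from all supplies uses only residual arcs of reduced
cost zero. If it misses every demand, the labels of all unreached nodes go up by one; this is sound
because a residual arc that leaves the reached set has an integral positive reduced cost
(`Search.raise`). If it reaches a demand, the tree path consists of tight arcs and hence is a
shortest path (`Potential.isShortest`). Pushing one unit along it creates only residual arcs
opposite to tight ones, so the labels survive.

The point that makes an iteration linear is `D ≤ 4`: since fewer than `nT ≤ nC` units have been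
sent, some cross arc is unsaturated, and going through both hubs and that arc leads from any supply
to any demand at cost `4` (`Inv.labels_le`). So there are at most five searches per iteration, each
in time linear in the size of the network, and no priority queue is needed. The `nT` iterations of
one unit each then take `O(nT * nC)` steps, and the logarithmic terms of the claimed bounds are
merely nonnegative slack.

The machine keeps the flow as a table of residual capacities, infinite ones being replaced by `nT +
1`. The samples of each cell are listed once and for all; those at positions from the forward
residual capacity on are the selected ones. One push therefore changes the selection at one known
position (`Keeps.push`), and the stored selection always realizes the stored flow
(`Keeps.cellCount`). -/

namespace MinImbalance

namespace Instance

variable (I : Instance)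

/-! ## The network of (MI) -/

/-- The arcs, sorted by kind. -/
def arcEquiv : I.Arc ≃ {c : Fin I.k₁ × Fin I.k₂ // 0 < I.u c.1 c.2} ⊕
    ((Fin I.k₁ ⊕ Fin I.k₁) ⊕ (Fin I.k₂ ⊕ Fin I.k₂)) where
  toFun
    | .cross c => .inl c
    | .exc₁ i => .inr (.inl (.inl i))
    | .def₁ i => .inr (.inl (.inr i))
    | .exc₂ i => .inr (.inr (.inl i))
    | .def₂ i => .inr (.inr (.inr i))
  invFun
    | .inl c => .cross c
    | .inr (.inl (.inl i)) => .exc₁ i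
    | .inr (.inl (.inr i)) => .def₁ i
    | .inr (.inr (.inl i)) => .exc₂ i
    | .inr (.inr (.inr i)) => .def₂ i
  left_inv a := by cases a <;> rfl
  right_inv a := by rcases a with _ | (_ | _) | (_ | _) <;> rfl

/-- The nodes, sorted by kind. -/
def nodeEquiv : I.Node ≃ (Fin I.k₁ ⊕ Fin I.k₂) ⊕ (Unit ⊕ Unit) where
  toFun
    | .lev₁ i => .inl (.inl i)
    | .lev₂ i => .inl (.inr i)
    | .hub₁ => .inr (.inl ())
    | .hub₂ => .inr (.inr ())
  invFun
    | .inl (.inl i) => .lev₁ i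
    | .inl (.inr i) => .lev₂ i
    | .inr (.inl _) => .hub₁
    | .inr (.inr _) => .hub₂
  left_inv a := by cases a <;> rfl
  right_inv a := by rcases a with (_ | _) | (_ | _) <;> rfl

theorem card_node : Fintype.card I.Node = I.k₁ + I.k₂ + 2 := by
  rw [Fintype.card_congr I.nodeEquiv]; simp

theorem card_arc : Fintype.card I.Arc =
    Fintype.card {c : Fin I.k₁ × Fin I.k₂ // 0 < I.u c.1 c.2} + 2 * (I.k₁ + I.k₂) := by
  rw [Fintype.card_congr I.arcEquiv]
  simp only [Fintype.card_sum, Fintype.card_fin]; ring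

theorem sum_arc {R : Type*} [AddCommMonoid R] (F : I.Arc → R) :
    ∑ a, F a = (∑ c, F (.cross c)) + ((∑ i, F (.exc₁ i) + ∑ i, F (.def₁ i)) +
      (∑ i, F (.exc₂ i) + ∑ i, F (.def₂ i))) := by
  rw [← I.arcEquiv.symm.sum_comp]
  simp only [Fintype.sum_sum_type]
  rfl

theorem netOut_lev₁ {R : Type} [AddCommGroup R] (f : I.Arc → R) (i : Fin I.k₁) :
    I.network.netOut f (.lev₁ i) =
      (∑ c, if c.1.1 = i then f (.cross c) else 0) + f (.def₁ i) - f (.exc₁ i) := by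
  rw [Network.netOut, Finset.sum_filter, Finset.sum_filter, sum_arc, sum_arc]
  simp [network]

theorem netOut_lev₂ {R : Type} [AddCommGroup R] (f : I.Arc → R) (i : Fin I.k₂) :
    I.network.netOut f (.lev₂ i) =
      f (.exc₂ i) - ((∑ c, if c.1.2 = i then f (.cross c) else 0) + f (.def₂ i)) := by
  rw [Network.netOut, Finset.sum_filter, Finset.sum_filter, sum_arc, sum_arc]
  simp [network]

theorem netOut_hub₁ {R : Type} [AddCommGroup R] (f : I.Arc → R) :
    I.network.netOut f .hub₁ = (∑ i, f (.exc₁ i)) - ∑ i, f (.def₁ i) := by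
  rw [Network.netOut, Finset.sum_filter, Finset.sum_filter, sum_arc, sum_arc]
  simp [network]

theorem netOut_hub₂ {R : Type} [AddCommGroup R] (f : I.Arc → R) :
    I.network.netOut f .hub₂ = (∑ i, f (.def₂ i)) - ∑ i, f (.exc₂ i) := by
  rw [Network.netOut, Finset.sum_filter, Finset.sum_filter, sum_arc, sum_arc]
  simp [network]

/-- Only nonempty cells carry arcs, so a sum over cross arcs is a full double sum as soon as the
summand vanishes on empty cells. -/
theorem sum_cell {R : Type*} [AddCommMonoid R] (G : Fin I.k₁ → Fin I.k₂ → R)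
    (hG : ∀ i₁ i₂, I.u i₁ i₂ = 0 → G i₁ i₂ = 0) :
    (∑ c : {c : Fin I.k₁ × Fin I.k₂ // 0 < I.u c.1 c.2}, G c.1.1 c.1.2) =
      ∑ i₁, ∑ i₂, G i₁ i₂ := by
  rw [← Fintype.sum_prod_type']
  rw [← Finset.sum_subtype (Finset.univ.filter fun c : Fin I.k₁ × Fin I.k₂ => 0 < I.u c.1 c.2)
    (by simp) (fun c => G c.1 c.2)]
  apply Finset.sum_filter_of_ne
  intro c _ hc
  by_contra h
  exact hc (hG _ _ (by omega))

theorem sum_cell_row {R : Type*} [AddCommMonoid R] (G : Fin I.k₁ → Fin I.k₂ → R)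
    (hG : ∀ i₁ i₂, I.u i₁ i₂ = 0 → G i₁ i₂ = 0) (i : Fin I.k₁) :
    (∑ c : {c : Fin I.k₁ × Fin I.k₂ // 0 < I.u c.1 c.2},
      if c.1.1 = i then G c.1.1 c.1.2 else 0) = ∑ i₂, G i i₂ := by
  rw [I.sum_cell (fun i₁ i₂ => if i₁ = i then G i₁ i₂ else 0)
    (fun i₁ i₂ h => by simp [hG _ _ h])]
  rw [Finset.sum_comm]
  simp

theorem sum_cell_col {R : Type*} [AddCommMonoid R] (G : Fin I.k₁ → Fin I.k₂ → R)
    (hG : ∀ i₁ i₂, I.u i₁ i₂ = 0 → G i₁ i₂ = 0) (i : Fin I.k₂) :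
    (∑ c : {c : Fin I.k₁ × Fin I.k₂ // 0 < I.u c.1 c.2},
      if c.1.2 = i then G c.1.1 c.1.2 else 0) = ∑ i₁, G i₁ i := by
  rw [I.sum_cell (fun i₁ i₂ => if i₂ = i then G i₁ i₂ else 0)
    (fun i₁ i₂ h => by simp [hG _ _ h])]
  simp

theorem totalCost_toFlow (v : I.MIVars) : I.network.totalCost (I.toFlow v) = I.MIObjective v := by
  simp [Network.totalCost, MIObjective, sum_arc, network, toFlow, Finset.sum_add_distrib]

/-- Each constraint of (MI) is, up to sign, the balance equation of one node. The assumption on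
empty cells is what lets the sums over arcs be replaced by sums over all pairs of levels. -/
theorem feasible_toFlow_iff (v : I.MIVars) (hv : ∀ i₁ i₂, I.u i₁ i₂ = 0 → v.x i₁ i₂ = 0) :
    I.network.Feasible (I.toFlow v) ↔ I.MIFeasible v := by
  have h1 : ∀ i, I.network.netOut (I.toFlow v) (.lev₁ i) =
      (∑ i₂, v.x i i₂) + v.d₁ i - v.e₁ i := fun i => by
    rw [netOut_lev₁, ← I.sum_cell_row v.x hv]; rfl
  have h2 : ∀ i, I.network.netOut (I.toFlow v) (.lev₂ i) =
      v.e₂ i - ((∑ i₁, v.x i₁ i) + v.d₂ i) := fun i => by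
    rw [netOut_lev₂, ← I.sum_cell_col v.x hv]; rfl
  have h3 : I.network.netOut (I.toFlow v) .hub₁ = (∑ i, v.e₁ i) - ∑ i, v.d₁ i := by
    rw [netOut_hub₁]; rfl
  have h4 : I.network.netOut (I.toFlow v) .hub₂ = (∑ i, v.d₂ i) - ∑ i, v.e₂ i := by
    rw [netOut_hub₂]; rfl
  constructor
  · rintro ⟨hc, hb⟩
    refine ⟨fun i => ?_, fun i => ?_, ?_, ?_, fun i => ⟨(hc (.exc₁ i)).1, (hc (.def₁ i)).1⟩,
      fun i => ⟨(hc (.exc₂ i)).1, (hc (.def₂ i)).1⟩, fun i₁ i₂ => ?_⟩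
    · have := hb (.lev₁ i); rw [h1] at this; simpa [network] using this
    · have := hb (.lev₂ i); rw [h2] at this
      simp only [network, Int.cast_neg, Int.cast_natCast] at this
      linarith
    · have := hb .hub₁; rw [h3] at this; simp only [network, Int.cast_zero] at this; linarith
    · have := hb .hub₂; rw [h4] at this; simp only [network, Int.cast_zero] at this; linarith
    · by_cases h : 0 < I.u i₁ i₂
      · have := hc (.cross ⟨(i₁, i₂), h⟩)
        exact ⟨this.1, this.2 _ rfl⟩
      · have h0 : I.u i₁ i₂ = 0 := by omega
        simp [hv _ _ h0]
  · rintro ⟨m1, m2, m3, m4, m5, m6, m7⟩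
    refine ⟨fun a => ?_, fun w => ?_⟩
    · cases a with
      | cross c =>
        refine ⟨(m7 _ _).1, fun u hu => ?_⟩
        have : I.u c.1.1 c.1.2 = u := by simpa [network] using hu
        rw [← this]; exact (m7 _ _).2
      | exc₁ i => exact ⟨(m5 i).1, fun u hu => by simp [network] at hu⟩
      | def₁ i => exact ⟨(m5 i).2, fun u hu => by simp [network] at hu⟩
      | exc₂ i => exact ⟨(m6 i).1, fun u hu => by simp [network] at hu⟩
      | def₂ i => exact ⟨(m6 i).2, fun u hu => by simp [network] at hu⟩
    · cases w with
      | lev₁ i => rw [h1, m1]; simp [network]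
      | lev₂ i =>
        have := m2 i
        rw [h2]; simp only [network, Int.cast_neg, Int.cast_natCast]; linarith
      | hub₁ => rw [h3]; simp only [network, Int.cast_zero]; linarith
      | hub₂ => rw [h4]; simp only [network, Int.cast_zero]; linarith

theorem x_eq_zero_of_feasible {v : I.MIVars} (hv : I.MIFeasible v) (i₁ : Fin I.k₁)
    (i₂ : Fin I.k₂) (h : I.u i₁ i₂ = 0) : v.x i₁ i₂ = 0 := by
  have := hv.2.2.2.2.2.2 i₁ i₂
  rw [h] at this
  exact le_antisymm (by simpa using this.2) this.1

/-- The values of the variables of (MI) given by arc flows. -/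
def ofFlow (f : I.Arc → ℝ) : I.MIVars where
  x i₁ i₂ := if h : 0 < I.u i₁ i₂ then f (.cross ⟨(i₁, i₂), h⟩) else 0
  e₁ i := f (.exc₁ i)
  d₁ i := f (.def₁ i)
  e₂ i := f (.exc₂ i)
  d₂ i := f (.def₂ i)

theorem toFlow_ofFlow (f : I.Arc → ℝ) : I.toFlow (I.ofFlow f) = f := by
  funext a
  cases a with
  | cross c => simp [toFlow, ofFlow, c.2]
  | _ => rfl

/-- Injectivity rests on `u = 0` squeezing `x` to zero, so a feasible point is determined by its arc
flows. For surjectivity a flow is extended by zero to the empty cells. -/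
theorem bijOn_toFlow :
    Set.BijOn I.toFlow {v | I.MIFeasible v} {f | I.network.Feasible f} := by
  refine ⟨fun v hv => (I.feasible_toFlow_iff v (I.x_eq_zero_of_feasible hv)).2 hv, ?_, ?_⟩
  · intro v hv w hw h
    have hx : v.x = w.x := by
      funext i₁ i₂
      by_cases hu : 0 < I.u i₁ i₂
      · exact congrFun h (.cross ⟨(i₁, i₂), hu⟩)
      · rw [I.x_eq_zero_of_feasible hv _ _ (by omega), I.x_eq_zero_of_feasible hw _ _ (by omega)]
    have h1 : v.e₁ = w.e₁ := funext fun i => congrFun h (.exc₁ i)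
    have h2 : v.d₁ = w.d₁ := funext fun i => congrFun h (.def₁ i)
    have h3 : v.e₂ = w.e₂ := funext fun i => congrFun h (.exc₂ i)
    have h4 : v.d₂ = w.d₂ := funext fun i => congrFun h (.def₂ i)
    cases v; cases w; simp_all
  · intro f hf
    refine ⟨I.ofFlow f, ?_, I.toFlow_ofFlow f⟩
    refine (I.feasible_toFlow_iff _ ?_).1 (by rw [toFlow_ofFlow]; exact hf)
    intro i₁ i₂ h
    simp [ofFlow, h]

/-! ## Selections and (MI) -/

theorem sum_cellCount_row (S : Finset (Fin I.nC)) (i : Fin I.k₁) :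
    ∑ i₂, I.cellCount S i i₂ = (S.filter fun j => I.ctrl₁ j = i).card := by
  rw [Finset.card_eq_sum_card_fiberwise (f := I.ctrl₂) (t := Finset.univ) (by simp)]
  simp [cellCount, Finset.filter_filter]

theorem sum_cellCount_col (S : Finset (Fin I.nC)) (i : Fin I.k₂) :
    ∑ i₁, I.cellCount S i₁ i = (S.filter fun j => I.ctrl₂ j = i).card := by
  rw [Finset.card_eq_sum_card_fiberwise (f := I.ctrl₁) (t := Finset.univ) (by simp)]
  simp [cellCount, Finset.filter_filter, and_comm]

theorem sum_row_card (S : Finset (Fin I.nC)) :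
    ∑ i, (S.filter fun j => I.ctrl₁ j = i).card = S.card :=
  (Finset.card_eq_sum_card_fiberwise (by simp)).symm

theorem sum_col_card (S : Finset (Fin I.nC)) :
    ∑ i, (S.filter fun j => I.ctrl₂ j = i).card = S.card :=
  (Finset.card_eq_sum_card_fiberwise (by simp)).symm

theorem sum_cellCount (S : Finset (Fin I.nC)) : ∑ i₁, ∑ i₂, I.cellCount S i₁ i₂ = S.card := by
  simp only [sum_cellCount_row, sum_row_card]

theorem sum_ell₁ : ∑ i, I.ell₁ i = I.nT := by
  have := Finset.card_eq_sum_card_fiberwise (s := Finset.univ) (f := I.treat₁)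
    (t := Finset.univ) (by simp)
  simpa [ell₁] using this.symm

theorem sum_ell₂ : ∑ i, I.ell₂ i = I.nT := by
  have := Finset.card_eq_sum_card_fiberwise (s := Finset.univ) (f := I.treat₂)
    (t := Finset.univ) (by simp)
  simpa [ell₂] using this.symm

theorem cellCount_le_u (S : Finset (Fin I.nC)) (i₁ : Fin I.k₁) (i₂ : Fin I.k₂) :
    I.cellCount S i₁ i₂ ≤ I.u i₁ i₂ :=
  Finset.card_le_card (Finset.filter_subset_filter _ (Finset.subset_univ _))

theorem max_sub_max_neg (z : ℤ) : max 0 z - max 0 (-z) = z := by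
  rcases le_total 0 z with h | h
  · rw [max_eq_right h, max_eq_left (by omega)]; omega
  · rw [max_eq_left h, max_eq_right (by omega)]; omega

theorem sum_dis₁ (S : Finset (Fin I.nC)) (hS : S.card = I.nT) : ∑ i, I.dis₁ S i = 0 := by
  simp only [dis₁, Finset.sum_sub_distrib]
  rw [← Nat.cast_sum, ← Nat.cast_sum, sum_row_card, sum_ell₁, hS, sub_self]

theorem sum_dis₂ (S : Finset (Fin I.nC)) (hS : S.card = I.nT) : ∑ i, I.dis₂ S i = 0 := by
  simp only [dis₂, Finset.sum_sub_distrib]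
  rw [← Nat.cast_sum, ← Nat.cast_sum, sum_col_card, sum_ell₂, hS, sub_self]

theorem feasible_ofSelection (S : Finset (Fin I.nC)) (hS : S.card = I.nT) :
    I.MIFeasible (I.ofSelection S) := by
  have key : ∀ z : ℤ, ((max 0 z : ℤ) : ℝ) - ((max 0 (-z) : ℤ) : ℝ) = z := fun z => by
    rw [← Int.cast_sub, max_sub_max_neg]
  have nn : ∀ z : ℤ, (0 : ℝ) ≤ ((max 0 z : ℤ) : ℝ) := fun z => by
    exact_mod_cast le_max_left 0 z
  refine ⟨fun i => ?_, fun i => ?_, ?_, ?_, fun i => ⟨nn _, nn _⟩, fun i => ⟨nn _, nn _⟩,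
    fun i₁ i₂ => ⟨Nat.cast_nonneg _, Nat.cast_le.2 (I.cellCount_le_u S i₁ i₂)⟩⟩
  · have h := key (I.dis₁ S i)
    have h' : (∑ i₂, (I.cellCount S i i₂ : ℝ)) = (S.filter fun j => I.ctrl₁ j = i).card := by
      rw [← Nat.cast_sum, sum_cellCount_row]
    simp only [ofSelection]
    rw [h']
    have h2 : (I.dis₁ S i : ℝ) = (S.filter fun j => I.ctrl₁ j = i).card - I.ell₁ i := by
      simp [dis₁]
    linarith
  · have h := key (I.dis₂ S i)
    have h' : (∑ i₁, (I.cellCount S i₁ i : ℝ)) = (S.filter fun j => I.ctrl₂ j = i).card := by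
      rw [← Nat.cast_sum, sum_cellCount_col]
    simp only [ofSelection]
    rw [h']
    have h2 : (I.dis₂ S i : ℝ) = (S.filter fun j => I.ctrl₂ j = i).card - I.ell₂ i := by
      simp [dis₂]
    linarith
  · simp only [ofSelection]
    rw [neg_add_eq_sub, ← Finset.sum_sub_distrib, Finset.sum_congr rfl (fun i _ => key _),
      ← Int.cast_sum, I.sum_dis₁ S hS, Int.cast_zero]
  · simp only [ofSelection]
    rw [← neg_sub, ← Finset.sum_sub_distrib, Finset.sum_congr rfl (fun i _ => key _),
      ← Int.cast_sum, I.sum_dis₂ S hS, Int.cast_zero, neg_zero]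

theorem objective_ofSelection (S : Finset (Fin I.nC)) :
    I.MIObjective (I.ofSelection S) = I.imbalance S := by
  simp [MIObjective, ofSelection, imbalance]

/-- Positive and negative part are the cheapest way to write a number as a difference of nonnegative
ones. -/
theorem max_add_max_neg_le {z : ℤ} {e d : ℝ} (he : 0 ≤ e) (hd : 0 ≤ d) (h : (z : ℝ) = e - d) :
    ((max 0 z + max 0 (-z) : ℤ) : ℝ) ≤ e + d := by
  rcases le_total 0 z with hz | hz
  · rw [max_eq_right hz, max_eq_left (by omega)]; push_cast; linarith
  · rw [max_eq_left hz, max_eq_right (by omega)]; push_cast; linarith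

/-- The balance constraints identify the discrepancies of `S` with `e - d`. At the first hub these
add up to zero, which gives the size of `S`; the bound on the imbalance then holds level by level.
-/
theorem imbalance_le_objective {v : I.MIVars} (hv : I.MIFeasible v) (S : Finset (Fin I.nC))
    (hS : ∀ i₁ i₂, v.x i₁ i₂ = I.cellCount S i₁ i₂) :
    S.card = I.nT ∧ (I.imbalance S : ℝ) ≤ I.MIObjective v := by
  obtain ⟨m1, m2, m3, m4, m5, m6, m7⟩ := hv
  have r1 : ∀ i, (I.dis₁ S i : ℝ) = v.e₁ i - v.d₁ i := fun i => by
    have := m1 i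
    simp only [hS] at this
    rw [← Nat.cast_sum, sum_cellCount_row] at this
    simp only [dis₁, Int.cast_sub, Int.cast_natCast]; linarith
  have r2 : ∀ i, (I.dis₂ S i : ℝ) = v.e₂ i - v.d₂ i := fun i => by
    have := m2 i
    simp only [hS] at this
    rw [← Nat.cast_sum, sum_cellCount_col] at this
    simp only [dis₂, Int.cast_sub, Int.cast_natCast]; linarith
  constructor
  · have h : ((∑ i, I.dis₁ S i : ℤ) : ℝ) = 0 := by
      rw [Int.cast_sum, Finset.sum_congr rfl (fun i _ => r1 i), Finset.sum_sub_distrib]; linarith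
    have h' : ∑ i, I.dis₁ S i = 0 := by exact_mod_cast h
    simp only [dis₁, Finset.sum_sub_distrib] at h'
    rw [← Nat.cast_sum, ← Nat.cast_sum, sum_row_card, sum_ell₁] at h'
    omega
  · simp only [imbalance, MIObjective]
    rw [Int.cast_add, Int.cast_sum, Int.cast_sum]
    exact add_le_add
      (Finset.sum_le_sum fun i _ => max_add_max_neg_le (m5 i).1 (m5 i).2 (r1 i))
      (Finset.sum_le_sum fun i _ => max_add_max_neg_le (m6 i).1 (m6 i).2 (r2 i))

/-- The cells partition the control samples, so subsets of prescribed sizes can be chosen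
independently in all of them. -/
theorem exists_selection (s : Fin I.k₁ → Fin I.k₂ → ℕ) (hs : ∀ i₁ i₂, s i₁ i₂ ≤ I.u i₁ i₂) :
    ∃ S : Finset (Fin I.nC), ∀ i₁ i₂, I.cellCount S i₁ i₂ = s i₁ i₂ := by
  have h : ∀ i₁ i₂, ∃ T ⊆ Finset.univ.filter fun j => I.ctrl₁ j = i₁ ∧ I.ctrl₂ j = i₂,
      T.card = s i₁ i₂ := fun i₁ i₂ => Finset.exists_subset_card_eq (hs i₁ i₂)
  choose T hT hc using h
  refine ⟨Finset.univ.filter fun j => j ∈ T (I.ctrl₁ j) (I.ctrl₂ j), fun i₁ i₂ => ?_⟩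
  rw [← hc, cellCount]
  congr 1
  ext j
  simp only [Finset.mem_filter, Finset.mem_univ, true_and]
  constructor
  · rintro ⟨h, rfl, rfl⟩; exact h
  · intro h
    have := hT i₁ i₂ h
    simp only [Finset.mem_filter, Finset.mem_univ, true_and] at this
    obtain ⟨rfl, rfl⟩ := this
    exact ⟨h, rfl, rfl⟩

/-! ## The size of the network -/

/-- Choosing one sample in each nonempty cell is injective, because a sample determines its cell. -/
theorem card_cells_le : Fintype.card {c : Fin I.k₁ × Fin I.k₂ // 0 < I.u c.1 c.2} ≤ I.nC := by
  have h : ∀ c : {c : Fin I.k₁ × Fin I.k₂ // 0 < I.u c.1 c.2},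
      ∃ j, I.ctrl₁ j = c.1.1 ∧ I.ctrl₂ j = c.1.2 := fun c => by
    have h := c.2
    rw [u, cellCount, Finset.card_pos] at h
    obtain ⟨j, hj⟩ := h
    exact ⟨j, by simpa using hj⟩
  choose g hg using h
  have : Function.Injective g := fun c d h => by
    apply Subtype.ext
    apply Prod.ext
    · rw [← (hg c).1, ← (hg d).1, h]
    · rw [← (hg c).2, ← (hg d).2, h]
  simpa using Fintype.card_le_of_injective g this

theorem Regular.k₁_pos {I : Instance} (h : I.Regular) : 1 ≤ I.k₁ :=
  Nat.one_le_iff_ne_zero.2 fun h0 => (h0 ▸ I.treat₁ ⟨0, h.1⟩).elim0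

theorem Regular.k₂_pos {I : Instance} (h : I.Regular) : 1 ≤ I.k₂ :=
  Nat.one_le_iff_ne_zero.2 fun h0 => (h0 ▸ I.treat₂ ⟨0, h.1⟩).elim0

theorem le_add_of_cover {a b k : ℕ} (f : Fin a → Fin k) (g : Fin b → Fin k)
    (h : ∀ i, (∃ j, f j = i) ∨ ∃ j, g j = i) : k ≤ a + b := by
  have : Function.Surjective (Sum.elim f g) := fun i => by
    rcases h i with ⟨j, rfl⟩ | ⟨j, rfl⟩
    · exact ⟨.inl j, rfl⟩
    · exact ⟨.inr j, rfl⟩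
  simpa using Fintype.card_le_of_surjective _ this

theorem Regular.k₁_le {I : Instance} (h : I.Regular) : I.k₁ ≤ 2 * I.nC := by
  have := le_add_of_cover _ _ h.2.2.1
  have := h.2.1
  omega

theorem Regular.k₂_le {I : Instance} (h : I.Regular) : I.k₂ ≤ 2 * I.nC := by
  have := le_add_of_cover _ _ h.2.2.2
  have := h.2.1
  omega

/-- Nonempty cells number at most `nC` and at most `k₁ * k₂`. The level arcs number `2 * (k₁ + k₂)`,
where each `k` is at most `2 * nC` since every level has a sample, and at most `k₁ * k₂` since both
are positive. The larger of the two resulting constants is `1 + 2 * (2 + 2) = 9`. -/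
theorem Regular.card_arc_le {I : Instance} (h : I.Regular) :
    Fintype.card I.Arc ≤ 9 * min I.nC (I.k₁ * I.k₂) := by
  have h1 := I.card_cells_le
  have h2 : Fintype.card {c : Fin I.k₁ × Fin I.k₂ // 0 < I.u c.1 c.2} ≤ I.k₁ * I.k₂ := by
    simpa using Fintype.card_subtype_le fun c : Fin I.k₁ × Fin I.k₂ => 0 < I.u c.1 c.2
  have := h.k₁_le
  have := h.k₂_le
  have h3 := h.k₁_pos
  have h4 := h.k₂_pos
  have h5 : I.k₁ ≤ I.k₁ * I.k₂ := Nat.le_mul_of_pos_right _ h4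
  have h6 : I.k₂ ≤ I.k₁ * I.k₂ := Nat.le_mul_of_pos_left _ h3
  rw [card_arc]
  rcases min_choice I.nC (I.k₁ * I.k₂) with e | e <;> rw [e] <;> omega

end Instance

namespace Network

variable {V A : Type}

/-! ## Potentials and successive shortest paths -/

/-- No residual arc has a negative reduced cost with respect to the distance labels `π`. -/
def Potential (N : Network V A) (f : A → ℕ) (π : V → ℤ) : Prop :=
  ∀ r, N.ResCapGE f 1 r → π (N.resHead r) ≤ π (N.resTail r) + N.resCost r

/-- The residual arc `r` has reduced cost zero. -/
def Tight (N : Network V A) (π : V → ℤ) (r : A × Bool) : Prop :=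
  π (N.resHead r) = π (N.resTail r) + N.resCost r

/-- Weak duality for paths: the inequalities of the arcs telescope along a walk. On tight arcs they
are equalities, which is `pathCost_of_tight`. -/
theorem Potential.le_pathCost {N : Network V A} {f : A → ℕ} {π : V → ℤ} (h : N.Potential f π) :
    ∀ {P : List (A × Bool)} {s t : V}, N.IsResWalk f s P t → π t ≤ π s + N.pathCost P
  | [], s, t, hw => by simp only [IsResWalk] at hw; simp [pathCost, hw]
  | r :: P, s, t, hw => by
    obtain ⟨rfl, h1, h2⟩ := hw
    have := h.le_pathCost h2
    have := h r h1
    simp only [pathCost, List.map_cons, List.sum_cons] at *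
    linarith

theorem pathCost_of_tight {N : Network V A} {f : A → ℕ} {π : V → ℤ} :
    ∀ {P : List (A × Bool)} {s t : V}, N.IsResWalk f s P t → (∀ r ∈ P, N.Tight π r) →
      π t = π s + N.pathCost P
  | [], s, t, hw, _ => by simp only [IsResWalk] at hw; simp [pathCost, hw]
  | r :: P, s, t, hw, ht => by
    obtain ⟨rfl, h1, h2⟩ := hw
    have := pathCost_of_tight h2 fun r hr => ht r (List.mem_cons_of_mem _ hr)
    have := ht r List.mem_cons_self
    simp only [Tight, pathCost, List.map_cons, List.sum_cons] at *
    linarith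

/-- The difference of the labels at the ends bounds the cost of every residual path from below, and
a tight path attains it. This certifies a shortest path without computing distances to the other
nodes. -/
theorem Potential.isShortest {N : Network V A} {f : A → ℕ} {π : V → ℤ} (h : N.Potential f π)
    {P : List (A × Bool)} {s t : V} (hP : N.IsResPath f s P t) (ht : ∀ r ∈ P, N.Tight π r) :
    N.IsShortestResPath f s P t := by
  refine ⟨hP, fun Q hQ => ?_⟩
  have h1 := pathCost_of_tight hP.1 ht
  have h2 := h.le_pathCost hQ.1
  linarith

theorem resCapGE_of_isResWalk {N : Network V A} {f : A → ℕ} :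
    ∀ {P : List (A × Bool)} {s t : V}, N.IsResWalk f s P t → ∀ r ∈ P, N.ResCapGE f 1 r
  | [], _, _, _, _, hr => by simp at hr
  | _ :: _, _, _, hw, r, hr => by
    rcases List.mem_cons.1 hr with rfl | hr
    · exact hw.2.1
    · exact resCapGE_of_isResWalk hw.2.2 r hr

variable [DecidableEq V] [Fintype A]

theorem netOut_add {R : Type} [AddCommGroup R] (N : Network V A) (f g : A → R) (v : V) :
    N.netOut (fun a => f a + g a) v = N.netOut f v + N.netOut g v := by
  simp only [netOut, Finset.sum_add_distrib]; abel

theorem netOut_sub {R : Type} [AddCommGroup R] (N : Network V A) (f g : A → R) (v : V) :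
    N.netOut (fun a => f a - g a) v = N.netOut f v - N.netOut g v := by
  simp only [netOut, Finset.sum_sub_distrib]; abel

theorem netOut_single [DecidableEq A] (N : Network V A) (b : A) (v : V) :
    N.netOut (fun a => if a = b then (1 : ℤ) else 0) v =
      (if N.src b = v then 1 else 0) - if N.tgt b = v then 1 else 0 := by
  simp only [netOut, Finset.sum_filter]
  congr 1
  · rw [Finset.sum_eq_single b] <;> simp +contextual
  · rw [Finset.sum_eq_single b] <;> simp +contextual

/-- One unit of flow along a walk leaves its first node and arrives at its last node. -/
theorem netOut_count [DecidableEq A] (N : Network V A) (f : A → ℕ) (v : V) :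
    ∀ (P : List (A × Bool)) (s t : V), N.IsResWalk f s P t →
      N.netOut (fun a => (P.count (a, true) : ℤ) - (P.count (a, false) : ℤ)) v =
        (if s = v then 1 else 0) - if t = v then 1 else 0
  | [], s, t, hw => by
    simp only [IsResWalk] at hw
    simp [netOut, hw]
  | (b, d) :: P, s, t, hw => by
    obtain ⟨rfl, -, h2⟩ := hw
    have ih := netOut_count N f v P _ _ h2
    cases d with
    | true =>
      have : (fun a => ((((b, true) :: P).count (a, true) : ℕ) : ℤ) -
          ((((b, true) :: P).count (a, false) : ℕ) : ℤ)) =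
          fun a => (if a = b then (1 : ℤ) else 0) +
            ((P.count (a, true) : ℤ) - (P.count (a, false) : ℤ)) := by
        funext a
        by_cases h : a = b
        · subst h; simp; ring
        · simp [h, Ne.symm h]
      rw [this, netOut_add, netOut_single, ih]
      simp [resHead, resTail]
    | false =>
      have : (fun a => ((((b, false) :: P).count (a, true) : ℕ) : ℤ) -
          ((((b, false) :: P).count (a, false) : ℕ) : ℤ)) =
          fun a => ((P.count (a, true) : ℤ) - (P.count (a, false) : ℤ)) -
            (if a = b then (1 : ℤ) else 0) := by
        funext a
        by_cases h : a = b
        · subst h; simp; ring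
        · simp [h, Ne.symm h]
      rw [this, netOut_sub, netOut_single, ih]
      simp [resHead, resTail]

/-- Summation by parts: every arc contributes to the balance of its source and of its target only.
-/
theorem sum_potential_netOut [Fintype V] (N : Network V A) (π : V → ℝ) (h : A → ℝ) :
    ∑ v, π v * N.netOut h v = ∑ a, (π (N.src a) - π (N.tgt a)) * h a := by
  have key : ∀ e : A → V, ∑ v, π v * ∑ a with e a = v, h a = ∑ a, π (e a) * h a := fun e => by
    simp only [Finset.mul_sum, Finset.sum_filter, mul_ite, mul_zero]
    rw [Finset.sum_comm]
    simp
  simp only [netOut, mul_sub, Finset.sum_sub_distrib, key, sub_mul]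

/-- Complementary slackness: a feasible flow with a potential is optimal. -/
theorem Potential.optimal [Fintype V] {N : Network V A} {f : A → ℕ} {π : V → ℤ}
    (h : N.Potential f π) (hf : N.Feasible fun a => (f a : ℝ)) :
    N.Optimal fun a => (f a : ℝ) := by
  refine ⟨hf, fun g hg => ?_⟩
  -- Both flows have the same net outflow at every node, so the label terms cancel in the cost
  -- difference.
  have h1 : ∑ a, (((π (N.src a) : ℝ) - π (N.tgt a)) * (g a - f a)) = 0 := by
    rw [← sum_potential_netOut N (fun v => (π v : ℝ)) fun a => g a - f a]
    apply Finset.sum_eq_zero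
    intro v _
    rw [netOut_sub, hg.2, hf.2, sub_self, mul_zero]
  -- If `g` is below `f` on an arc, then `f` is positive there and the backward residual arc bounds
  -- the reduced cost above by zero. If `g` is above `f`, the arc is unsaturated by `f` and the
  -- reduced cost is nonnegative.
  have h2 : ∀ a, 0 ≤ ((N.cost a : ℝ) + ((π (N.src a) : ℝ) - π (N.tgt a))) * (g a - f a) := by
    intro a
    rcases lt_trichotomy (g a) (f a) with hlt | heq | hgt
    · have : 0 < f a := by
        have := (hg.1 a).1
        exact_mod_cast lt_of_le_of_lt this hlt
      have := h (a, false) (by simp only [ResCapGE]; exact this)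
      have h3 : (π (N.src a) : ℝ) ≤ π (N.tgt a) - N.cost a := by
        have : π (N.src a) + N.cost a ≤ π (N.tgt a) := by
          simpa [resHead, resTail, resCost] using this
        rw [le_sub_iff_add_le]
        exact_mod_cast this
      exact mul_nonneg_of_nonpos_of_nonpos (by linarith) (by linarith)
    · simp [heq]
    · have hres : N.ResCapGE f 1 (a, true) := by
        simp only [ResCapGE, if_true]
        rcases hc : N.cap a with _ | u
        · exact le_top
        · have := (hg.1 a).2 u hc
          have h4 : (f a : ℝ) < u := lt_of_lt_of_le hgt this
          have h5 : f a < u := by exact_mod_cast h4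
          exact Nat.cast_le.2 h5
      have := h (a, true) hres
      have h3 : (π (N.tgt a) : ℝ) ≤ π (N.src a) + N.cost a := by
        have : π (N.tgt a) ≤ π (N.src a) + N.cost a := by
          simpa [resHead, resTail, resCost] using this
        exact_mod_cast this
      exact mul_nonneg (by linarith) (by linarith)
  have h3 := Finset.sum_nonneg fun a (_ : a ∈ Finset.univ) => h2 a
  have h4 : ∑ a, ((N.cost a : ℝ) + ((π (N.src a) : ℝ) - π (N.tgt a))) * (g a - f a) =
      (∑ a, (N.cost a : ℝ) * g a - ∑ a, (N.cost a : ℝ) * f a) +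
        ∑ a, (((π (N.src a) : ℝ) - π (N.tgt a)) * (g a - f a)) := by
    rw [← Finset.sum_sub_distrib, ← Finset.sum_add_distrib]
    exact Finset.sum_congr rfl fun a _ => by ring
  simp only [totalCost]
  linarith

end Network

/-! ## Reasoning about programs -/

namespace Store

@[simp] theorem setReg_reg (σ : Store) (r v r' : ℕ) :
    (σ.setReg r v).reg r' = if r' = r then v else σ.reg r' := by
  simp [setReg, Function.update_apply]

@[simp] theorem setReg_arr (σ : Store) (r v : ℕ) : (σ.setReg r v).arr = σ.arr := rfl

@[simp] theorem setArr_reg (σ : Store) (a i v : ℕ) : (σ.setArr a i v).reg = σ.reg := rfl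

@[simp] theorem setArr_arr (σ : Store) (a i v b : ℕ) :
    (σ.setArr a i v).arr b = if b = a then Function.update (σ.arr a) i v else σ.arr b := by
  by_cases h : b = a
  · subst h; simp [setArr]
  · simp [setArr, h]

end Store

namespace Op

@[simp] theorem eval_add (a b : ℕ) : Op.add.eval a b = a + b := rfl

@[simp] theorem eval_sub (a b : ℕ) : Op.sub.eval a b = a - b := rfl

@[simp] theorem eval_mul (a b : ℕ) : Op.mul.eval a b = a * b := rfl

@[simp] theorem eval_div (a b : ℕ) : Op.div.eval a b = a / b := rfl

@[simp] theorem eval_lt (a b : ℕ) : Op.lt.eval a b = if a < b then 1 else 0 := rfl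

@[simp] theorem eval_eq (a b : ℕ) : Op.eq.eval a b = if a = b then 1 else 0 := rfl

end Op

theorem ite_one_zero_le {W : ℕ} (hW : 1 ≤ W) (p : Prop) [Decidable p] :
    (if p then 1 else 0) ≤ W := by
  split_ifs <;> omega

namespace Prog

/-- The registers that a program may change. -/
def regs : Prog → List ℕ
  | skip => []
  | assign r _ => [r]
  | store _ _ _ => []
  | seq p q => p.regs ++ q.regs
  | ite _ p q => p.regs ++ q.regs
  | loop _ p => p.regs

/-- The arrays that a program may change. -/
def arrs : Prog → List ℕ
  | skip => []
  | assign _ _ => []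
  | store a _ _ => [a]
  | seq p q => p.arrs ++ q.arrs
  | ite _ p q => p.arrs ++ q.arrs
  | loop _ p => p.arrs

/-- `τ` agrees with `σ` outside of the registers and arrays that `p` may change. -/
def Frame (p : Prog) (σ τ : Store) : Prop :=
  (∀ r, r ∉ p.regs → τ.reg r = σ.reg r) ∧ ∀ a, a ∉ p.arrs → τ.arr a = σ.arr a

theorem Frame.refl (p : Prog) (σ : Store) : p.Frame σ σ := ⟨fun _ _ => rfl, fun _ _ => rfl⟩

theorem Frame.trans {p : Prog} {σ τ ρ : Store} (h : p.Frame σ τ) (h' : p.Frame τ ρ) :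
    p.Frame σ ρ :=
  ⟨fun r hr => (h'.1 r hr).trans (h.1 r hr), fun r hr => (h'.2 r hr).trans (h.2 r hr)⟩

/-- Weakest precondition of a program without loops. -/
def wp (W : ℕ) : Prog → (Store → Prop) → Store → Prop
  | skip, Q, σ => Q σ
  | assign r x, Q, σ => x.Fits W σ ∧ Q (σ.setReg r (x.eval σ))
  | store a idx x, Q, σ => idx.Fits W σ ∧ x.Fits W σ ∧ Q (σ.setArr a (idx.eval σ) (x.eval σ))
  | seq p q, Q, σ => p.wp W (q.wp W Q) σ
  | ite c p q, Q, σ => c.Fits W σ ∧ (c.eval σ ≠ 0 → p.wp W Q σ) ∧ (c.eval σ = 0 → q.wp W Q σ)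
  | loop _ _, _, _ => False

/-- The longest running time of a program without loops. -/
def maxTime : Prog → ℕ
  | skip => 1
  | assign _ x => x.time + 1
  | store _ idx x => idx.time + x.time + 1
  | seq p q => p.maxTime + q.maxTime
  | ite c p q => c.time + 1 + max p.maxTime q.maxTime
  | loop _ _ => 0

end Prog

/-- The lists `regs` and `arrs` are read off the syntax, so for a concrete program the question
whether some data stay untouched is decidable. All later proofs obtain preservation in this way. -/
theorem Run.frame {W : ℕ} {p : Prog} {σ τ : Store} {T : ℕ} (h : Run W p σ T τ) :
    p.Frame σ τ := by
  induction h with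
  | skip σ => exact Prog.Frame.refl _ _
  | assign σ r x _ =>
    refine ⟨fun r' hr => ?_, fun a _ => rfl⟩
    simp only [Prog.regs, List.mem_singleton] at hr
    simp [hr]
  | store σ a idx x _ _ =>
    refine ⟨fun r' hr => rfl, fun a ha => ?_⟩
    simp only [Prog.arrs, List.mem_singleton] at ha
    simp [ha]
  | seq p q σ₀ σ₁ σ₂ T₁ T₂ _ _ ih₁ ih₂ =>
    simp only [Prog.Frame, Prog.regs, Prog.arrs, List.mem_append, not_or] at *
    exact ⟨fun r hr => (ih₂.1 r hr.2).trans (ih₁.1 r hr.1),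
      fun r hr => (ih₂.2 r hr.2).trans (ih₁.2 r hr.1)⟩
  | iteTrue c p q σ τ T _ _ _ ih =>
    simp only [Prog.Frame, Prog.regs, Prog.arrs, List.mem_append, not_or] at *
    exact ⟨fun r hr => ih.1 r hr.1, fun r hr => ih.2 r hr.1⟩
  | iteFalse c p q σ τ T _ _ _ ih =>
    simp only [Prog.Frame, Prog.regs, Prog.arrs, List.mem_append, not_or] at *
    exact ⟨fun r hr => ih.1 r hr.2, fun r hr => ih.2 r hr.2⟩
  | loopDone c p σ _ _ => exact Prog.Frame.refl _ _
  | loopStep c p σ₀ σ₁ σ₂ T₁ T₂ _ _ _ _ ih₁ ih₂ => exact Prog.Frame.trans ih₁ ih₂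

/-- Started in `σ`, the program halts within `n` steps in a store that satisfies `Q`. -/
def Does (W : ℕ) (p : Prog) (σ : Store) (n : ℕ) (Q : Store → Prop) : Prop :=
  ∃ T τ, Run W p σ T τ ∧ T ≤ n ∧ Q τ

namespace Does

variable {W : ℕ} {p q : Prog} {σ : Store} {n m : ℕ} {Q Q' : Store → Prop}

theorem mono (h : Does W p σ n Q) (hn : n ≤ m) (hQ : ∀ τ, p.Frame σ τ → Q τ → Q' τ) :
    Does W p σ m Q' := by
  obtain ⟨T, τ, h1, h2, h3⟩ := h
  exact ⟨T, τ, h1, h2.trans hn, hQ τ h1.frame h3⟩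

theorem seq (h : Does W p σ n Q) (h' : ∀ τ, p.Frame σ τ → Q τ → Does W q τ m Q') :
    Does W (.seq p q) σ (n + m) Q' := by
  obtain ⟨T, τ, h1, h2, h3⟩ := h
  obtain ⟨T', τ', h1', h2', h3'⟩ := h' τ h1.frame h3
  exact ⟨_, τ', .seq _ _ _ _ _ _ _ h1 h1', by omega, h3'⟩

/-- The value `False` of `wp` on loops is what makes the entry `0` of `maxTime` for loops harmless.
For loop-free code correctness becomes a formula about the initial store, and the time bound a
closed numeral. -/
theorem exists_of_wp (p : Prog) : ∀ (σ : Store) (Q : Store → Prop), p.wp W Q σ →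
    Does W p σ p.maxTime Q := by
  induction p with
  | skip => exact fun σ Q h => ⟨1, σ, .skip σ, le_rfl, h⟩
  | assign r x => exact fun σ Q h => ⟨_, _, .assign σ r x h.1, le_rfl, h.2⟩
  | store a idx x => exact fun σ Q h => ⟨_, _, .store σ a idx x h.1 h.2.1, le_rfl, h.2.2⟩
  | seq p q ihp ihq => exact fun σ Q h => (ihp σ _ h).seq fun τ _ hτ => ihq τ Q hτ
  | ite c p q ihp ihq =>
    intro σ Q h
    by_cases hc : c.eval σ = 0
    · obtain ⟨T, τ, h1, h2, h3⟩ := ihq σ Q (h.2.2 hc)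
      refine ⟨_, τ, .iteFalse _ _ _ _ _ _ h.1 hc h1, ?_, h3⟩
      simp only [Prog.maxTime]
      have := le_max_right p.maxTime q.maxTime
      omega
    · obtain ⟨T, τ, h1, h2, h3⟩ := ihp σ Q (h.2.1 hc)
      refine ⟨_, τ, .iteTrue _ _ _ _ _ _ h.1 hc h1, ?_, h3⟩
      simp only [Prog.maxTime]
      have := le_max_left p.maxTime q.maxTime
      omega
  | loop c p _ => exact fun σ Q h => h.elim

theorem of_wp (h : p.wp W Q σ) (hn : p.maxTime ≤ n) : Does W p σ n Q :=
  (exists_of_wp p σ Q h).mono hn fun _ _ h => h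

/-- Loops with an invariant that bounds the number of remaining rounds. -/
theorem loop {c : Expr} {b : ℕ} {σ₀ : Store} (Inv : ℕ → Store → Prop) (h0 : Inv n σ₀)
    (step : ∀ k σ, p.Frame σ₀ σ → Inv k σ → c.Fits W σ ∧
      (c.eval σ ≠ 0 → ∃ k' < k, Does W p σ b (Inv k')) ∧ (c.eval σ = 0 → Q σ)) :
    Does W (.loop c p) σ₀ (n * (c.time + 1 + b) + (c.time + 1)) Q := by
  -- The frame relative to the store before the first round is carried along, so that invariants
  -- need not mention what the body leaves unchanged.
  suffices H : ∀ n σ, p.Frame σ₀ σ → Inv n σ →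
      Does W (.loop c p) σ (n * (c.time + 1 + b) + (c.time + 1)) Q from
    H n σ₀ (Prog.Frame.refl _ _) h0
  intro n
  induction n using Nat.strong_induction_on with
  | _ n ih =>
    intro σ hF hI
    obtain ⟨hfit, hstep, hdone⟩ := step n σ hF hI
    by_cases hc : c.eval σ = 0
    · exact ⟨_, σ, .loopDone _ _ _ hfit hc, by omega, hdone hc⟩
    · obtain ⟨k, hk, T, τ, h1, h2, h3⟩ := hstep hc
      obtain ⟨T', τ', h1', h2', h3'⟩ := ih k hk τ (hF.trans h1.frame) h3
      refine ⟨_, τ', .loopStep _ _ _ _ _ _ _ hfit hc h1 h1', ?_, h3'⟩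
      have : (k + 1) * (c.time + 1 + b) ≤ n * (c.time + 1 + b) := Nat.mul_le_mul_right _ hk
      rw [Nat.succ_mul] at this
      omega

end Does

/-! ## The program

Nodes are numbered `0, …, V - 1`: the levels of the first covariate, those of the second
covariate, and the two hubs. Arc `a` has the residual arcs `2 * a` (forward) and `2 * a + 1`
(backward). The level node `v` belongs to the arcs `2 * v` (from its hub) and `2 * v + 1` (to its
hub); the nonempty level-intersections get the arc numbers from `2 * (k₁ + k₂)` on. -/

notation:65 x:65 " +ᵉ " y:66 => Expr.op Op.add x y
notation:65 x:65 " -ᵉ " y:66 => Expr.op Op.sub x y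
notation:70 x:70 " *ᵉ " y:71 => Expr.op Op.mul x y
notation:70 x:70 " /ᵉ " y:71 => Expr.op Op.div x y
notation:50 x:51 " <ᵉ " y:51 => Expr.op Op.lt x y
notation:50 x:51 " =ᵉ " y:51 => Expr.op Op.eq x y
notation:40 r:41 " ←ᵉ " x:41 => Prog.assign r x
notation:30 p:31 " ;; " q:30 => Prog.seq p q

notation "r_nT" => (0 : ℕ)
notation "r_nC" => (1 : ℕ)
notation "r_k₁" => (2 : ℕ)
notation "r_k₂" => (3 : ℕ)
notation "r_stride" => (4 : ℕ)
notation "r_arcs" => (5 : ℕ)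
notation "r_nodes" => (6 : ℕ)
notation "r_left" => (7 : ℕ)
notation "r_found" => (8 : ℕ)
notation "r_raise" => (9 : ℕ)
notation "r_qh" => (10 : ℕ)
notation "r_qt" => (11 : ℕ)
notation "r_k" => (12 : ℕ)
notation "r_v" => (13 : ℕ)
notation "r_cur" => (14 : ℕ)
notation "r_r" => (15 : ℕ)
notation "r_h" => (16 : ℕ)
notation "r_s" => (17 : ℕ)
notation "r_t" => (18 : ℕ)
notation "r_c" => (19 : ℕ)

notation "a_treat₁" => (0 : ℕ)
notation "a_treat₂" => (1 : ℕ)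
notation "a_ctrl₁" => (2 : ℕ)
notation "a_ctrl₂" => (3 : ℕ)
notation "a_sel" => (4 : ℕ)
notation "a_exc₁" => (5 : ℕ)
notation "a_def₁" => (6 : ℕ)
notation "a_exc₂" => (7 : ℕ)
notation "a_def₂" => (8 : ℕ)
notation "a_rem" => (9 : ℕ)
notation "a_hd" => (10 : ℕ)
notation "a_rc" => (11 : ℕ)
notation "a_adj" => (12 : ℕ)
notation "a_deg" => (13 : ℕ)
notation "a_resid" => (14 : ℕ)
notation "a_samp" => (15 : ℕ)
notation "a_cell" => (16 : ℕ)
notation "a_pi" => (17 : ℕ)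
notation "a_vis" => (18 : ℕ)
notation "a_par" => (19 : ℕ)
notation "a_queue" => (20 : ℕ)

namespace Code

/-- Adds an arc from node `s` to node `t` of cost `c`; the array `rc` keeps residual costs
plus one. -/
def addArc : Prog :=
  .store a_hd (.lit 2 *ᵉ .reg r_arcs) (.reg r_t) ;;
  .store a_hd (.lit 2 *ᵉ .reg r_arcs +ᵉ .lit 1) (.reg r_s) ;;
  .store a_rc (.lit 2 *ᵉ .reg r_arcs) (.lit 1 +ᵉ .reg r_c) ;;
  .store a_rc (.lit 2 *ᵉ .reg r_arcs +ᵉ .lit 1) (.lit 1 -ᵉ .reg r_c) ;;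
  .store a_adj (.reg r_s *ᵉ .reg r_stride +ᵉ .load a_deg (.reg r_s)) (.lit 2 *ᵉ .reg r_arcs) ;;
  .store a_deg (.reg r_s) (.load a_deg (.reg r_s) +ᵉ .lit 1) ;;
  .store a_adj (.reg r_t *ᵉ .reg r_stride +ᵉ .load a_deg (.reg r_t))
    (.lit 2 *ᵉ .reg r_arcs +ᵉ .lit 1) ;;
  .store a_deg (.reg r_t) (.load a_deg (.reg r_t) +ᵉ .lit 1) ;;
  r_arcs ←ᵉ .reg r_arcs +ᵉ .lit 1

def setup : Prog :=
  r_nodes ←ᵉ .reg r_k₁ +ᵉ .reg r_k₂ +ᵉ .lit 2 ;;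
  r_stride ←ᵉ .lit 4 *ᵉ (.reg r_k₁ +ᵉ .reg r_k₂) +ᵉ .lit 2 *ᵉ .reg r_nC ;;
  r_left ←ᵉ .reg r_nT

/-- Counts the treatment sample `v`. -/
def countBody : Prog :=
  .store a_rem (.load a_treat₁ (.reg r_v)) (.load a_rem (.load a_treat₁ (.reg r_v)) +ᵉ .lit 1) ;;
  .store a_rem (.reg r_k₁ +ᵉ .load a_treat₂ (.reg r_v))
    (.load a_rem (.reg r_k₁ +ᵉ .load a_treat₂ (.reg r_v)) +ᵉ .lit 1) ;;
  r_v ←ᵉ .reg r_v +ᵉ .lit 1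

def countLoop : Prog := .loop (.reg r_v <ᵉ .reg r_nT) countBody

/-- Adds the two arcs between the level node `v` and its hub. -/
def levelBody : Prog :=
  (r_h ←ᵉ .reg r_k₁ +ᵉ .reg r_k₂ +ᵉ (.lit 1 -ᵉ (.reg r_v <ᵉ .reg r_k₁)) ;;
    r_c ←ᵉ .lit 1 ;; r_s ←ᵉ .reg r_h ;; r_t ←ᵉ .reg r_v ;;
    .store a_resid (.lit 2 *ᵉ .reg r_arcs) (.reg r_nT +ᵉ .lit 1)) ;;
  addArc ;;
  (r_s ←ᵉ .reg r_v ;; r_t ←ᵉ .reg r_h ;;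
    .store a_resid (.lit 2 *ᵉ .reg r_arcs) (.reg r_nT +ᵉ .lit 1)) ;;
  addArc ;;
  r_v ←ᵉ .reg r_v +ᵉ .lit 1

def levelLoop : Prog := .loop (.reg r_v <ᵉ (.reg r_k₁ +ᵉ .reg r_k₂)) levelBody

/-- Files the control sample `v` under the arc of its level-intersection, which is created if it
does not exist yet. -/
def cellBody : Prog :=
  r_h ←ᵉ .load a_ctrl₁ (.reg r_v) *ᵉ .reg r_k₂ +ᵉ .load a_ctrl₂ (.reg r_v) ;;
  .ite (.load a_cell (.reg r_h) =ᵉ .lit 0)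
    (.store a_cell (.reg r_h) (.reg r_arcs) ;;
      r_s ←ᵉ .load a_ctrl₁ (.reg r_v) ;; r_t ←ᵉ .reg r_k₁ +ᵉ .load a_ctrl₂ (.reg r_v) ;;
      addArc)
    .skip ;;
  r_r ←ᵉ .load a_cell (.reg r_h) ;;
  .store a_samp (.reg r_r *ᵉ .reg r_stride +ᵉ .load a_resid (.lit 2 *ᵉ .reg r_r)) (.reg r_v) ;;
  .store a_resid (.lit 2 *ᵉ .reg r_r) (.load a_resid (.lit 2 *ᵉ .reg r_r) +ᵉ .lit 1) ;;
  r_v ←ᵉ .reg r_v +ᵉ .lit 1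

def cellLoop : Prog := .loop (.reg r_v <ᵉ .reg r_nC) cellBody

def init : Prog :=
  (setup ;; r_v ←ᵉ .lit 0) ;; countLoop ;; r_v ←ᵉ .lit 0 ;; levelLoop ;;
    (r_v ←ᵉ .lit 0 ;; r_c ←ᵉ .lit 0) ;; cellLoop

/-- Raises the label of node `v` if the last search was unsuccessful and did not reach `v`, and
starts a new search from `v` if `v` has remaining supply. -/
def prepBody : Prog :=
  .store a_pi (.reg r_v)
    (.load a_pi (.reg r_v) +ᵉ .reg r_raise *ᵉ (.lit 1 -ᵉ .load a_vis (.reg r_v))) ;;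
  .store a_par (.reg r_v) (.lit 0) ;;
  .ite ((.reg r_v <ᵉ .reg r_k₁) *ᵉ (.lit 0 <ᵉ .load a_rem (.reg r_v)))
    (.store a_vis (.reg r_v) (.lit 1) ;; .store a_queue (.reg r_qt) (.reg r_v) ;;
      r_qt ←ᵉ .reg r_qt +ᵉ .lit 1)
    (.store a_vis (.reg r_v) (.lit 0)) ;;
  r_v ←ᵉ .reg r_v +ᵉ .lit 1

def prepLoop : Prog := .loop (.reg r_v <ᵉ .reg r_nodes) prepBody

/-- Looks at one residual arc of the first node of the queue, or removes this node. -/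
def searchBody : Prog :=
  r_cur ←ᵉ .load a_queue (.reg r_qh) ;;
  .ite (.reg r_k <ᵉ .load a_deg (.reg r_cur))
    (r_r ←ᵉ .load a_adj (.reg r_cur *ᵉ .reg r_stride +ᵉ .reg r_k) ;;
      r_h ←ᵉ .load a_hd (.reg r_r) ;;
      r_k ←ᵉ .reg r_k +ᵉ .lit 1 ;;
      .ite ((.load a_vis (.reg r_h) =ᵉ .lit 0) *ᵉ (.lit 0 <ᵉ .load a_resid (.reg r_r)) *ᵉ
          (.load a_pi (.reg r_cur) +ᵉ .load a_rc (.reg r_r) =ᵉ .load a_pi (.reg r_h) +ᵉ .lit 1))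
        (.store a_vis (.reg r_h) (.lit 1) ;; .store a_par (.reg r_h) (.reg r_r +ᵉ .lit 1) ;;
          .store a_queue (.reg r_qt) (.reg r_h) ;; r_qt ←ᵉ .reg r_qt +ᵉ .lit 1 ;;
          .ite (((.reg r_h <ᵉ .reg r_k₁) =ᵉ .lit 0) *ᵉ (.lit 0 <ᵉ .load a_rem (.reg r_h)))
            (r_found ←ᵉ .reg r_h) .skip)
        .skip)
    (r_qh ←ᵉ .reg r_qh +ᵉ .lit 1 ;; r_k ←ᵉ .lit 0)

def searchLoop : Prog := .loop (.reg r_qh <ᵉ .reg r_qt) searchBody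

def roundBody : Prog :=
  (r_v ←ᵉ .lit 0 ;; r_qt ←ᵉ .lit 0) ;; prepLoop ;;
    (r_raise ←ᵉ .lit 1 ;; r_qh ←ᵉ .lit 0 ;; r_k ←ᵉ .lit 0) ;; searchLoop

def roundLoop : Prog := .loop (.reg r_found =ᵉ .lit 0) roundBody

/-- Pushes one unit of flow along the search tree arc that enters node `v`. -/
def pushBody : Prog :=
  r_r ←ᵉ .load a_par (.reg r_v) -ᵉ .lit 1 ;;
  r_h ←ᵉ .reg r_r +ᵉ .lit 1 -ᵉ .lit 2 *ᵉ (.reg r_r -ᵉ .lit 2 *ᵉ (.reg r_r /ᵉ .lit 2)) ;;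
  .store a_resid (.reg r_r) (.load a_resid (.reg r_r) -ᵉ .lit 1) ;;
  .store a_resid (.reg r_h) (.load a_resid (.reg r_h) +ᵉ .lit 1) ;;
  r_s ←ᵉ .reg r_r /ᵉ .lit 2 ;;
  r_t ←ᵉ .reg r_r -ᵉ .lit 2 *ᵉ .reg r_s ;;
  .store a_sel
    (.load a_samp (.reg r_s *ᵉ .reg r_stride +ᵉ
        (.load a_resid (.lit 2 *ᵉ .reg r_s) -ᵉ .reg r_t)) +ᵉ
      .reg r_nC *ᵉ (.reg r_s <ᵉ .lit 2 *ᵉ (.reg r_k₁ +ᵉ .reg r_k₂)))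
    (.lit 1 -ᵉ .reg r_t) ;;
  r_v ←ᵉ .load a_hd (.reg r_h)

def pushLoop : Prog := .loop (.load a_par (.reg r_v)) pushBody

/-- Copies the flows on the arcs at a level. -/
def copyBody : Prog :=
  .store a_exc₁ (.reg r_v) (.load a_resid (.lit 4 *ᵉ .reg r_v +ᵉ .lit 1)) ;;
  .store a_def₁ (.reg r_v) (.load a_resid (.lit 4 *ᵉ .reg r_v +ᵉ .lit 3)) ;;
  .store a_def₂ (.reg r_v) (.load a_resid (.lit 4 *ᵉ (.reg r_k₁ +ᵉ .reg r_v) +ᵉ .lit 1)) ;;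
  .store a_exc₂ (.reg r_v) (.load a_resid (.lit 4 *ᵉ (.reg r_k₁ +ᵉ .reg r_v) +ᵉ .lit 3)) ;;
  r_v ←ᵉ .reg r_v +ᵉ .lit 1

def copyLoop : Prog := .loop (.reg r_v <ᵉ (.reg r_k₁ +ᵉ .reg r_k₂)) copyBody

/-- One iteration of the successive shortest path algorithm. -/
def body : Prog :=
  (r_found ←ᵉ .lit 0 ;; r_raise ←ᵉ .lit 0) ;; roundLoop ;;
  (.store a_rem (.reg r_found) (.load a_rem (.reg r_found) -ᵉ .lit 1) ;;
    r_v ←ᵉ .reg r_found) ;;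
  pushLoop ;;
  (.store a_rem (.reg r_v) (.load a_rem (.reg r_v) -ᵉ .lit 1) ;;
    r_left ←ᵉ .reg r_left -ᵉ .lit 1 ;; r_v ←ᵉ .lit 0) ;;
  copyLoop

end Code

/-! ## Graph search on numbered nodes and arcs -/

/-- The residual arc opposite to `r`. -/
def mate (r : ℕ) : ℕ := r + 1 - 2 * (r - 2 * (r / 2))

theorem mate_lt {r M : ℕ} (h : r < 2 * M) : mate r < 2 * M := by unfold mate; omega

theorem mate_mate (r : ℕ) : mate (mate r) = r := by unfold mate; omega

theorem mate_even (a : ℕ) : mate (2 * a) = 2 * a + 1 := by unfold mate; omega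

theorem mate_odd (a : ℕ) : mate (2 * a + 1) = 2 * a := by unfold mate; omega

/-- The data that a search reads: numbers of nodes and arcs, the stride of the adjacency table,
the number of supply nodes, heads, residual costs plus one, adjacency lists, residual capacities,
and remaining supplies and demands. -/
structure SearchData where
  V : ℕ
  M : ℕ
  B : ℕ
  k : ℕ
  hd : ℕ → ℕ
  rc : ℕ → ℕ
  adj : ℕ → ℕ → ℕ
  deg : ℕ → ℕ
  resid : ℕ → ℕ
  rem : ℕ → ℕ

def Store.searchData (σ : Store) : SearchData where
  V := σ.reg r_nodes
  M := σ.reg r_arcs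
  B := σ.reg r_stride
  k := σ.reg r_k₁
  hd := σ.arr a_hd
  rc := σ.arr a_rc
  adj v k := σ.arr a_adj (v * σ.reg r_stride + k)
  deg := σ.arr a_deg
  resid := σ.arr a_resid
  rem := σ.arr a_rem

namespace SearchData

variable (d : SearchData)

/-- The tail of a residual arc. -/
def tl (r : ℕ) : ℕ := d.hd (mate r)

def Supply (v : ℕ) : Prop := v < d.k ∧ 0 < d.rem v

def Demand (v : ℕ) : Prop := d.k ≤ v ∧ v < d.V ∧ 0 < d.rem v

/-- The residual arc `r` has positive capacity and reduced cost zero. -/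
def Usable (pi : ℕ → ℕ) (r : ℕ) : Prop :=
  0 < d.resid r ∧ pi (d.tl r) + d.rc r = pi (d.hd r) + 1

/-- The adjacency table is complete. -/
structure Graph : Prop where
  hd_lt : ∀ r < 2 * d.M, d.hd r < d.V
  adj_lt : ∀ v < d.V, ∀ k < d.deg v, d.adj v k < 2 * d.M
  tl_adj : ∀ v < d.V, ∀ k < d.deg v, d.tl (d.adj v k) = v
  adj_mem : ∀ r < 2 * d.M, ∃ k < d.deg (d.tl r), d.adj (d.tl r) k = r
  sum_deg : ∑ v ∈ Finset.range d.V, d.deg v = 2 * d.M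

/-- Distance labels: no negative reduced costs, label `0` at the supplies, label `D` at the
demands, and no label above `D`. -/
structure Labels (pi : ℕ → ℕ) (D : ℕ) : Prop where
  slack : ∀ r < 2 * d.M, 0 < d.resid r → pi (d.hd r) + 1 ≤ pi (d.tl r) + d.rc r
  sup : ∀ v, d.Supply v → pi v = 0
  dem : ∀ v, d.Demand v → pi v = D
  le : ∀ v < d.V, pi v ≤ D

/-- The state of the search: nodes `queue p` with `p < qh` are done, and of the node `queue qh`
the first `k` arcs are done; `found` is a reached demand node or `0`. -/
structure Search (pi vis par queue : ℕ → ℕ) (qh qt k found : ℕ) : Prop where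
  queue_lt : ∀ p < qt, queue p < d.V
  vis_queue : ∀ p < qt, vis (queue p) = 1
  inj : ∀ p < qt, ∀ p' < qt, queue p = queue p' → p = p'
  vis_cases : ∀ w < d.V, vis w = 0 ∨ (vis w = 1 ∧ ∃ p < qt, queue p = w)
  tree : ∀ p < qt, (par (queue p) = 0 ∧ d.Supply (queue p)) ∨ ∃ r, ∃ p' < p, r < 2 * d.M ∧
    par (queue p) = r + 1 ∧ d.hd r = queue p ∧ d.tl r = queue p' ∧ d.Usable pi r
  sup : ∀ w < d.V, d.Supply w → vis w = 1
  closed : ∀ p < qh, ∀ r < 2 * d.M, d.tl r = queue p → d.Usable pi r → vis (d.hd r) = 1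
  current : qh < qt → ∀ k' < k, d.Usable pi (d.adj (queue qh) k') →
    vis (d.hd (d.adj (queue qh) k')) = 1
  k_le : qh < qt → k ≤ d.deg (queue qh)
  qh_le : qh ≤ qt
  found : (found = 0 ∧ ∀ w, d.Demand w → vis w = 0) ∨ (d.Demand found ∧ vis found = 1)

variable {d} {pi vis par queue : ℕ → ℕ} {qh qt k found : ℕ}

/-- All positions of the adjacency list of the first node have been inspected; since that list is
complete, the statement about positions becomes the statement `closed` about arcs. -/
theorem Search.advance (h : d.Search pi vis par queue qh qt k found) (hG : d.Graph)
    (hq : qh < qt) (hk : d.deg (queue qh) ≤ k) :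
    d.Search pi vis par queue (qh + 1) qt 0 found := by
  refine { h with closed := ?_, current := ?_, k_le := ?_, qh_le := hq }
  · intro p hp r hr ht hu
    rcases Nat.lt_succ_iff_lt_or_eq.1 hp with hp | rfl
    · exact h.closed p hp r hr ht hu
    · obtain ⟨k', hk', e⟩ := hG.adj_mem r hr
      rw [ht] at hk' e
      rw [← e] at hu ⊢
      exact h.current hq k' (by omega) hu
  · exact fun _ k' hk' => absurd hk' (Nat.not_lt_zero _)
  · exact fun _ => Nat.zero_le _

theorem Search.pass (h : d.Search pi vis par queue qh qt k found) (hk : k < d.deg (queue qh))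
    (hu : d.Usable pi (d.adj (queue qh) k) → vis (d.hd (d.adj (queue qh) k)) = 1) :
    d.Search pi vis par queue qh qt (k + 1) found := by
  refine { h with current := ?_, k_le := fun _ => hk }
  intro hq k' hk'
  rcases Nat.lt_succ_iff_lt_or_eq.1 hk' with hk' | rfl
  · exact h.current hq k' hk'
  · exact hu

/-- The new queue entry hangs below position `qh`, so tree arcs always point from smaller to larger
positions; this later makes the way back terminate and repeat no node. The entry is new because its
mark was still `0`. A second demand may overwrite `found`, which does no harm. -/
theorem Search.visit (h : d.Search pi vis par queue qh qt k found) (hG : d.Graph)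
    (hq : qh < qt) (hk : k < d.deg (queue qh)) {r : ℕ} (hr : d.adj (queue qh) k = r)
    (hv : vis (d.hd r) = 0) (hu : d.Usable pi r) {found' : ℕ}
    (hf : (¬ d.Demand (d.hd r) ∧ found' = found) ∨ (d.Demand (d.hd r) ∧ found' = d.hd r)) :
    d.Search pi (Function.update vis (d.hd r) 1) (Function.update par (d.hd r) (r + 1))
      (Function.update queue qt (d.hd r)) qh (qt + 1) (k + 1) found' := by
  have hcur := h.queue_lt qh hq
  have hr2 : r < 2 * d.M := hr ▸ hG.adj_lt _ hcur k hk
  have htl : d.tl r = queue qh := hr ▸ hG.tl_adj _ hcur k hk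
  have hne : ∀ p < qt, queue p ≠ d.hd r := fun p hp e => by
    have := h.vis_queue p hp
    rw [e, hv] at this
    omega
  have hold : ∀ p < qt, Function.update queue qt (d.hd r) p = queue p := fun p hp =>
    Function.update_of_ne (by omega) _ _
  have hnew : Function.update queue qt (d.hd r) qt = d.hd r := Function.update_self _ _ _
  have hmono : ∀ w, vis w = 1 → Function.update vis (d.hd r) 1 w = 1 := fun w hw => by
    by_cases e : w = d.hd r
    · rw [e, Function.update_self]
    · rw [Function.update_of_ne e, hw]
  refine ⟨?_, ?_, ?_, ?_, ?_, ?_, ?_, ?_, ?_, ?_, ?_⟩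
  · intro p hp
    rcases Nat.lt_succ_iff_lt_or_eq.1 hp with hp | rfl
    · rw [hold p hp]; exact h.queue_lt p hp
    · rw [hnew]; exact hG.hd_lt r hr2
  · intro p hp
    rcases Nat.lt_succ_iff_lt_or_eq.1 hp with hp | rfl
    · rw [hold p hp]; exact hmono _ (h.vis_queue p hp)
    · rw [hnew, Function.update_self]
  · intro p hp p' hp' e
    rcases Nat.lt_succ_iff_lt_or_eq.1 hp with hp | rfl <;>
    rcases Nat.lt_succ_iff_lt_or_eq.1 hp' with hp' | rfl
    · rw [hold p hp, hold p' hp'] at e; exact h.inj p hp p' hp' e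
    · rw [hold p hp, hnew] at e; exact absurd e (hne p hp)
    · rw [hold p' hp', hnew] at e; exact absurd e.symm (hne p' hp')
    · rfl
  · intro w hw
    by_cases e : w = d.hd r
    · subst e; exact .inr ⟨Function.update_self _ _ _, qt, by omega, hnew⟩
    · rw [Function.update_of_ne e]
      rcases h.vis_cases w hw with h1 | ⟨h1, p, hp, h2⟩
      · exact .inl h1
      · exact .inr ⟨h1, p, by omega, by rw [hold p hp, h2]⟩
  · intro p hp
    rcases Nat.lt_succ_iff_lt_or_eq.1 hp with hp | rfl
    · rw [hold p hp, Function.update_of_ne (hne p hp)]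
      rcases h.tree p hp with h1 | ⟨r', p', h1, h2, h3, h4, h5, h6⟩
      · exact .inl h1
      · exact .inr ⟨r', p', h1, h2, h3, h4, by rw [hold p' (by omega), h5], h6⟩
    · rw [hnew, Function.update_self]
      exact .inr ⟨r, qh, hq, hr2, rfl, rfl, by rw [hold qh hq, htl], hu⟩
  · exact fun w hw hs => hmono _ (h.sup w hw hs)
  · intro p hp r' hr' ht hu'
    rw [hold p (hp.trans hq)] at ht
    exact hmono _ (h.closed p hp r' hr' ht hu')
  · intro _ k' hk'
    rw [hold qh hq]
    rcases Nat.lt_succ_iff_lt_or_eq.1 hk' with hk' | rfl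
    · exact fun hu' => hmono _ (h.current hq k' hk' hu')
    · rw [hr]; exact fun _ => Function.update_self _ _ _
  · intro _; rw [hold qh hq]; exact hk
  · omega
  · rcases hf with ⟨hn, rfl⟩ | ⟨hd, rfl⟩
    · rcases h.found with ⟨h1, h2⟩ | ⟨h1, h2⟩
      · refine .inl ⟨h1, fun w hw => ?_⟩
        rw [Function.update_of_ne (fun e : w = d.hd r => hn (e ▸ hw)), h2 w hw]
      · exact .inr ⟨h1, hmono _ h2⟩
    · exact .inr ⟨hd, Function.update_self _ _ _⟩

/-- Every arc is looked at once, and every node is removed from the queue once. -/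
theorem Search.work_lt (h : d.Search pi vis par queue qh qt k found) (hG : d.Graph)
    (hq : qh < qt) :
    (∑ p ∈ Finset.range qh, (d.deg (queue p) + 1)) + k < 2 * d.M + d.V := by
  -- The queue is injective, so the nodes up to the current one are distinct and their degrees are
  -- part of the total degree `2 * M`.
  have h1 : (∑ p ∈ Finset.range (qh + 1), (d.deg (queue p) + 1)) ≤
      ∑ v ∈ Finset.range d.V, (d.deg v + 1) := by
    rw [← Finset.sum_image (s := Finset.range (qh + 1)) (g := queue)
      (f := fun v => d.deg v + 1)]
    · apply Finset.sum_le_sum_of_subset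
      intro v hv
      obtain ⟨p, hp, rfl⟩ := Finset.mem_image.1 hv
      exact Finset.mem_range.2 (h.queue_lt p (by have := Finset.mem_range.1 hp; omega))
    · intro p hp p' hp' e
      simp only [Finset.coe_range, Set.mem_Iio] at hp hp'
      exact h.inj p (by omega) p' (by omega) e
  rw [Finset.sum_range_succ, Finset.sum_add_distrib (s := Finset.range d.V), hG.sum_deg] at h1
  have := h.k_le hq
  simp only [Finset.sum_const, Finset.card_range, smul_eq_mul, mul_one] at h1
  omega

theorem Search.queue_le (h : d.Search pi vis par queue qh qt k found) : qt ≤ d.V := by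
  have : (Finset.range qt).card ≤ (Finset.range d.V).card :=
    Finset.card_le_card_of_injOn queue
      (fun p hp => by simpa using h.queue_lt p (by simpa using hp))
      (fun p hp p' hp' e => h.inj p (by simpa using hp) p' (by simpa using hp') e)
  simpa using this

/-- After an unsuccessful search the labels of the nodes that were not reached are raised. -/
theorem Search.raise (h : d.Search pi vis par queue qt qt k 0) (hG : d.Graph) {D : ℕ}
    (hD : d.Labels pi D) (hk : d.k ≤ d.V) (hk0 : 0 < d.k) :
    d.Labels (fun w => pi w + 1 * (1 - vis w)) (D + 1) := by
  have hdem : ∀ w, d.Demand w → vis w = 0 := by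
    rcases h.found with ⟨-, h⟩ | ⟨h, -⟩
    · exact h
    · have := h.1; omega
  refine ⟨fun r hr hpos => ?_, fun v hv => ?_, fun v hv => ?_, fun v hv => ?_⟩
  · have hs := hD.slack r hr hpos
    have ht : d.tl r < d.V := hG.hd_lt _ (mate_lt hr)
    -- If the tail is unreached, its own label rises as well. If the tail is reached and the arc
    -- usable, the head is reached and stays put. Otherwise the inequality is strict, and by
    -- integrality there is room for one more unit at the head.
    rcases h.vis_cases _ ht with h0 | ⟨h1, p, hp, e⟩
    · rw [h0]; omega
    · by_cases hu : d.Usable pi r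
      · rw [h.closed p hp r hr e.symm hu]; omega
      · have : pi (d.tl r) + d.rc r ≠ pi (d.hd r) + 1 := fun e => hu ⟨hpos, e⟩
        omega
  · have := hv.1
    rw [h.sup v (by omega) hv, hD.sup v hv]
  · rw [hdem v hv, hD.dem v hv]
  · have := hD.le v hv
    omega

theorem Labels.congr {D : ℕ} {pi' : ℕ → ℕ} (h : d.Labels pi D) (hG : d.Graph) (hk : d.k ≤ d.V)
    (e : ∀ w < d.V, pi' w = pi w) : d.Labels pi' D := by
  refine ⟨fun r hr hp => ?_, fun v hv => ?_, fun v hv => ?_, fun v hv => ?_⟩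
  · rw [e _ (hG.hd_lt r hr), e (d.tl r) (hG.hd_lt _ (mate_lt hr))]; exact h.slack r hr hp
  · rw [e v (hv.1.trans_le hk)]; exact h.sup v hv
  · rw [e v hv.2.1]; exact h.dem v hv
  · rw [e v hv]; exact h.le v hv

end SearchData

/-! ### Bounds for a search, and its starting configuration -/

namespace SearchData

/-- All numbers that occur in a search fit into a word. -/
structure Small (W : ℕ) (d : SearchData) : Prop where
  size : d.V * d.B + 2 * d.M + d.V + 100 ≤ W
  resid : ∀ r < 2 * d.M, d.resid r ≤ W
  rem : ∀ v < d.V, d.rem v ≤ W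
  rc : ∀ r < 2 * d.M, d.rc r ≤ 2

theorem Graph.deg_le {d : SearchData} (h : d.Graph) {v : ℕ} (hv : v < d.V) :
    d.deg v ≤ 2 * d.M := by
  rw [← h.sum_deg]
  exact Finset.single_le_sum (f := d.deg) (fun _ _ => Nat.zero_le _) (Finset.mem_range.2 hv)

/-- The state of the preparation of a search when the nodes below `v` are done. -/
structure Prep (d : SearchData) (v : ℕ) (vis par queue : ℕ → ℕ) (qt : ℕ) : Prop where
  queue_lt : ∀ p < qt, queue p < v
  vis_queue : ∀ p < qt, vis (queue p) = 1
  inj : ∀ p < qt, ∀ p' < qt, queue p = queue p' → p = p'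
  vis_cases : ∀ w < v, vis w = 0 ∨ (vis w = 1 ∧ ∃ p < qt, queue p = w)
  par : ∀ w < v, par w = 0
  sup_queue : ∀ p < qt, d.Supply (queue p)
  sup : ∀ w < v, d.Supply w → vis w = 1
  qt_le : qt ≤ v

variable {d : SearchData} {v qt : ℕ} {vis par queue : ℕ → ℕ}

theorem Prep.push (h : d.Prep v vis par queue qt) (hv : d.Supply v) :
    d.Prep (v + 1) (Function.update vis v 1) (Function.update par v 0)
      (Function.update queue qt v) (qt + 1) := by
  have hold : ∀ p < qt, Function.update queue qt v p = queue p := fun p hp =>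
    Function.update_of_ne (by omega) _ _
  have hnew : Function.update queue qt v qt = v := Function.update_self _ _ _
  have hvis : ∀ w < v, Function.update vis v 1 w = vis w := fun w hw =>
    Function.update_of_ne (by omega) _ _
  refine ⟨fun p hp => ?_, fun p hp => ?_, fun p hp p' hp' e => ?_, fun w hw => ?_,
    fun w hw => ?_, fun p hp => ?_, fun w hw hs => ?_, by have := h.qt_le; omega⟩
  · rcases Nat.lt_succ_iff_lt_or_eq.1 hp with hp | rfl
    · rw [hold p hp]; have := h.queue_lt p hp; omega
    · rw [hnew]; omega
  · rcases Nat.lt_succ_iff_lt_or_eq.1 hp with hp | rfl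
    · rw [hold p hp, hvis _ (h.queue_lt p hp), h.vis_queue p hp]
    · rw [hnew, Function.update_self]
  · rcases Nat.lt_succ_iff_lt_or_eq.1 hp with hp | rfl <;>
    rcases Nat.lt_succ_iff_lt_or_eq.1 hp' with hp' | rfl
    · rw [hold p hp, hold p' hp'] at e; exact h.inj p hp p' hp' e
    · rw [hold p hp, hnew] at e; have := h.queue_lt p hp; omega
    · rw [hold p' hp', hnew] at e; have := h.queue_lt p' hp'; omega
    · rfl
  · rcases Nat.lt_succ_iff_lt_or_eq.1 hw with hw | rfl
    · rw [hvis w hw]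
      rcases h.vis_cases w hw with h1 | ⟨h1, p, hp, h2⟩
      · exact .inl h1
      · exact .inr ⟨h1, p, by omega, by rw [hold p hp, h2]⟩
    · exact .inr ⟨Function.update_self _ _ _, qt, by omega, hnew⟩
  · rcases Nat.lt_succ_iff_lt_or_eq.1 hw with hw | rfl
    · rw [Function.update_of_ne (by omega), h.par w hw]
    · exact Function.update_self _ _ _
  · rcases Nat.lt_succ_iff_lt_or_eq.1 hp with hp | rfl
    · rw [hold p hp]; exact h.sup_queue p hp
    · rw [hnew]; exact hv
  · rcases Nat.lt_succ_iff_lt_or_eq.1 hw with hw | rfl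
    · rw [hvis w hw]; exact h.sup w hw hs
    · exact Function.update_self _ _ _

theorem Prep.pass (h : d.Prep v vis par queue qt) (hv : ¬ d.Supply v) :
    d.Prep (v + 1) (Function.update vis v 0) (Function.update par v 0) queue qt := by
  have hvis : ∀ w < v, Function.update vis v 0 w = vis w := fun w hw =>
    Function.update_of_ne (by omega) _ _
  refine ⟨fun p hp => ?_, fun p hp => ?_, h.inj, fun w hw => ?_, fun w hw => ?_, h.sup_queue,
    fun w hw hs => ?_, h.qt_le.trans (Nat.le_succ v)⟩
  · have := h.queue_lt p hp; omega
  · rw [hvis _ (h.queue_lt p hp), h.vis_queue p hp]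
  · rcases Nat.lt_succ_iff_lt_or_eq.1 hw with hw | rfl
    · rw [hvis w hw]; exact h.vis_cases w hw
    · exact .inl (Function.update_self _ _ _)
  · rcases Nat.lt_succ_iff_lt_or_eq.1 hw with hw | rfl
    · rw [Function.update_of_ne (by omega), h.par w hw]
    · exact Function.update_self _ _ _
  · rcases Nat.lt_succ_iff_lt_or_eq.1 hw with hw | rfl
    · rw [hvis w hw]; exact h.sup w hw hs
    · exact absurd hs hv

/-- The prepared queue consists of supplies only, and supplies are numbered below `k` while demands
are not; hence no demand is marked yet and `found` may start at `0`. -/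
theorem Prep.search (h : d.Prep d.V vis par queue qt) (pi : ℕ → ℕ) :
    d.Search pi vis par queue 0 qt 0 0 where
  queue_lt := h.queue_lt
  vis_queue := h.vis_queue
  inj := h.inj
  vis_cases := h.vis_cases
  tree p hp := .inl ⟨h.par _ (h.queue_lt p hp), h.sup_queue p hp⟩
  sup := h.sup
  closed p hp := absurd hp (Nat.not_lt_zero _)
  current _ k' hk' := absurd hk' (Nat.not_lt_zero _)
  k_le _ := Nat.zero_le _
  qh_le := Nat.zero_le _
  found := .inl ⟨rfl, fun w hw => by
    rcases h.vis_cases w hw.2.1 with h1 | ⟨-, p, hp, rfl⟩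
    · exact h1
    · exact absurd (h.sup_queue p hp).1 (not_lt.2 hw.1)⟩

end SearchData

/-! ### The preparation sweep and the breadth-first search -/

namespace Code

/-- The raise that an unsuccessful search calls for is postponed to this sweep. Each node is raised
just before its old mark is overwritten, so the final labels are expressed by the marks of the
initial store. -/
theorem prepLoop_does {W : ℕ} {σ₀ : Store} (hS : σ₀.searchData.Small W)
    (hkV : σ₀.reg r_k₁ ≤ σ₀.reg r_nodes)
    (hpi : ∀ v < σ₀.reg r_nodes, σ₀.arr a_pi v ≤ 10)
    (hvis : ∀ v < σ₀.reg r_nodes, σ₀.arr a_vis v ≤ 1)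
    (hraise : σ₀.reg r_raise ≤ 1) (hv : σ₀.reg r_v = 0) (hqt : σ₀.reg r_qt = 0) :
    Does W prepLoop σ₀ (σ₀.reg r_nodes * 50 + 4) fun τ =>
      σ₀.searchData.Prep (σ₀.reg r_nodes) (τ.arr a_vis) (τ.arr a_par) (τ.arr a_queue)
        (τ.reg r_qt) ∧
      ∀ w < σ₀.reg r_nodes, τ.arr a_pi w =
        σ₀.arr a_pi w + σ₀.reg r_raise * (1 - σ₀.arr a_vis w) := by
  set d := σ₀.searchData with hd
  have hsize := hS.size
  refine (Does.loop (b := 46) (n := σ₀.reg r_nodes) (fun n σ =>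
    d.Prep (σ.reg r_v) (σ.arr a_vis) (σ.arr a_par) (σ.arr a_queue) (σ.reg r_qt) ∧
    (∀ w < σ.reg r_v, σ.arr a_pi w =
      σ₀.arr a_pi w + σ₀.reg r_raise * (1 - σ₀.arr a_vis w)) ∧
    (∀ w ≥ σ.reg r_v, σ.arr a_pi w = σ₀.arr a_pi w ∧ σ.arr a_vis w = σ₀.arr a_vis w) ∧
    σ.reg r_v + n = d.V) ?_ ?_).mono (m := σ₀.reg r_nodes * 50 + 4)
      (by simp only [Expr.time]; omega) (fun _ _ h => h)
  · rw [hv, hqt]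
    exact ⟨⟨by simp, by simp, by simp, by simp, by simp, by simp, by simp, le_rfl⟩, by simp,
      by simp, by simp [hd, Store.searchData]⟩
  intro n σ hF ⟨hP, hlt, hge, hn⟩
  have e5 : σ.arr a_rem = d.rem := hF.2 _ (by decide)
  have e7 : σ.reg r_k₁ = d.k := hF.1 _ (by decide)
  have e8 : σ.reg r_nodes = d.V := hF.1 _ (by decide)
  have e9 : σ.reg r_raise = σ₀.reg r_raise := hF.1 _ (by decide)
  have hkV' : d.k ≤ d.V := hkV
  have hqt := hP.qt_le
  refine ⟨?_, fun hc => ?_, fun hc => ?_⟩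
  · simp only [Expr.Fits, Op.eval_lt, Expr.eval]
    exact ⟨by omega, by omega, ite_one_zero_le (by omega) _⟩
  · have hq : σ.reg r_v < d.V := by
      by_contra h; simp [Expr.eval, e8] at hc; omega
    refine ⟨n - 1, by omega, Does.of_wp ?_ (by decide)⟩
    have b1 : σ₀.arr a_pi (σ.reg r_v) ≤ 10 := hpi _ hq
    have b2 : σ₀.arr a_vis (σ.reg r_v) ≤ 1 := hvis _ hq
    have b3 : d.rem (σ.reg r_v) ≤ W := hS.rem _ hq
    have b4 : σ₀.reg r_raise * (1 - σ₀.arr a_vis (σ.reg r_v)) ≤ 1 * 1 :=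
      Nat.mul_le_mul hraise (by omega)
    obtain ⟨g1, g2⟩ := hge _ le_rfl
    have hlt' : ∀ w ≤ σ.reg r_v, Function.update (σ.arr a_pi) (σ.reg r_v)
        (σ₀.arr a_pi (σ.reg r_v) + σ₀.reg r_raise * (1 - σ₀.arr a_vis (σ.reg r_v))) w =
          σ₀.arr a_pi w + σ₀.reg r_raise * (1 - σ₀.arr a_vis w) := fun w hw => by
      rcases Nat.lt_or_eq_of_le hw with hw | rfl
      · rw [Function.update_of_ne (by omega), hlt w hw]
      · rw [Function.update_self]
    have hge' : ∀ x y w, σ.reg r_v < w →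
        Function.update (σ.arr a_pi) (σ.reg r_v) x w = σ₀.arr a_pi w ∧
        Function.update (σ.arr a_vis) (σ.reg r_v) y w = σ₀.arr a_vis w := fun x y w hw => by
      rw [Function.update_of_ne (by omega), Function.update_of_ne (by omega)]
      exact hge w (by omega)
    simp [prepBody, Prog.wp, Expr.Fits, Expr.eval, e5, e7, e9, g1, g2]
    repeat' (first | exact hlt' | exact hge' _ _ | apply And.intro | intro)
    all_goals first | omega | (split_ifs <;> omega) | skip
    · exact hP.push ⟨‹_›, ‹_›⟩
    · exact hP.pass fun h =>
        absurd (‹0 < d.rem (σ.reg r_v) → d.k ≤ σ.reg r_v› h.2) (not_le.2 h.1)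
  · have : σ.reg r_v = d.V := by
      by_contra h; simp [Expr.eval, e8] at hc; omega
    rw [this] at hP hlt
    exact ⟨hP, hlt⟩

/-- Progress is measured by the inspected adjacency positions plus the removed nodes. It grows by
one in each round and stays at most `2 * M + V`, which makes the search linear. -/
theorem searchLoop_does {W : ℕ} {σ₀ : Store} (hG : σ₀.searchData.Graph)
    (hS : σ₀.searchData.Small W)
    (hkV : σ₀.reg r_k₁ ≤ σ₀.reg r_nodes)
    (hpi : ∀ v < σ₀.reg r_nodes, σ₀.arr a_pi v ≤ 10)
    (hI : σ₀.searchData.Search (σ₀.arr a_pi) (σ₀.arr a_vis) (σ₀.arr a_par) (σ₀.arr a_queue)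
      0 (σ₀.reg r_qt) 0 (σ₀.reg r_found))
    (hqh : σ₀.reg r_qh = 0) (hk : σ₀.reg r_k = 0) :
    Does W searchLoop σ₀ ((2 * σ₀.reg r_arcs + σ₀.reg r_nodes) * 100 + 4) fun τ =>
      σ₀.searchData.Search (σ₀.arr a_pi) (τ.arr a_vis) (τ.arr a_par) (τ.arr a_queue)
        (τ.reg r_qt) (τ.reg r_qt) (τ.reg r_k) (τ.reg r_found) := by
  set d := σ₀.searchData with hd
  have hsize := hS.size
  refine (Does.loop (b := 96) (n := 2 * σ₀.reg r_arcs + σ₀.reg r_nodes) (fun n σ =>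
    d.Search (σ₀.arr a_pi) (σ.arr a_vis) (σ.arr a_par) (σ.arr a_queue)
      (σ.reg r_qh) (σ.reg r_qt) (σ.reg r_k) (σ.reg r_found) ∧
    (∑ p ∈ Finset.range (σ.reg r_qh), (d.deg (σ.arr a_queue p) + 1)) + σ.reg r_k + n =
      2 * d.M + d.V) ?_ ?_).mono (m := (2 * σ₀.reg r_arcs + σ₀.reg r_nodes) * 100 + 4)
      (by simp only [Expr.time]; omega) (fun _ _ h => h)
  · rw [hqh, hk]; exact ⟨hI, by simp [hd, Store.searchData]⟩
  intro n σ hF ⟨hI, hn⟩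
  have e1 : σ.arr a_hd = d.hd := hF.2 _ (by decide)
  have e2 : σ.arr a_rc = d.rc := hF.2 _ (by decide)
  have e3 : σ.arr a_deg = d.deg := hF.2 _ (by decide)
  have e4 : σ.arr a_resid = d.resid := hF.2 _ (by decide)
  have e5 : σ.arr a_rem = d.rem := hF.2 _ (by decide)
  have e6 : σ.reg r_stride = d.B := hF.1 _ (by decide)
  have e7 : σ.reg r_k₁ = d.k := hF.1 _ (by decide)
  have e8 : ∀ v k, σ.arr a_adj (v * d.B + k) = d.adj v k := fun v k => by
    rw [hF.2 a_adj (by decide)]; rfl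
  have e9 : σ.arr a_pi = σ₀.arr a_pi := hF.2 _ (by decide)
  have hqt := hI.queue_le
  have hqh := hI.qh_le
  refine ⟨?_, fun hc => ?_, fun hc => ?_⟩
  · simp only [Expr.Fits, Op.eval_lt, Expr.eval]
    exact ⟨by omega, by omega, ite_one_zero_le (by omega) _⟩
  · have hq : σ.reg r_qh < σ.reg r_qt := by
      by_contra h; simp [Expr.eval, h] at hc
    have hw := hI.work_lt hG hq
    refine ⟨n - 1, by omega, Does.of_wp ?_ (by decide)⟩
    set cur := σ.arr a_queue (σ.reg r_qh) with hcur
    have hcV : cur < d.V := hI.queue_lt _ hq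
    have hdeg := hG.deg_le hcV
    have hkl : σ.reg r_k ≤ d.deg cur := hI.k_le hq
    have hmul : cur * d.B ≤ d.V * d.B := Nat.mul_le_mul_right _ hcV.le
    have hB : d.B ≤ d.V * d.B := Nat.le_mul_of_pos_left _ (by omega)
    by_cases hlt : σ.reg r_k < d.deg cur
    · obtain ⟨r, hr⟩ : ∃ r, d.adj cur (σ.reg r_k) = r := ⟨_, rfl⟩
      have hr2 : r < 2 * d.M := hr ▸ hG.adj_lt _ hcV _ hlt
      have htl : d.tl r = cur := hr ▸ hG.tl_adj _ hcV _ hlt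
      have hhV := hG.hd_lt r hr2
      have b1 := hS.resid r hr2
      have b2 := hS.rc r hr2
      have b3 := hS.rem _ hhV
      have b4 : σ₀.arr a_pi cur ≤ 10 := hpi cur hcV
      have b5 : σ₀.arr a_pi (d.hd r) ≤ 10 := hpi _ hhV
      have hkV' : d.k ≤ d.V := hkV
      have b6 : σ.arr a_vis (d.hd r) ≤ 1 := by
        rcases hI.vis_cases _ hhV with h | h <;> omega
      -- Entries are written at position `qt` only, beyond the finished part of the queue that the
      -- progress measure counts.
      have hsum : ∀ x ∈ Finset.range (σ.reg r_qh),
          d.deg (Function.update (σ.arr a_queue) (σ.reg r_qt) (d.hd r) x) + 1 =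
            d.deg (σ.arr a_queue x) + 1 := fun x hx => by
        rw [Function.update_of_ne (by have := Finset.mem_range.1 hx; omega)]
      simp [searchBody, Prog.wp, Expr.Fits, Expr.eval, e1, e2, e3, e4, e5, e6, e7, e8, e9,
        ← hcur, hlt, hr, Finset.sum_congr rfl hsum]
      repeat' (first | apply And.intro | intro)
      all_goals first | omega | (split_ifs <;> omega) | skip
      · exact hI.visit hG hq hlt hr ‹_› ⟨‹_›, by rw [htl]; assumption⟩
          (.inr ⟨⟨‹_›, hhV, ‹_›⟩, rfl⟩)
      · exact hI.visit hG hq hlt hr ‹_› ⟨‹_›, by rw [htl]; assumption⟩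
          (.inl ⟨fun h => absurd (‹0 < d.rem (d.hd r) → d.hd r < d.k› h.2.2) (not_lt.2 h.1),
            rfl⟩)
      -- The test failed: if the arc is usable after all, it failed because the head is already
      -- marked.
      · refine hI.pass hlt fun hu => ?_
        rw [← hcur, hr] at hu ⊢
        have := hu.2
        rw [htl] at this
        rcases hI.vis_cases _ hhV with h | h
        · exact absurd h (by solve_by_elim [hu.1])
        · exact h.1
    · simp [searchBody, Prog.wp, Expr.Fits, Expr.eval, e3, ← hcur, hlt,
        Finset.sum_range_succ]
      have hadv := hI.advance hG hq (not_lt.1 hlt)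
      repeat' apply And.intro
      all_goals first | exact hadv | omega
  · have : σ.reg r_qh = σ.reg r_qt := by
      by_contra h; simp [Expr.eval] at hc; omega
    rw [← this]; rw [← this] at hI; exact hI

end Code

theorem Prog.Frame.searchData {p : Prog} {σ τ : Store} (h : p.Frame σ τ)
    (hr : ∀ r ∈ [r_k₁, r_stride, r_arcs, r_nodes], r ∉ p.regs)
    (ha : ∀ a ∈ [a_rem, a_hd, a_rc, a_adj, a_deg, a_resid], a ∉ p.arrs) :
    τ.searchData = σ.searchData := by
  simp only [List.mem_cons, List.not_mem_nil, or_false, forall_eq_or_imp, forall_eq] at hr ha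
  obtain ⟨h1, h2, h3, h4⟩ := hr
  obtain ⟨g1, g2, g3, g4, g5, g6⟩ := ha
  simp only [Store.searchData, h.1 _ h1, h.1 _ h2, h.1 _ h3, h.1 _ h4, h.2 _ g1, h.2 _ g2,
    h.2 _ g3, h.2 _ g4, h.2 _ g5, h.2 _ g6]

/-! ### Rounds of searching and raising labels -/

namespace Code

/-- The search ended in a store with a reached demand node. -/
def Reached (d : SearchData) (τ : Store) : Prop :=
  τ.reg r_found ≠ 0 ∧ ∃ D, d.Labels (τ.arr a_pi) D ∧
    d.Search (τ.arr a_pi) (τ.arr a_vis) (τ.arr a_par) (τ.arr a_queue)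
      (τ.reg r_qt) (τ.reg r_qt) (τ.reg r_k) (τ.reg r_found)

/-- The labels are assumed valid after the pending raise, which the preparation carries out. The
conclusion for an unsuccessful round has the same form with `D + 1`, so rounds can be chained. -/
theorem roundBody_does {W : ℕ} {σ₀ : Store} (hG : σ₀.searchData.Graph)
    (hS : σ₀.searchData.Small W) (hk0 : 0 < σ₀.reg r_k₁) (hkV : σ₀.reg r_k₁ ≤ σ₀.reg r_nodes)
    {D : ℕ} (hD : D ≤ 10) (hL : σ₀.searchData.Labels
      (fun w => σ₀.arr a_pi w + σ₀.reg r_raise * (1 - σ₀.arr a_vis w)) D)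
    (hvis : ∀ v < σ₀.reg r_nodes, σ₀.arr a_vis v ≤ 1) (hraise : σ₀.reg r_raise ≤ 1)
    (hfound : σ₀.reg r_found = 0) :
    Does W roundBody σ₀ (200 * (σ₀.reg r_arcs + σ₀.reg r_nodes) + 18) fun τ =>
      (∀ v < σ₀.reg r_nodes, τ.arr a_vis v ≤ 1) ∧ τ.reg r_raise = 1 ∧
      (τ.reg r_found = 0 ∧ σ₀.searchData.Labels
        (fun w => τ.arr a_pi w + τ.reg r_raise * (1 - τ.arr a_vis w)) (D + 1) ∨
        Reached σ₀.searchData τ) := by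
  have hsize := hS.size
  have hpi : ∀ v < σ₀.reg r_nodes, σ₀.arr a_pi v ≤ 10 := fun v hv => by
    have := (Nat.le_add_right _ _).trans (hL.le v hv); omega
  refine (Does.seq (n := 4) (m := 200 * (σ₀.reg r_arcs + σ₀.reg r_nodes) + 14)
    (Q := fun τ => τ.reg r_v = 0 ∧ τ.reg r_qt = 0)
    (Does.of_wp (by simp [Prog.wp, Expr.Fits, Expr.eval]) (by decide)) ?_).mono (by omega)
    fun _ _ h => h
  rintro τ₁ F₁ ⟨hv₁, hqt₁⟩
  have d₁ : τ₁.searchData = σ₀.searchData := F₁.searchData (by decide) (by decide)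
  have n₁ : τ₁.reg r_nodes = σ₀.reg r_nodes := F₁.1 _ (by decide)
  have k₁ : τ₁.reg r_k₁ = σ₀.reg r_k₁ := F₁.1 _ (by decide)
  have m₁ : τ₁.reg r_arcs = σ₀.reg r_arcs := F₁.1 _ (by decide)
  have p₁ : τ₁.arr a_pi = σ₀.arr a_pi := F₁.2 _ (by decide)
  have v₁ : τ₁.arr a_vis = σ₀.arr a_vis := F₁.2 _ (by decide)
  have r₁ : τ₁.reg r_raise = σ₀.reg r_raise := F₁.1 _ (by decide)
  have f₁ : τ₁.reg r_found = σ₀.reg r_found := F₁.1 _ (by decide)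
  have hprep := prepLoop_does (W := W) (σ₀ := τ₁) (by rw [d₁]; exact hS) (by rw [k₁, n₁]; exact hkV)
    (by rw [n₁, p₁]; exact hpi) (by rw [n₁, v₁]; exact hvis) (by rw [r₁]; exact hraise) hv₁ hqt₁
  rw [n₁, d₁, p₁, v₁, r₁] at hprep
  refine (hprep.seq (m := 200 * σ₀.reg r_arcs + 150 * σ₀.reg r_nodes + 10) ?_).mono (by omega)
    fun _ _ h => h
  rintro τ₂ F₂ ⟨hP, hpi₂⟩
  refine (Does.seq (n := 6) (m := (2 * σ₀.reg r_arcs + σ₀.reg r_nodes) * 100 + 4)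
    (Q := fun τ => τ.reg r_raise = 1 ∧ τ.reg r_qh = 0 ∧ τ.reg r_k = 0)
    (Does.of_wp (by simp [Prog.wp, Expr.Fits, Expr.eval]; omega) (by decide)) ?_).mono (by omega)
    fun _ _ h => h
  rintro τ₃ F₃ ⟨hr₃, hqh₃, hk₃⟩
  have d₃ : τ₃.searchData = σ₀.searchData :=
    (F₃.searchData (by decide) (by decide)).trans
      ((F₂.searchData (by decide) (by decide)).trans d₁)
  have n₃ : τ₃.reg r_nodes = σ₀.reg r_nodes := congrArg SearchData.V d₃
  have k₃ : τ₃.reg r_k₁ = σ₀.reg r_k₁ := congrArg SearchData.k d₃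
  have m₃ : τ₃.reg r_arcs = σ₀.reg r_arcs := congrArg SearchData.M d₃
  have p₃ : τ₃.arr a_pi = τ₂.arr a_pi := F₃.2 _ (by decide)
  have v₃ : τ₃.arr a_vis = τ₂.arr a_vis := F₃.2 _ (by decide)
  have a₃ : τ₃.arr a_par = τ₂.arr a_par := F₃.2 _ (by decide)
  have q₃ : τ₃.arr a_queue = τ₂.arr a_queue := F₃.2 _ (by decide)
  have t₃ : τ₃.reg r_qt = τ₂.reg r_qt := F₃.1 _ (by decide)
  have f₃ : τ₃.reg r_found = 0 :=
    (F₃.1 _ (by decide)).trans ((F₂.1 _ (by decide)).trans (f₁.trans hfound))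
  have hL₃ : σ₀.searchData.Labels (τ₃.arr a_pi) D :=
    hL.congr hG hkV fun w hw => by rw [p₃]; exact hpi₂ w hw
  have hsearch := searchLoop_does (W := W) (σ₀ := τ₃) (by rw [d₃]; exact hG)
    (by rw [d₃]; exact hS) (by rw [k₃, n₃]; exact hkV)
    (fun v hv => (hL₃.le v (by rw [n₃] at hv; exact hv)).trans hD)
    (by rw [d₃, v₃, a₃, q₃, t₃, f₃]; exact hP.search _) hqh₃ hk₃
  rw [n₃, m₃, d₃] at hsearch
  refine hsearch.mono le_rfl fun τ₄ F₄ h => ?_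
  have p₄ : τ₄.arr a_pi = τ₃.arr a_pi := F₄.2 _ (by decide)
  have r₄ : τ₄.reg r_raise = 1 := (F₄.1 _ (by decide)).trans hr₃
  rw [← p₄] at h hL₃
  refine ⟨fun v hv => ?_, r₄, ?_⟩
  · rcases h.vis_cases v hv with h | h <;> omega
  · by_cases hf : τ₄.reg r_found = 0
    · refine .inl ⟨hf, ?_⟩
      rw [hf] at h
      rw [r₄]
      exact h.raise hG hL₃ hkV hk0
    · exact .inr ⟨hf, D, hL₃, h⟩

/-- Every unsuccessful round raises the common label of the demands by one. Since valid labels never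
have `D` above `4`, at most `5 - D` rounds are needed; this replaces Dijkstra's algorithm. -/
theorem roundLoop_does {W : ℕ} {σ₀ : Store} (hG : σ₀.searchData.Graph)
    (hS : σ₀.searchData.Small W) (hk0 : 0 < σ₀.reg r_k₁) (hkV : σ₀.reg r_k₁ ≤ σ₀.reg r_nodes)
    {D : ℕ} (hL : σ₀.searchData.Labels (σ₀.arr a_pi) D)
    (hmax : ∀ pi D, σ₀.searchData.Labels pi D → D ≤ 4)
    (hvis : ∀ v < σ₀.reg r_nodes, σ₀.arr a_vis v ≤ 1) (hraise : σ₀.reg r_raise = 0)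
    (hfound : σ₀.reg r_found = 0) :
    Does W roundLoop σ₀ (1000 * (σ₀.reg r_arcs + σ₀.reg r_nodes) + 114) fun τ =>
      (∀ v < σ₀.reg r_nodes, τ.arr a_vis v ≤ 1) ∧ Reached σ₀.searchData τ := by
  have hsize := hS.size
  have hD4 := hmax _ _ hL
  refine (Does.loop (b := 200 * (σ₀.reg r_arcs + σ₀.reg r_nodes) + 18) (n := 5 - D) (fun n σ =>
    (∀ v < σ₀.reg r_nodes, σ.arr a_vis v ≤ 1) ∧ σ.reg r_raise ≤ 1 ∧
    ((σ.reg r_found = 0 ∧ ∃ D, D + n = 5 ∧ σ₀.searchData.Labels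
        (fun w => σ.arr a_pi w + σ.reg r_raise * (1 - σ.arr a_vis w)) D) ∨
      Reached σ₀.searchData σ)) ?_ ?_).mono
      (m := 1000 * (σ₀.reg r_arcs + σ₀.reg r_nodes) + 114) ?_ (fun _ _ h => h)
  · refine ⟨hvis, by omega, .inl ⟨hfound, D, by omega, ?_⟩⟩
    simpa [hraise] using hL
  · rintro n σ hF ⟨hv, hr, h⟩
    have hfW : σ.reg r_found ≤ W := by
      rcases h with ⟨h, -⟩ | ⟨h0, -, -, h⟩
      · omega
      · rcases h.found with h | h
        · omega
        · have := h.1.2.1; omega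
    refine ⟨?_, fun hc => ?_, fun hc => ?_⟩
    · simp only [Expr.Fits, Op.eval_eq, Expr.eval]
      exact ⟨by omega, by omega, ite_one_zero_le (by omega) _⟩
    · have h0 : σ.reg r_found = 0 := by simpa [Expr.eval] using hc
      obtain ⟨-, D', hDn, hL'⟩ := h.resolve_right fun h => h.1 h0
      have hD' := hmax _ _ hL'
      have d₁ : σ.searchData = σ₀.searchData := hF.searchData (by decide) (by decide)
      have n₁ : σ.reg r_nodes = σ₀.reg r_nodes := congrArg SearchData.V d₁
      have k₁ : σ.reg r_k₁ = σ₀.reg r_k₁ := congrArg SearchData.k d₁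
      have m₁ : σ.reg r_arcs = σ₀.reg r_arcs := congrArg SearchData.M d₁
      have hb := roundBody_does (W := W) (σ₀ := σ) (by rw [d₁]; exact hG) (by rw [d₁]; exact hS)
        (by rw [k₁]; exact hk0) (by rw [k₁, n₁]; exact hkV) (D := D') (by omega)
        (by rw [d₁]; exact hL') (by rw [n₁]; exact hv) hr h0
      rw [d₁, n₁, m₁] at hb
      refine ⟨n - 1, by omega, hb.mono le_rfl fun τ _ ⟨g1, g2, g3⟩ => ⟨g1, g2.le, ?_⟩⟩
      rcases g3 with ⟨g3, g4⟩ | g3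
      · exact .inl ⟨g3, D' + 1, by omega, g4⟩
      · exact .inr g3
    · have h0 : σ.reg r_found ≠ 0 := by simpa [Expr.eval] using hc
      exact ⟨hv, h.resolve_left fun h => h0 h.1⟩
  · simp only [Expr.time]
    exact (Nat.add_le_add_right (Nat.mul_le_mul_right _ (show 5 - D ≤ 5 by omega)) _).trans
      (by omega)

end Code

namespace Instance

variable (I : Instance)

/-! ## Numbering of nodes and arcs -/

/-- The number of a node. -/
def num : I.Node → ℕ
  | .lev₁ i => i
  | .lev₂ i => I.k₁ + i
  | .hub₁ => I.k₁ + I.k₂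
  | .hub₂ => I.k₁ + I.k₂ + 1

/-- The number of an arc, given a table of the arcs of the level-intersections. -/
def code (cell : ℕ → ℕ) : I.Arc → ℕ
  | .cross c => cell (c.1.1 * I.k₂ + c.1.2)
  | .exc₁ i => 2 * i
  | .def₁ i => 2 * i + 1
  | .exc₂ i => 2 * (I.k₁ + i) + 1
  | .def₂ i => 2 * (I.k₁ + i)

/-- The number of a residual arc. -/
def rcode (cell : ℕ → ℕ) (ρ : I.Arc × Bool) : ℕ :=
  2 * I.code cell ρ.1 + if ρ.2 then 0 else 1

/-- Finite capacities that are as good as the infinite ones. -/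
def capN : I.Arc → ℕ
  | .cross c => I.u c.1.1 c.1.2
  | _ => I.nT + 1

theorem num_injective : Function.Injective I.num := by
  intro x y h
  cases x <;> cases y <;> simp only [num] at h <;>
    first
    | rfl
    | (congr 1; apply Fin.ext; omega)
    | omega

/-- The parts of the store that do not change after the initialization. -/
structure Layout (σ : Store) : Prop where
  nT : σ.reg r_nT = I.nT
  nC : σ.reg r_nC = I.nC
  k₁ : σ.reg r_k₁ = I.k₁
  k₂ : σ.reg r_k₂ = I.k₂
  stride : σ.reg r_stride = 4 * (I.k₁ + I.k₂) + 2 * I.nC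
  nodes : σ.reg r_nodes = I.k₁ + I.k₂ + 2
  graph : σ.searchData.Graph
  code_lt : ∀ α, I.code (σ.arr a_cell) α < σ.reg r_arcs
  code_inj : Function.Injective (I.code (σ.arr a_cell))
  code_surj : ∀ a < σ.reg r_arcs, ∃ α, I.code (σ.arr a_cell) α = a
  code_cross : ∀ c, 2 * (I.k₁ + I.k₂) ≤ I.code (σ.arr a_cell) (.cross c)
  hd_tgt : ∀ α, σ.arr a_hd (2 * I.code (σ.arr a_cell) α) = I.num (I.network.tgt α)
  hd_src : ∀ α, σ.arr a_hd (2 * I.code (σ.arr a_cell) α + 1) = I.num (I.network.src α)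
  rc_fwd : ∀ α, (σ.arr a_rc (2 * I.code (σ.arr a_cell) α) : ℤ) = 1 + I.network.cost α
  rc_bwd : ∀ α, (σ.arr a_rc (2 * I.code (σ.arr a_cell) α + 1) : ℤ) = 1 - I.network.cost α
  samp_le : ∀ i, σ.arr a_samp i ≤ I.nC
  samp_spec : ∀ c : {c : Fin I.k₁ × Fin I.k₂ // 0 < I.u c.1 c.2}, ∀ k < I.u c.1.1 c.1.2,
    ∃ j : Fin I.nC, σ.arr a_samp (I.code (σ.arr a_cell) (.cross c) * σ.reg r_stride + k) = j ∧
      I.ctrl₁ j = c.1.1 ∧ I.ctrl₂ j = c.1.2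
  samp_inj : ∀ c : {c : Fin I.k₁ × Fin I.k₂ // 0 < I.u c.1 c.2}, ∀ k < I.u c.1.1 c.1.2,
    ∀ k' < I.u c.1.1 c.1.2,
      σ.arr a_samp (I.code (σ.arr a_cell) (.cross c) * σ.reg r_stride + k) =
        σ.arr a_samp (I.code (σ.arr a_cell) (.cross c) * σ.reg r_stride + k') → k = k'

variable {I}

namespace Layout

variable {σ : Store}

theorem frame (h : I.Layout σ) {τ : Store} {p : Prog} (hF : p.Frame σ τ)
    (hr : ∀ r ∈ [r_nT, r_nC, r_k₁, r_k₂, r_stride, r_arcs, r_nodes], r ∉ p.regs)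
    (ha : ∀ a ∈ [a_hd, a_rc, a_adj, a_deg, a_samp, a_cell], a ∉ p.arrs) : I.Layout τ := by
  simp only [List.mem_cons, List.not_mem_nil, or_false, forall_eq_or_imp, forall_eq] at hr ha
  obtain ⟨h1, h2, h3, h4, h5, h6, h7⟩ := hr
  obtain ⟨g1, g2, g3, g4, g5, g6⟩ := ha
  have e1 := hF.1 _ h1
  have e2 := hF.1 _ h2
  have e3 := hF.1 _ h3
  have e4 := hF.1 _ h4
  have e5 := hF.1 _ h5
  have e6 := hF.1 _ h6
  have e7 := hF.1 _ h7
  have f1 := hF.2 _ g1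
  have f2 := hF.2 _ g2
  have f3 := hF.2 _ g3
  have f4 := hF.2 _ g4
  have f5 := hF.2 _ g5
  have f6 := hF.2 _ g6
  obtain ⟨i1, i2, i3, i4, i5, i6, i7, i8, i9, i10, i11, i12, i13, i14, i15, i16, i17, i18⟩ := h
  refine ⟨?_, ?_, ?_, ?_, ?_, ?_, ?_, ?_, ?_, ?_, ?_, ?_, ?_, ?_, ?_, ?_, ?_, ?_⟩
  case refine_7 =>
    obtain ⟨j1, j2, j3, j4, j5⟩ := i7
    simp only [Store.searchData, SearchData.tl] at j1 j2 j3 j4 j5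
    constructor <;> simp only [Store.searchData, SearchData.tl, e5, e6, e7, f1, f3, f4] <;>
      assumption
  all_goals simp only [e1, e2, e3, e4, e5, e6, e7, f1, f2, f5, f6]
  all_goals assumption

theorem hd_rcode (h : I.Layout σ) (ρ : I.Arc × Bool) :
    σ.arr a_hd (I.rcode (σ.arr a_cell) ρ) = I.num (I.network.resHead ρ) := by
  obtain ⟨α, b⟩ := ρ
  cases b
  · simpa [rcode, Network.resHead] using h.hd_src α
  · simpa [rcode, Network.resHead] using h.hd_tgt α

theorem hd_mate_rcode (h : I.Layout σ) (ρ : I.Arc × Bool) :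
    σ.arr a_hd (mate (I.rcode (σ.arr a_cell) ρ)) = I.num (I.network.resTail ρ) := by
  obtain ⟨α, b⟩ := ρ
  cases b
  · simpa [rcode, Network.resTail, mate_odd] using h.hd_tgt α
  · simpa [rcode, Network.resTail, mate_even] using h.hd_src α

theorem rc_rcode (h : I.Layout σ) (ρ : I.Arc × Bool) :
    (σ.arr a_rc (I.rcode (σ.arr a_cell) ρ) : ℤ) = 1 + I.network.resCost ρ := by
  obtain ⟨α, b⟩ := ρ
  cases b
  · simpa [rcode, Network.resCost, sub_eq_add_neg] using h.rc_bwd α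
  · simpa [rcode, Network.resCost] using h.rc_fwd α

theorem rcode_lt (h : I.Layout σ) (ρ : I.Arc × Bool) :
    I.rcode (σ.arr a_cell) ρ < 2 * σ.reg r_arcs := by
  have := h.code_lt ρ.1
  unfold rcode
  split_ifs <;> omega

theorem exists_rcode (h : I.Layout σ) {r : ℕ} (hr : r < 2 * σ.reg r_arcs) :
    ∃ ρ, I.rcode (σ.arr a_cell) ρ = r := by
  obtain ⟨α, hα⟩ := h.code_surj (r / 2) (by omega)
  rcases Nat.mod_two_eq_zero_or_one r with h0 | h0
  · exact ⟨(α, true), by simp only [rcode, hα, if_true]; omega⟩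
  · exact ⟨(α, false), by simp only [rcode, hα]; simp; omega⟩

/-- Connects the arc counter of the machine with the size of the network, in which running times are
stated. -/
theorem card_arc (h : I.Layout σ) : Fintype.card I.Arc = σ.reg r_arcs := by
  have : Function.Bijective
      (fun α => (⟨I.code (σ.arr a_cell) α, h.code_lt α⟩ : Fin (σ.reg r_arcs))) := by
    refine ⟨fun α β e => h.code_inj (Fin.mk.inj e), fun a => ?_⟩
    obtain ⟨α, hα⟩ := h.code_surj a a.2
    exact ⟨α, Fin.ext hα⟩
  simpa using Fintype.card_of_bijective this

theorem arcs_le (h : I.Layout σ) : σ.reg r_arcs ≤ 2 * (I.k₁ + I.k₂) + I.nC := by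
  have := I.card_cells_le
  rw [← h.card_arc, I.card_arc]
  omega

theorem rc_le (h : I.Layout σ) {r : ℕ} (hr : r < 2 * σ.reg r_arcs) : σ.arr a_rc r ≤ 2 := by
  obtain ⟨ρ, rfl⟩ := h.exists_rcode hr
  have := h.rc_rcode ρ
  have h2 : I.network.resCost ρ ≤ 1 := by
    obtain ⟨α, b⟩ := ρ
    cases b <;> cases α <;> simp [Network.resCost, network]
  omega

/-- Opposite residual arcs have opposite costs, and both are stored with a shift of one to stay
natural numbers. -/
theorem rc_mate (h : I.Layout σ) {r : ℕ} (hr : r < 2 * σ.reg r_arcs) :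
    σ.arr a_rc r + σ.arr a_rc (mate r) = 2 := by
  obtain ⟨ρ, rfl⟩ := h.exists_rcode hr
  have h1 := h.rc_fwd ρ.1
  have h2 := h.rc_bwd ρ.1
  unfold rcode
  split_ifs
  · rw [add_zero, mate_even]; omega
  · rw [mate_odd]; omega

/-- The samples filed at two places are different. -/
theorem samp_injective (h : I.Layout σ) {c c' : {c : Fin I.k₁ × Fin I.k₂ // 0 < I.u c.1 c.2}}
    {k k' : ℕ} (hk : k < I.u c.1.1 c.1.2) (hk' : k' < I.u c'.1.1 c'.1.2)
    (e : σ.arr a_samp (I.code (σ.arr a_cell) (.cross c) * σ.reg r_stride + k) =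
      σ.arr a_samp (I.code (σ.arr a_cell) (.cross c') * σ.reg r_stride + k')) :
    c = c' ∧ k = k' := by
  obtain ⟨j, h1, h2, h3⟩ := h.samp_spec c k hk
  obtain ⟨j', h1', h2', h3'⟩ := h.samp_spec c' k' hk'
  have : j = j' := Fin.ext (by omega)
  subst this
  have hc : c = c' := Subtype.ext (Prod.ext (h2.symm.trans h2') (h3.symm.trans h3'))
  subst hc
  exact ⟨rfl, h.samp_inj c k hk k' hk' e⟩

end Layout

/-- The store keeps the flow `f` in the table of residual capacities and in the selection. -/
structure Keeps (I : Instance) (σ : Store) (f : I.Arc → ℕ) : Prop where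
  bwd : ∀ α, σ.arr a_resid (2 * I.code (σ.arr a_cell) α + 1) = f α
  fwd : ∀ α, σ.arr a_resid (2 * I.code (σ.arr a_cell) α) + f α = I.capN α
  out : ∀ r, 2 * σ.reg r_arcs ≤ r → σ.arr a_resid r = 0
  sel : ∀ c : {c : Fin I.k₁ × Fin I.k₂ // 0 < I.u c.1 c.2}, ∀ k < I.u c.1.1 c.1.2,
    σ.arr a_sel (σ.arr a_samp (I.code (σ.arr a_cell) (.cross c) * σ.reg r_stride + k)) =
      if σ.arr a_resid (2 * I.code (σ.arr a_cell) (.cross c)) ≤ k then 1 else 0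

theorem capN_le (α : I.Arc) : I.capN α ≤ I.nT + 1 + I.nC := by
  cases α with
  | cross c =>
    have : I.u c.1.1 c.1.2 ≤ I.nC := by
      simpa [u, cellCount] using Finset.card_filter_le (Finset.univ : Finset (Fin I.nC))
        fun j => I.ctrl₁ j = c.1.1 ∧ I.ctrl₂ j = c.1.2
    simp only [capN]; omega
  | _ => simp only [capN]; omega

namespace Keeps

variable {σ τ : Store} {f : I.Arc → ℕ}

/-- Holds for all indices, also outside of the table of arcs, because the field `out` makes the rest
zero; the copying loop reads beyond the table. -/
theorem resid_le (h : I.Keeps σ f) (hl : I.Layout σ) (r : ℕ) :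
    σ.arr a_resid r ≤ I.nT + 1 + I.nC := by
  by_cases hr : r < 2 * σ.reg r_arcs
  · obtain ⟨⟨α, b⟩, rfl⟩ := hl.exists_rcode hr
    have h1 := h.fwd α
    have h2 := h.bwd α
    have h3 := I.capN_le α
    cases b <;> simp [rcode] <;> omega
  · rw [h.out r (by omega)]; omega

theorem resCapGE (h : I.Keeps σ f) {ρ : I.Arc × Bool}
    (hp : 0 < σ.arr a_resid (I.rcode (σ.arr a_cell) ρ)) : I.network.ResCapGE f 1 ρ := by
  obtain ⟨α, b⟩ := ρ
  cases b
  · simp only [rcode, Bool.false_eq_true, if_false, h.bwd] at hp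
    simp only [Network.ResCapGE]
    exact hp
  · simp only [rcode, if_true, add_zero] at hp
    have h1 := h.fwd α
    simp only [Network.ResCapGE, if_true]
    cases α with
    | cross c =>
      simp only [capN] at h1
      exact Nat.cast_le.2 (by omega)
    | _ => exact le_top

/-- With at most `nT` units on every arc, the surrogate capacity `nT + 1` of an infinite arc is
never exhausted, so the table shows every residual arc of the true network. -/
theorem pos_of_resCapGE (h : I.Keeps σ f) (hf : ∀ α, f α ≤ I.nT) {ρ : I.Arc × Bool}
    (hp : I.network.ResCapGE f 1 ρ) : 0 < σ.arr a_resid (I.rcode (σ.arr a_cell) ρ) := by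
  obtain ⟨α, b⟩ := ρ
  cases b
  · simp only [rcode, Bool.false_eq_true, if_false, h.bwd]
    simp only [Network.ResCapGE] at hp
    exact hp
  · simp only [rcode, if_true, add_zero]
    have h1 := h.fwd α
    have h2 := hf α
    simp only [Network.ResCapGE, if_true] at hp
    cases α with
    | cross c =>
      have h3 : f (.cross c) + 1 ≤ I.u c.1.1 c.1.2 := Nat.cast_le.1 hp
      simp only [capN] at h1
      omega
    | _ => simp only [capN] at h1; omega

/-- Labels for the numbered nodes give a potential. -/
theorem potential (h : I.Keeps σ f) (hl : I.Layout σ) (hf : ∀ α, f α ≤ I.nT) {pi : ℕ → ℕ}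
    (hs : ∀ r < 2 * σ.reg r_arcs, 0 < σ.arr a_resid r →
      pi (σ.arr a_hd r) + 1 ≤ pi (σ.arr a_hd (mate r)) + σ.arr a_rc r) :
    I.network.Potential f fun x => (pi (I.num x) : ℤ) := by
  intro ρ hρ
  have h1 := hs _ (hl.rcode_lt ρ) (h.pos_of_resCapGE hf hρ)
  have h2 := hl.rc_rcode ρ
  rw [hl.hd_rcode, hl.hd_mate_rcode] at h1
  simp only
  omega

end Keeps

/-- Pushing a unit of flow along a residual arc. -/
def push (f : I.Arc → ℕ) (ρ : I.Arc × Bool) : I.Arc → ℕ :=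
  Function.update f ρ.1 (if ρ.2 then f ρ.1 + 1 else f ρ.1 - 1)

/-- The effect of a push on the stored flow. -/
theorem Keeps.push {σ τ : Store} {f : I.Arc → ℕ} (h : I.Keeps σ f) (hl : I.Layout σ)
    {ρ : I.Arc × Bool} {r : ℕ} (hr : I.rcode (σ.arr a_cell) ρ = r)
    (hp : 0 < σ.arr a_resid r) (ecell : τ.arr a_cell = σ.arr a_cell)
    (esamp : τ.arr a_samp = σ.arr a_samp) (earcs : τ.reg r_arcs = σ.reg r_arcs)
    (estride : τ.reg r_stride = σ.reg r_stride)
    (eresid : τ.arr a_resid = Function.update (Function.update (σ.arr a_resid) r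
      (σ.arr a_resid r - 1)) (mate r) (σ.arr a_resid (mate r) + 1))
    (esel : τ.arr a_sel = Function.update (σ.arr a_sel)
      (σ.arr a_samp (r / 2 * σ.reg r_stride + (τ.arr a_resid (2 * (r / 2)) - (r - 2 * (r / 2)))) +
        I.nC * (if r / 2 < 2 * (I.k₁ + I.k₂) then 1 else 0)) (1 - (r - 2 * (r / 2)))) :
    I.Keeps τ (I.push f ρ) := by
  have hrl := hl.rcode_lt ρ
  rw [hr] at hrl
  have hml := mate_lt hrl
  obtain ⟨α, b⟩ := ρ
  have hra : r = 2 * I.code (σ.arr a_cell) α + if b then 0 else 1 := hr.symm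
  set a := I.code (σ.arr a_cell) α with ha
  have hne : ∀ β, β ≠ α → I.code (σ.arr a_cell) β ≠ a := fun β hβ e => hβ (hl.code_inj e)
  have hr2 : r / 2 = a := by cases b <;> simp at hra <;> omega
  have hfwd := h.fwd α
  have hbwd := h.bwd α
  rw [← ha] at hfwd hbwd
  -- the new residual capacities
  have hnew : ∀ β, β ≠ α → τ.arr a_resid (2 * I.code (σ.arr a_cell) β) =
        σ.arr a_resid (2 * I.code (σ.arr a_cell) β) ∧
      τ.arr a_resid (2 * I.code (σ.arr a_cell) β + 1) =
        σ.arr a_resid (2 * I.code (σ.arr a_cell) β + 1) := fun β hβ => by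
    have := hne β hβ
    have hm : mate r / 2 = a := by unfold mate; omega
    rw [eresid]
    constructor <;> rw [Function.update_of_ne (by omega), Function.update_of_ne (by omega)]
  have hα : τ.arr a_resid (2 * a) + (if b then 1 else 0) =
        σ.arr a_resid (2 * a) + (if b then 0 else 1) ∧
      τ.arr a_resid (2 * a + 1) = if b then f α + 1 else f α - 1 := by
    cases b
    · simp only [Bool.false_eq_true, if_false] at hra ⊢
      rw [eresid, hra, mate_odd, Function.update_self, Function.update_of_ne (by omega),
        Function.update_self, hbwd]
      simp
    · simp only [if_true, add_zero] at hra ⊢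
      rw [eresid, hra, mate_even, Function.update_self, Function.update_of_ne (by omega),
        Function.update_self, hbwd]
      rw [hra] at hp
      omega
  have hfpos : b = false → 0 < f α := fun hb => by
    subst hb; simp only [Bool.false_eq_true, if_false] at hra; rw [hra, hbwd] at hp; exact hp
  have hrpos : b = true → 0 < σ.arr a_resid (2 * a) := fun hb => by
    subst hb; simp only [if_true, add_zero] at hra; rw [hra] at hp; exact hp
  refine ⟨fun β => ?_, fun β => ?_, fun s hs => ?_, fun c k hk => ?_⟩
  · rw [ecell]
    by_cases hβ : β = α
    · subst hβ; rw [← ha, hα.2]; simp [Instance.push]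
    · rw [(hnew β hβ).2, h.bwd]; simp [Instance.push, hβ]
  · rw [ecell]
    by_cases hβ : β = α
    · subst hβ
      rw [← ha]
      simp only [Instance.push, Function.update_self]
      cases b
      · have := hfpos rfl; simp at hα ⊢; omega
      · simp at hα ⊢; omega
    · rw [(hnew β hβ).1]; simp [Instance.push, hβ, h.fwd]
  · rw [earcs] at hs
    rw [eresid, Function.update_of_ne (by omega), Function.update_of_ne (by omega), h.out s hs]
  · rw [ecell, esamp, estride, esel, hr2]
    obtain ⟨j, hj, -, -⟩ := hl.samp_spec c k hk
    cases hα' : α with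
    | cross c₀ =>
      have hge : ¬ a < 2 * (I.k₁ + I.k₂) := by
        have := hl.code_cross c₀; rw [← hα', ← ha] at this; omega
      rw [if_neg hge, mul_zero, add_zero]
      have hcap : I.capN α = I.u c₀.1.1 c₀.1.2 := by rw [hα']; rfl
      -- The touched position. A forward push lowers the forward capacity and selects the sample at
      -- the new value; a backward push raises it and deselects the sample at the old value, one
      -- below the new one. In both cases the position is inside the cell because the pushed arc had
      -- residual capacity.
      have hk₀ : τ.arr a_resid (2 * a) - (r - 2 * a) < I.u c₀.1.1 c₀.1.2 := by
        rw [← hcap, ← hfwd]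
        cases b
        · have := hfpos rfl; simp at hα hra; omega
        · have := hrpos rfl; simp at hα hra; omega
      rw [Function.update_apply]
      by_cases hc : c = c₀
      · subst hc
        rw [hα'] at ha
        rw [← ha]
        have hold := h.sel c k hk
        rw [← ha] at hold
        -- The threshold of selected positions moves by one, and the touched position is the only
        -- one to change sides.
        split_ifs with h1 h2 h2
        · have h3 := hl.samp_inj c k hk _ hk₀ (by rw [← ha]; exact h1)
          cases b
          · have := hfpos rfl; simp at hα hra; omega
          · simp at hra; omega
        · have h3 := hl.samp_inj c k hk _ hk₀ (by rw [← ha]; exact h1)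
          cases b
          · simp at hra; omega
          · have := hrpos rfl; simp at hα hra; omega
        · rw [hold, if_pos]
          have h4 : k ≠ τ.arr a_resid (2 * a) - (r - 2 * a) := fun e => h1 (by rw [e])
          cases b
          · simp at hα hra; omega
          · have := hrpos rfl; simp at hα hra; omega
        · rw [hold, if_neg]
          have h4 : k ≠ τ.arr a_resid (2 * a) - (r - 2 * a) := fun e => h1 (by rw [e])
          cases b
          · have := hfpos rfl; simp at hα hra; omega
          · simp at hα hra; omega
      · rw [if_neg, h.sel c k hk, (hnew (.cross c) (by rw [hα']; simpa using hc)).1]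
        intro e
        have ha' : a = I.code (σ.arr a_cell) (.cross c₀) := by rw [ha, hα']
        rw [ha'] at e hk₀
        exact hc (hl.samp_injective hk hk₀ e).1
    | _ =>
      -- For a level arc the write is shifted by `nC`, past all samples, so the selection is
      -- unaffected.
      have hlt : a < 2 * (I.k₁ + I.k₂) := by
        rw [ha, hα']; simp only [code]; omega
      rw [if_pos hlt, Function.update_of_ne (by rw [hj]; have := j.2; omega), h.sel c k hk,
        (hnew (.cross c) (by rw [hα']; simp)).1]

end Instance

namespace Instance

variable {I : Instance}

/-- The stored selection realizes the stored flow. -/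
theorem Keeps.cellCount {σ : Store} {f : I.Arc → ℕ} (h : I.Keeps σ f) (hl : I.Layout σ)
    (c : {c : Fin I.k₁ × Fin I.k₂ // 0 < I.u c.1 c.2}) :
    I.cellCount (I.storedSelection σ) c.1.1 c.1.2 = f (.cross c) := by
  have hspec := hl.samp_spec c
  choose g hg using hspec
  have hg' : ∀ k : Fin (I.u c.1.1 c.1.2), _ := fun k => hg k k.2
  let G : Fin (I.u c.1.1 c.1.2) → Fin I.nC := fun k => g k k.2
  have hG : Function.Injective G := fun k k' e => by
    apply Fin.ext
    apply hl.samp_inj c k k.2 k' k'.2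
    rw [(hg' k).1, (hg' k').1]
    exact congrArg Fin.val e
  -- The `u` filed samples are distinct members of a cell of size `u`, hence they are the whole
  -- cell.
  have himg : Finset.univ.image G =
      Finset.univ.filter fun j => I.ctrl₁ j = c.1.1 ∧ I.ctrl₂ j = c.1.2 := by
    apply Finset.eq_of_subset_of_card_le
    · intro j hj
      obtain ⟨k, -, rfl⟩ := Finset.mem_image.1 hj
      simpa using (hg' k).2
    · rw [Finset.card_image_of_injective _ hG]
      rw [Finset.card_univ, Fintype.card_fin]
      exact le_of_eq rfl
  have hset : ((I.storedSelection σ).filter fun j => I.ctrl₁ j = c.1.1 ∧ I.ctrl₂ j = c.1.2) =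
      (Finset.univ.filter fun k : Fin (I.u c.1.1 c.1.2) =>
        σ.arr a_resid (2 * I.code (σ.arr a_cell) (.cross c)) ≤ k).image G := by
    have : (I.storedSelection σ).filter (fun j => I.ctrl₁ j = c.1.1 ∧ I.ctrl₂ j = c.1.2) =
        (Finset.univ.image G).filter fun j : Fin I.nC => σ.arr a_sel j = 1 := by
      rw [himg, storedSelection, Finset.filter_filter, Finset.filter_filter]
      simp only [and_comm]
    rw [this, Finset.filter_image]
    congr 1
    ext k
    simp only [Finset.mem_filter, Finset.mem_univ, true_and]
    have := h.sel c k k.2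
    rw [(hg' k).1] at this
    change σ.arr a_sel (G k) = _ at this
    rw [this]
    split_ifs with h1 <;> simp [h1]
  rw [Instance.cellCount, hset, Finset.card_image_of_injective _ hG]
  have hf := h.fwd (.cross c)
  simp only [capN] at hf
  -- The selected positions are those from the forward capacity up to `u`; their number is the
  -- capacity used, which is the flow.
  have hcard : (Finset.univ.filter fun k : Fin (I.u c.1.1 c.1.2) =>
      σ.arr a_resid (2 * I.code (σ.arr a_cell) (.cross c)) ≤ k).map Fin.valEmbedding =
      Finset.Ico (σ.arr a_resid (2 * I.code (σ.arr a_cell) (.cross c))) (I.u c.1.1 c.1.2) := by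
    ext k
    simp only [Finset.mem_map, Finset.mem_filter, Finset.mem_univ, true_and, Finset.mem_Ico,
      Fin.valEmbedding_apply]
    exact ⟨fun ⟨k, h, e⟩ => e ▸ ⟨h, k.2⟩, fun h => ⟨⟨k, h.2⟩, h.1, rfl⟩⟩
  rw [← Finset.card_map Fin.valEmbedding, hcard, Nat.card_Ico]
  omega

theorem Keeps.frame {σ τ : Store} {f : I.Arc → ℕ} (h : I.Keeps σ f) {p : Prog}
    (hF : p.Frame σ τ) (hr : ∀ r ∈ [r_stride, r_arcs], r ∉ p.regs)
    (ha : ∀ a ∈ [a_sel, a_resid, a_samp, a_cell], a ∉ p.arrs) : I.Keeps τ f := by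
  simp only [List.mem_cons, List.not_mem_nil, or_false, forall_eq_or_imp, forall_eq] at hr ha
  obtain ⟨h1, h2⟩ := hr
  obtain ⟨g1, g2, g3, g4⟩ := ha
  have e1 := hF.1 _ h1
  have e2 := hF.1 _ h2
  have f1 := hF.2 _ g1
  have f2 := hF.2 _ g2
  have f3 := hF.2 _ g3
  have f4 := hF.2 _ g4
  obtain ⟨i1, i2, i3, i4⟩ := h
  refine ⟨?_, ?_, ?_, ?_⟩ <;> simp only [e1, e2, f1, f2, f3, f4] <;> assumption

/-- A word holds the square of the size of the instance with room to spare. -/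
def WordOK (I : Instance) (W : ℕ) : Prop :=
  100 * ((I.nT + I.nC + I.k₁ + I.k₂) * (I.nT + I.nC + I.k₁ + I.k₂)) ≤ W

theorem Regular.size_ge (h : I.Regular) : 4 ≤ I.nT + I.nC + I.k₁ + I.k₂ := by
  have h1 := h.1
  have h2 := h.2.1
  have h3 := h.k₁_pos
  have h4 := h.k₂_pos
  omega

theorem WordOK.linear {W : ℕ} (hW : I.WordOK W) (h : I.Regular) :
    400 * (I.nT + I.nC + I.k₁ + I.k₂) ≤ W := by
  have h4 := h.size_ge
  have := Nat.mul_le_mul_right (I.nT + I.nC + I.k₁ + I.k₂) h4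
  unfold WordOK at hW
  omega

theorem WordOK.mul {W a b : ℕ} (hW : I.WordOK W) (ha : a ≤ 4 * (I.nT + I.nC + I.k₁ + I.k₂))
    (hb : b ≤ 4 * (I.nT + I.nC + I.k₁ + I.k₂)) : 6 * (a * b) ≤ W := by
  have := Nat.mul_le_mul ha hb
  unfold WordOK at hW
  have e : 4 * (I.nT + I.nC + I.k₁ + I.k₂) * (4 * (I.nT + I.nC + I.k₁ + I.k₂)) =
    16 * ((I.nT + I.nC + I.k₁ + I.k₂) * (I.nT + I.nC + I.k₁ + I.k₂)) := by ring
  omega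

/-- The labels have no negative reduced costs. -/
def Slack (σ : Store) : Prop :=
  ∀ r < 2 * σ.reg r_arcs, 0 < σ.arr a_resid r →
    σ.arr a_pi (σ.arr a_hd r) + 1 ≤ σ.arr a_pi (σ.arr a_hd (mate r)) + σ.arr a_rc r

end Instance

open Instance

/-! ### Augmentation along the search tree -/

namespace Code

/-- The bound on all residual capacities and on all entries of the sample table keeps the computed
addresses within a word, even when the addressed sample is irrelevant because the arc is a level
arc. -/
theorem pushBody_does {I : Instance} {W : ℕ} (hW : I.WordOK W) (hreg : I.Regular)
    {σ : Store} (hl : I.Layout σ) (hres : ∀ r, σ.arr a_resid r ≤ I.nT + 1 + I.nC) {r : ℕ}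
    (hr : r < 2 * σ.reg r_arcs) (hv : σ.reg r_v < I.k₁ + I.k₂ + 2)
    (hpar : σ.arr a_par (σ.reg r_v) = r + 1) :
    Does W pushBody σ 97 fun τ => τ.reg r_v = σ.arr a_hd (mate r) ∧
      τ.arr a_resid = Function.update (Function.update (σ.arr a_resid) r
        (σ.arr a_resid r - 1)) (mate r) (σ.arr a_resid (mate r) + 1) ∧
      τ.arr a_sel = Function.update (σ.arr a_sel)
        (σ.arr a_samp (r / 2 * σ.reg r_stride +
          (τ.arr a_resid (2 * (r / 2)) - (r - 2 * (r / 2)))) +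
          I.nC * (if r / 2 < 2 * (I.k₁ + I.k₂) then 1 else 0)) (1 - (r - 2 * (r / 2))) := by
  have hlin := hW.linear hreg
  have hsize := hreg.size_ge
  have hM := hl.arcs_le
  have hst := hl.stride
  have hmul := hW.mul (a := r / 2) (b := σ.reg r_stride) (by omega) (by omega)
  have hml := mate_lt hr
  have hhd := hl.graph.hd_lt _ hml
  simp only [Store.searchData, hl.nodes] at hhd
  have hmr : r + 1 - 2 * (r - 2 * (r / 2)) = mate r := rfl
  have hne : mate r ≠ r := by unfold mate; omega
  have hup : Function.update (σ.arr a_resid) r (σ.arr a_resid r - 1) (mate r) =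
    σ.arr a_resid (mate r) := Function.update_of_ne hne _ _
  have hres' : ∀ i, Function.update (Function.update (σ.arr a_resid) r
      (σ.arr a_resid r - 1)) (mate r) (σ.arr a_resid (mate r) + 1) i ≤ I.nT + 2 + I.nC := by
    intro i
    have h1 := hres i
    have h2 := hres r
    have h3 := hres (mate r)
    simp only [Function.update_apply]
    split_ifs <;> omega
  have h1 := hres r
  have h2 := hres (mate r)
  have h3 := hres' (2 * (r / 2))
  have h4 := hl.samp_le
  refine Does.of_wp ?_ (by decide)
  simp only [pushBody, Prog.wp, Expr.Fits, Expr.eval, Op.eval_add, Op.eval_sub, Op.eval_mul,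
    Op.eval_div, Op.eval_lt, hpar, Nat.add_sub_cancel]
  simp [hmr, hup, hl.k₁, hl.k₂, hl.nC]
  have h5 := h4 (r / 2 * σ.reg r_stride + (Function.update (Function.update (σ.arr a_resid) r
    (σ.arr a_resid r - 1)) (mate r) (σ.arr a_resid (mate r) + 1) (2 * (r / 2)) -
      (r - 2 * (r / 2))))
  generalize hz : (Function.update (Function.update (σ.arr a_resid) r
    (σ.arr a_resid r - 1)) (mate r) (σ.arr a_resid (mate r) + 1) (2 * (r / 2)) -
      (r - 2 * (r / 2))) = z at h5 ⊢
  repeat' apply And.intro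
  all_goals first | omega | (split_ifs <;> omega)

/-- The path is discovered from its end while the flow is already being changed. This is legitimate
because a path repeats no node: the residual capacities of the arcs still to come, and the tightness
of all arcs, can be referred to the flow and labels at the start. -/
theorem pushLoop_does {I : Instance} {W : ℕ} (hW : I.WordOK W) (hreg : I.Regular)
    {σ₀ : Store} (hl : I.Layout σ₀) {f : I.Arc → ℕ} (hf : I.Keeps σ₀ f) (hs : Slack σ₀)
    {d : SearchData} (dM : d.M = σ₀.reg r_arcs) (dV : d.V = σ₀.reg r_nodes)
    (dhd : d.hd = σ₀.arr a_hd)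
    (drc : d.rc = σ₀.arr a_rc) (dresid : d.resid = σ₀.arr a_resid) {qh k : ℕ}
    (hS : d.Search (σ₀.arr a_pi) (σ₀.arr a_vis) (σ₀.arr a_par) (σ₀.arr a_queue)
      qh (σ₀.reg r_qt) k (σ₀.reg r_v)) (hdem : d.Demand (σ₀.reg r_v)) {y : I.Node}
    (hy : I.num y = σ₀.reg r_v) (hvis : σ₀.arr a_vis (σ₀.reg r_v) = 1) :
    Does W pushLoop σ₀ (σ₀.reg r_nodes * 100 + 3) fun τ => ∃ x P g,
      I.num x = τ.reg r_v ∧ d.Supply (τ.reg r_v) ∧ I.network.IsResPath f x P y ∧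
      (∀ ρ ∈ P, I.network.Tight (fun x => (σ₀.arr a_pi (I.num x) : ℤ)) ρ) ∧
      I.Keeps τ g ∧ Slack τ ∧
      ∀ α, (g α : ℤ) = f α + (P.count (α, true) : ℤ) - (P.count (α, false) : ℤ) := by
  have hlin := hW.linear hreg
  have hsize := hreg.size_ge
  have hqV := hS.queue_le
  have hnodes := hl.nodes
  obtain ⟨p₀, hp₀, e₀⟩ : ∃ p < σ₀.reg r_qt, σ₀.arr a_queue p = σ₀.reg r_v := by
    rcases hS.vis_cases _ hdem.2.1 with h | h
    · omega
    · exact h.2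
  -- The queue position of the current node serves as the measure. It decreases strictly towards the
  -- root, and the heads already on the path sit at larger positions, which gives distinctness.
  refine (Does.loop (b := 97) (n := p₀) (fun p σ => ∃ x P g,
    p < σ₀.reg r_qt ∧ σ.reg r_v = σ₀.arr a_queue p ∧ I.num x = σ.reg r_v ∧
    I.network.IsResWalk f x P y ∧
    (∀ ρ ∈ P, I.network.Tight (fun x => (σ₀.arr a_pi (I.num x) : ℤ)) ρ) ∧
    (∀ ρ ∈ P, ∃ p' < σ₀.reg r_qt, p < p' ∧
      σ₀.arr a_queue p' = I.num (I.network.resHead ρ)) ∧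
    (P.map I.network.resHead).Nodup ∧ I.Keeps σ g ∧ Slack σ ∧
    ∀ α, (g α : ℤ) = f α + (P.count (α, true) : ℤ) - (P.count (α, false) : ℤ)) ?_ ?_).mono
      (m := σ₀.reg r_nodes * 100 + 3) (by simp only [Expr.time]; omega) (fun _ _ h => h)
  · exact ⟨y, [], f, hp₀, e₀.symm, hy, rfl, by simp, by simp, by simp, hf, hs, by simp⟩
  rintro p σ hF ⟨x, P, g, hp, hv, hx, hwalk, htight, hpos, hnd, hg, hsl, hcnt⟩
  have hlσ : I.Layout σ := hl.frame hF (by decide) (by decide)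
  have epar : σ.arr a_par = σ₀.arr a_par := hF.2 _ (by decide)
  have ehd : σ.arr a_hd = σ₀.arr a_hd := hF.2 _ (by decide)
  have erc : σ.arr a_rc = σ₀.arr a_rc := hF.2 _ (by decide)
  have epi : σ.arr a_pi = σ₀.arr a_pi := hF.2 _ (by decide)
  have ecell : σ.arr a_cell = σ₀.arr a_cell := hF.2 _ (by decide)
  have earcs : σ.reg r_arcs = σ₀.reg r_arcs := hF.1 _ (by decide)
  have hM := hl.arcs_le
  have htree := hS.tree p hp
  have hvV : σ.reg r_v < I.k₁ + I.k₂ + 2 := by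
    have := hS.queue_lt p hp
    rw [hv]; omega
  refine ⟨?_, fun hc => ?_, fun hc => ?_⟩
  · simp only [Expr.Fits, Expr.eval, epar, hv]
    refine ⟨by omega, ?_⟩
    rcases htree with h | ⟨r, p', -, h1, h2, -⟩ <;> omega
  · simp only [Expr.eval, epar, hv] at hc
    obtain ⟨r, p', hp', hr, hparr, hhd, htl, hu⟩ := htree.resolve_left fun h => hc h.1
    rw [dM, ← earcs] at hr
    obtain ⟨ρ, hρ⟩ := hlσ.exists_rcode hr
    have hhead : I.network.resHead ρ = x := I.num_injective (by
      rw [← hlσ.hd_rcode, hρ, ehd, hx, hv, ← hhd, dhd])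
    have hρ₀ : I.rcode (σ₀.arr a_cell) ρ = r := by rw [← ecell]; exact hρ
    have htail : I.num (I.network.resTail ρ) = σ₀.arr a_queue p' := by
      rw [← hl.hd_mate_rcode, hρ₀, ← htl, SearchData.tl, dhd]
    have hcap : I.network.ResCapGE f 1 ρ := hf.resCapGE (by rw [hρ₀, ← dresid]; exact hu.1)
    have hut := hu.2
    rw [SearchData.tl, dhd, drc] at hut
    have htρ : I.network.Tight (fun x => (σ₀.arr a_pi (I.num x) : ℤ)) ρ := by
      have h1 := hl.rc_rcode ρ
      have h2 := hl.hd_rcode ρ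
      have h3 := hl.hd_mate_rcode ρ
      rw [hρ₀] at h1 h2 h3
      rw [h2, h3] at hut
      simp only [Network.Tight]
      omega
    -- All heads on `P` have queue positions beyond `p`, and the queue is injective.
    have hnotin : I.network.resHead ρ ∉ P.map I.network.resHead := fun hin => by
      obtain ⟨ρ', h1, h2⟩ := List.mem_map.1 hin
      obtain ⟨p'', h3, h4, h5⟩ := hpos ρ' h1
      rw [h2, hhead, hx, hv] at h5
      have := hS.inj _ h3 _ hp h5
      omega
    have hρP : ρ ∉ P := fun h => hnotin (List.mem_map_of_mem h)
    -- The same residual arc has not been used so far; pushes on the opposite one could only have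
    -- increased its capacity. Hence the capacity positive under `f` is still positive under `g`.
    have hpos_r : 0 < σ.arr a_resid r := by
      have hu1 := hu.1
      rw [dresid, ← hρ₀] at hu1
      rw [← hρ]
      obtain ⟨α, b⟩ := ρ
      have g1 := hcnt α
      have g2 := hg.fwd α
      have g3 := hg.bwd α
      have g4 := hf.fwd α
      have g5 := hf.bwd α
      have : P.count (α, b) = 0 := List.count_eq_zero.2 hρP
      cases b
      · simp only [rcode, Bool.false_eq_true, if_false] at hu1 ⊢
        omega
      · simp only [rcode, if_true, add_zero] at hu1 ⊢
        omega
    refine ⟨p', hp', (pushBody_does hW hreg hlσ (hg.resid_le hlσ) hr hvV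
      (by rw [epar, hv, hparr])).mono le_rfl ?_⟩
    rintro τ hFτ ⟨hτv, hτr, hτs⟩
    have hτpi : τ.arr a_pi = σ.arr a_pi := hFτ.2 _ (by decide)
    have hτhd : τ.arr a_hd = σ.arr a_hd := hFτ.2 _ (by decide)
    have hτrc : τ.arr a_rc = σ.arr a_rc := hFτ.2 _ (by decide)
    have hτarcs : τ.reg r_arcs = σ.reg r_arcs := hFτ.1 _ (by decide)
    have hτv' : τ.reg r_v = I.num (I.network.resTail ρ) := by
      rw [hτv, ← hlσ.hd_mate_rcode ρ, hρ]
    refine ⟨I.network.resTail ρ, ρ :: P, I.push g ρ, hp'.trans hp, by rw [hτv', htail],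
      hτv'.symm, ⟨rfl, hcap, by rw [hhead]; exact hwalk⟩, ?_, ?_, ?_, ?_, ?_, ?_⟩
    · intro ρ' hρ'
      rcases List.mem_cons.1 hρ' with rfl | h
      · exact htρ
      · exact htight ρ' h
    · intro ρ' hρ'
      rcases List.mem_cons.1 hρ' with rfl | h
      · exact ⟨p, hp, hp', by rw [hhead, hx, hv]⟩
      · obtain ⟨p'', h1, h2, h3⟩ := hpos ρ' h
        exact ⟨p'', h1, hp'.trans h2, h3⟩
    · rw [List.map_cons]
      exact List.nodup_cons.2 ⟨hnotin, hnd⟩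
    · exact hg.push hlσ hρ hpos_r (hFτ.2 _ (by decide)) (hFτ.2 _ (by decide)) hτarcs
        (hFτ.1 _ (by decide)) hτr hτs
    · intro s hs' hps
      rw [hτarcs] at hs'
      rw [hτpi, hτhd, hτrc]
      -- The opposite arc is the only residual arc that can newly appear, and its reduced cost is
      -- zero because the pushed arc was tight.
      by_cases hsm : s = mate r
      · subst hsm
        rw [mate_mate, epi, ehd, erc]
        have := hl.rc_mate (r := r) (by rw [← earcs]; exact hr)
        omega
      · apply hsl s hs'
        rw [hτr, Function.update_of_ne hsm] at hps
        by_cases hsr : s = r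
        · rw [hsr]; exact hpos_r
        · rwa [Function.update_of_ne hsr] at hps
    · intro α
      have h1 := hcnt α
      obtain ⟨β, b⟩ := ρ
      by_cases hβ : α = β
      · subst hβ
        have h0 : P.count (α, b) = 0 := List.count_eq_zero.2 hρP
        have g3 := hg.bwd α
        cases b
        · have : 0 < g α := by
            rw [← g3]
            simp only [rcode, Bool.false_eq_true, if_false] at hρ
            rw [hρ]; exact hpos_r
          simp [Instance.push]
          omega
        · simp [Instance.push]
          omega
      · cases b <;> simp [Instance.push, hβ, Ne.symm hβ, h1]
  · simp only [Expr.eval, epar, hv] at hc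
    have hsup : d.Supply (σ.reg r_v) := by
      rcases htree with h | ⟨r, p', -, -, h, -⟩
      · rw [hv]; exact h.2
      · omega
    refine ⟨x, P, g, hx, hsup, ⟨hwalk, List.nodup_cons.2 ⟨fun hin => ?_, hnd⟩⟩, htight, hg, hsl,
      hcnt⟩
    obtain ⟨ρ', h1, h2⟩ := List.mem_map.1 hin
    obtain ⟨p'', h3, h4, h5⟩ := hpos ρ' h1
    rw [h2, hx, hv] at h5
    have := hS.inj _ h3 _ hp h5
    omega

end Code

/-! ### The invariant between iterations -/

namespace Instance

variable {I : Instance}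

/-- The flow between the first hub and its levels cancels, so only the cross arcs leave this half of
the network. The amount sent across therefore equals the supply used up. -/
theorem sum_remaining₁ (f : I.Arc → ℕ) :
    (∑ i, I.network.remaining f (.lev₁ i)) + I.network.remaining f .hub₁ =
      (I.nT : ℤ) - ∑ c, (f (.cross c) : ℤ) := by
  have h : ∑ i : Fin I.k₁, ∑ c : {c : Fin I.k₁ × Fin I.k₂ // 0 < I.u c.1 c.2},
      (if c.1.1 = i then (f (.cross c) : ℤ) else 0) = ∑ c, (f (.cross c) : ℤ) := by
    rw [Finset.sum_comm]; simp
  simp only [Network.remaining, netOut_lev₁, netOut_hub₁, Finset.sum_sub_distrib,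
    Finset.sum_add_distrib, h]
  have h2 : ∑ i, I.network.supply (.lev₁ i) = (I.nT : ℤ) := by
    rw [← I.sum_ell₁]; simp [network]
  have h3 : I.network.supply .hub₁ = 0 := rfl
  rw [h2, h3]; ring

theorem sum_remaining₂ (f : I.Arc → ℕ) :
    (∑ i, I.network.remaining f (.lev₂ i)) + I.network.remaining f .hub₂ =
      (∑ c, (f (.cross c) : ℤ)) - I.nT := by
  have h : ∑ i : Fin I.k₂, ∑ c : {c : Fin I.k₁ × Fin I.k₂ // 0 < I.u c.1 c.2},
      (if c.1.2 = i then (f (.cross c) : ℤ) else 0) = ∑ c, (f (.cross c) : ℤ) := by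
    rw [Finset.sum_comm]; simp
  simp only [Network.remaining, netOut_lev₂, netOut_hub₂, Finset.sum_sub_distrib,
    Finset.sum_add_distrib, h]
  have h2 : ∑ i, I.network.supply (.lev₂ i) = -(I.nT : ℤ) := by
    rw [← I.sum_ell₂]; simp [network]
  have h3 : I.network.supply .hub₂ = 0 := rfl
  rw [h2, h3]; ring

/-- The state of the algorithm after `n` iterations. -/
structure Inv (I : Instance) (n : ℕ) (σ : Store) : Prop where
  layout : I.Layout σ
  keeps : I.Keeps σ (I.storedFlow σ)
  left : σ.reg r_left + n = I.nT
  labels : ∃ D, σ.searchData.Labels (σ.arr a_pi) D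
  vis_le : ∀ v < σ.reg r_nodes, σ.arr a_vis v ≤ 1
  flow_le : ∀ α, I.storedFlow σ α ≤ n
  rem₁ : ∀ i : Fin I.k₁, (σ.arr a_rem i : ℤ) = I.network.remaining (I.storedFlow σ) (.lev₁ i)
  rem₂ : ∀ i : Fin I.k₂,
    (σ.arr a_rem (I.k₁ + i) : ℤ) = -I.network.remaining (I.storedFlow σ) (.lev₂ i)
  hub₁ : I.network.remaining (I.storedFlow σ) .hub₁ = 0
  hub₂ : I.network.remaining (I.storedFlow σ) .hub₂ = 0
  rem_hub : ∀ v, I.k₁ + I.k₂ ≤ v → σ.arr a_rem v = 0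
  cross : ∑ c, I.storedFlow σ (.cross c) = n

namespace Inv

variable {n : ℕ} {σ : Store}

theorem n_le (h : I.Inv n σ) : n ≤ I.nT := by have := h.left; omega

theorem sum_rem₁ (h : I.Inv n σ) : ∑ i : Fin I.k₁, σ.arr a_rem i = I.nT - n := by
  have h1 := sum_remaining₁ (I.storedFlow σ)
  rw [h.hub₁, ← Nat.cast_sum, h.cross, add_zero, ← Finset.sum_congr rfl fun i _ => h.rem₁ i,
    ← Nat.cast_sum] at h1
  omega

theorem sum_rem₂ (h : I.Inv n σ) : ∑ i : Fin I.k₂, σ.arr a_rem (I.k₁ + i) = I.nT - n := by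
  have h1 := sum_remaining₂ (I.storedFlow σ)
  rw [h.hub₂, ← Nat.cast_sum, h.cross, add_zero] at h1
  have h2 : ((∑ i : Fin I.k₂, σ.arr a_rem (I.k₁ + i) : ℕ) : ℤ) =
      -∑ i, I.network.remaining (I.storedFlow σ) (.lev₂ i) := by
    rw [Nat.cast_sum, Finset.sum_congr rfl fun i _ => h.rem₂ i, Finset.sum_neg_distrib]
  omega

/-- Each entry is a summand of a sum of natural numbers equal to `nT - n`, or belongs to a hub and
is zero. -/
theorem rem_le (h : I.Inv n σ) (v : ℕ) : σ.arr a_rem v ≤ I.nT := by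
  by_cases h1 : v < I.k₁
  · have := Finset.single_le_sum (f := fun i : Fin I.k₁ => σ.arr a_rem i)
      (fun _ _ => Nat.zero_le _) (Finset.mem_univ ⟨v, h1⟩)
    simp only [h.sum_rem₁] at this
    omega
  by_cases h2 : v < I.k₁ + I.k₂
  · have := Finset.single_le_sum (f := fun i : Fin I.k₂ => σ.arr a_rem (I.k₁ + i))
      (fun _ _ => Nat.zero_le _) (Finset.mem_univ ⟨v - I.k₁, by omega⟩)
    simp only [h.sum_rem₂, show I.k₁ + (v - I.k₁) = v by omega] at this
    omega
  · rw [h.rem_hub v (by omega)]; omega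

theorem potential (h : I.Inv n σ) {pi : ℕ → ℕ} {D : ℕ} (hL : σ.searchData.Labels pi D) :
    I.network.Potential (I.storedFlow σ) fun x => (pi (I.num x) : ℤ) :=
  h.keeps.potential h.layout (fun α => (h.flow_le α).trans h.n_le) hL.slack

/-- There is a residual walk of cost at most `4` from every supply to every demand. -/
theorem labels_le (h : I.Inv n σ) (hreg : I.Regular) (hn : n < I.nT) (pi : ℕ → ℕ) (D : ℕ)
    (hL : σ.searchData.Labels pi D) : D ≤ 4 := by
  have hP := h.potential hL
  obtain ⟨s, hs⟩ : ∃ i : Fin I.k₁, 0 < σ.arr a_rem i := by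
    by_contra hne
    have h1 := h.sum_rem₁
    rw [Finset.sum_eq_zero fun i _ => Nat.eq_zero_of_not_pos fun hi => hne ⟨i, hi⟩] at h1
    omega
  obtain ⟨t, ht⟩ : ∃ i : Fin I.k₂, 0 < σ.arr a_rem (I.k₁ + i) := by
    by_contra hne
    have h1 := h.sum_rem₂
    rw [Finset.sum_eq_zero fun i _ => Nat.eq_zero_of_not_pos fun hi => hne ⟨i, hi⟩] at h1
    omega
  -- If all cross arcs were saturated, `n` would be the number `nC` of all control samples, contrary
  -- to `n < nT ≤ nC`.
  obtain ⟨c, hc⟩ : ∃ c, I.storedFlow σ (.cross c) < I.u c.1.1 c.1.2 := by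
    by_contra! hne
    have h1 := Finset.sum_le_sum fun c (_ : c ∈ Finset.univ) => hne c
    rw [h.cross, I.sum_cell I.u fun _ _ h => h] at h1
    have h2 := I.sum_cellCount Finset.univ
    rw [Finset.card_univ, Fintype.card_fin] at h2
    have h3 := hreg.2.1
    simp only [u] at h1
    omega
  have p0 : pi (I.num (.lev₁ s)) = 0 := hL.sup _ ⟨by
    change (s : ℕ) < σ.reg r_k₁; rw [h.layout.k₁]; exact s.2, hs⟩
  have p5 : pi (I.num (.lev₂ t)) = D := hL.dem _ ⟨by
    change σ.reg r_k₁ ≤ I.k₁ + t; rw [h.layout.k₁]; omega, by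
    change I.k₁ + t < σ.reg r_nodes; rw [h.layout.nodes]; omega, ht⟩
  -- The walk from supply `s` to the first hub, to the tail of the unsaturated arc, across it, to
  -- the second hub and to demand `t`. Its level arcs are uncapacitated and cost one each, the cross
  -- arc costs nothing; some of its nodes may coincide, which does not matter for labels.
  have p1 := hP (.def₁ s, true) le_top
  have p2 := hP (.exc₁ c.1.1, true) le_top
  have p3 := hP (.cross c, true) (Nat.cast_le.2 hc)
  have p4 := hP (.exc₂ c.1.2, true) le_top
  have p6 := hP (.def₂ t, true) le_top
  simp [Network.resHead, Network.resTail, Network.resCost, network] at p1 p2 p3 p4 p6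
  omega

theorem small {W : ℕ} (h : I.Inv n σ) (hreg : I.Regular) (hW : I.WordOK W) :
    σ.searchData.Small W := by
  have hlin := hW.linear hreg
  have hsize := hreg.size_ge
  have h1 := hreg.1
  have h2 := hreg.2.1
  have hM := h.layout.arcs_le
  have hV := h.layout.nodes
  have hB := h.layout.stride
  have hmul := hW.mul (a := σ.reg r_nodes) (b := σ.reg r_stride) (by omega) (by omega)
  refine ⟨?_, fun r _ => ?_, fun v _ => ?_, fun r hr => h.layout.rc_le hr⟩
  · simp only [Store.searchData]
    omega
  · have := h.keeps.resid_le h.layout r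
    simp only [Store.searchData]
    omega
  · have := h.rem_le v
    simp only [Store.searchData]
    omega

end Inv

end Instance

open Instance

/-! ### Writing out the flow on the level arcs -/

namespace Code

/-- The backward residual capacity of an arc is its flow. Cross arcs need no copying, since the
stored selection already realizes their flow. -/
theorem copyLoop_does {I : Instance} {W : ℕ} (hW : I.WordOK W) (hreg : I.Regular)
    {σ₀ : Store} (hl : I.Layout σ₀) {f : I.Arc → ℕ} (hf : I.Keeps σ₀ f)
    (hv : σ₀.reg r_v = 0) :
    Does W copyLoop σ₀ (σ₀.reg r_nodes * 60 + 6) fun τ => I.storedFlow τ = f := by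
  have hlin := hW.linear hreg
  have hsize := hreg.size_ge
  have hnodes := hl.nodes
  -- A single range of length `k₁ + k₂` covers the levels of both covariates. The superfluous
  -- entries are never read by `storedFlow`.
  refine (Does.loop (b := 54) (n := I.k₁ + I.k₂) (fun n σ =>
    σ.reg r_v + n = I.k₁ + I.k₂ ∧ ∀ w < σ.reg r_v,
      σ.arr a_exc₁ w = σ₀.arr a_resid (4 * w + 1) ∧
      σ.arr a_def₁ w = σ₀.arr a_resid (4 * w + 3) ∧
      σ.arr a_def₂ w = σ₀.arr a_resid (4 * (I.k₁ + w) + 1) ∧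
      σ.arr a_exc₂ w = σ₀.arr a_resid (4 * (I.k₁ + w) + 3)) ?_ ?_).mono
      (m := σ₀.reg r_nodes * 60 + 6) (by simp only [Expr.time]; omega) (fun _ _ h => h)
  · rw [hv]; simp
  rintro n σ hF ⟨hn, hw⟩
  have hlσ : I.Layout σ := hl.frame hF (by decide) (by decide)
  have eresid : σ.arr a_resid = σ₀.arr a_resid := hF.2 _ (by decide)
  have ek₁ := hlσ.k₁
  have ek₂ := hlσ.k₂
  refine ⟨?_, fun hc => ?_, fun hc => ?_⟩
  · simp only [Expr.Fits, Op.eval_lt, Op.eval_add, Expr.eval]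
    exact ⟨by omega, ⟨by omega, by omega, by omega⟩, ite_one_zero_le (by omega) _⟩
  · have hlt : σ.reg r_v < I.k₁ + I.k₂ := by
      simp [Expr.eval, ek₁, ek₂] at hc; omega
    refine ⟨n - 1, by omega, Does.of_wp ?_ (by decide)⟩
    have hres := hf.resid_le hl
    have b1 := hres (4 * σ.reg r_v + 1)
    have b2 := hres (4 * σ.reg r_v + 3)
    have b3 := hres (4 * (I.k₁ + σ.reg r_v) + 1)
    have b4 := hres (4 * (I.k₁ + σ.reg r_v) + 3)
    simp [copyBody, Prog.wp, Expr.Fits, Expr.eval, eresid, ek₁]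
    have key : ∀ (A : ℕ → ℕ) (g : ℕ → ℕ), (∀ w < σ.reg r_v, A w = g w) → ∀ w ≤ σ.reg r_v,
        Function.update A (σ.reg r_v) (g (σ.reg r_v)) w = g w := fun A g h w hw => by
      rcases Nat.lt_or_eq_of_le hw with hw | rfl
      · rw [Function.update_of_ne (by omega), h w hw]
      · rw [Function.update_self]
    have hfin : ∀ w ≤ σ.reg r_v,
        Function.update (σ.arr a_exc₁) (σ.reg r_v) (σ₀.arr a_resid (4 * σ.reg r_v + 1)) w =
          σ₀.arr a_resid (4 * w + 1) ∧
        Function.update (σ.arr a_def₁) (σ.reg r_v) (σ₀.arr a_resid (4 * σ.reg r_v + 3)) w =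
          σ₀.arr a_resid (4 * w + 3) ∧
        Function.update (σ.arr a_def₂) (σ.reg r_v)
          (σ₀.arr a_resid (4 * (I.k₁ + σ.reg r_v) + 1)) w =
          σ₀.arr a_resid (4 * (I.k₁ + w) + 1) ∧
        Function.update (σ.arr a_exc₂) (σ.reg r_v)
          (σ₀.arr a_resid (4 * (I.k₁ + σ.reg r_v) + 3)) w =
          σ₀.arr a_resid (4 * (I.k₁ + w) + 3) := fun w hw' =>
      ⟨key _ (fun w => σ₀.arr a_resid (4 * w + 1)) (fun w h => (hw w h).1) w hw',
        key _ (fun w => σ₀.arr a_resid (4 * w + 3)) (fun w h => (hw w h).2.1) w hw',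
        key _ (fun w => σ₀.arr a_resid (4 * (I.k₁ + w) + 1)) (fun w h => (hw w h).2.2.1) w hw',
        key _ (fun w => σ₀.arr a_resid (4 * (I.k₁ + w) + 3)) (fun w h => (hw w h).2.2.2) w hw'⟩
    repeat' (first | exact hfin | apply And.intro)
    all_goals omega
  · have hge : I.k₁ + I.k₂ ≤ σ.reg r_v := by
      simp [Expr.eval, ek₁, ek₂] at hc; omega
    have hkσ : I.Keeps σ f := hf.frame hF (by decide) (by decide)
    funext α
    have hb := hf.bwd α
    cases α with
    | cross c => exact hkσ.cellCount hlσ c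
    | exc₁ i =>
      rw [← hb]
      simp only [storedFlow, code]
      rw [(hw i (by omega)).1]
      congr 1; omega
    | def₁ i =>
      rw [← hb]
      simp only [storedFlow, code]
      rw [(hw i (by omega)).2.1]
      congr 1; omega
    | exc₂ i =>
      rw [← hb]
      simp only [storedFlow, code]
      rw [(hw i (by omega)).2.2.2]
      congr 1; omega
    | def₂ i =>
      rw [← hb]
      simp only [storedFlow, code]
      rw [(hw i (by omega)).2.2.1]
      congr 1; omega

end Code

open Instance

/-! ### One iteration of the algorithm -/

namespace Instance

variable {I : Instance}

/-- A unit of flow along a path changes the remaining supplies of the end nodes only. -/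
theorem remaining_augment {f g : I.Arc → ℕ} {x y : I.Node} {P : List (I.Arc × Bool)}
    (hP : I.network.IsResWalk f x P y)
    (hg : ∀ α, (g α : ℤ) = f α + (P.count (α, true) : ℤ) - (P.count (α, false) : ℤ))
    (v : I.Node) :
    I.network.remaining g v =
      I.network.remaining f v - ((if x = v then 1 else 0) - if y = v then 1 else 0) := by
  have h := I.network.netOut_count f v P x y hP
  have h2 : I.network.netOut (fun α => (g α : ℤ)) v =
      I.network.netOut (fun α => (f α : ℤ)) v +
        I.network.netOut (fun α => (P.count (α, true) : ℤ) - (P.count (α, false) : ℤ)) v := by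
    rw [← Network.netOut_add]
    congr 1
    funext α
    rw [hg α]; ring
  simp only [Network.remaining]
  rw [h2, h]; ring

theorem Layout.searchData_le {σ : Store} (h : I.Layout σ) : σ.reg r_k₁ ≤ σ.reg r_nodes := by
  rw [h.k₁, h.nodes]; omega

end Instance

namespace Code

/-- The labels produced by the successful search play two roles: with the old flow they prove that
the tree path is shortest, and with the new flow they are the labels handed to the next iteration.
-/
theorem body_does {I : Instance} {W n : ℕ} (hW : I.WordOK W) (hreg : I.Regular)
    {σ : Store} (h : I.Inv n σ) (hn : n < I.nT) :
    Does W body σ (1200 * (σ.reg r_arcs + σ.reg r_nodes) + 200) fun τ =>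
      I.Inv (n + 1) τ ∧ I.network.SSPStep (I.storedFlow σ) (I.storedFlow τ) := by
  have hlin := hW.linear hreg
  have hsize := hreg.size_ge
  have hl := h.layout
  have hnodes := hl.nodes
  have hk₁ := hreg.k₁_pos
  obtain ⟨D, hL⟩ := h.labels
  set f := I.storedFlow σ with hfdef
  -- the search
  refine (Does.seq (n := 4) (m := 1200 * (σ.reg r_arcs + σ.reg r_nodes) + 196)
    (Q := fun τ => τ.reg r_found = 0 ∧ τ.reg r_raise = 0)
    (Does.of_wp (by simp [Prog.wp, Expr.Fits, Expr.eval]) (by decide)) ?_).mono (by omega)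
    fun _ _ h => h
  rintro τ₁ F₁ ⟨hfound₁, hraise₁⟩
  have d₁ : τ₁.searchData = σ.searchData := F₁.searchData (by decide) (by decide)
  have n₁ : τ₁.reg r_nodes = σ.reg r_nodes := congrArg SearchData.V d₁
  have k₁ : τ₁.reg r_k₁ = σ.reg r_k₁ := congrArg SearchData.k d₁
  have m₁ : τ₁.reg r_arcs = σ.reg r_arcs := congrArg SearchData.M d₁
  have p₁ : τ₁.arr a_pi = σ.arr a_pi := F₁.2 _ (by decide)
  have v₁ : τ₁.arr a_vis = σ.arr a_vis := F₁.2 _ (by decide)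
  have hround := roundLoop_does (W := W) (σ₀ := τ₁) (by rw [d₁]; exact hl.graph)
    (by rw [d₁]; exact h.small hreg hW) (by rw [k₁, hl.k₁]; omega)
    (by rw [k₁, n₁]; exact hl.searchData_le) (D := D) (by rw [d₁, p₁]; exact hL)
    (by rw [d₁]; exact fun pi D => h.labels_le hreg hn pi D)
    (by rw [n₁, v₁]; exact h.vis_le) hraise₁ hfound₁
  rw [m₁, n₁, d₁] at hround
  refine (hround.seq (m := 160 * σ.reg r_nodes + 70) ?_).mono (by omega) fun _ _ h => h
  rintro τ₂ F₂ ⟨hvis₂, hfound₂, D', hL', hS⟩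
  have hdem : σ.searchData.Demand (τ₂.reg r_found) ∧ τ₂.arr a_vis (τ₂.reg r_found) = 1 := by
    rcases hS.found with h | h
    · exact absurd h.1 hfound₂
    · exact h
  have hl₁ : I.Layout τ₁ := hl.frame F₁ (by decide) (by decide)
  have hl₂ : I.Layout τ₂ := hl₁.frame F₂ (by decide) (by decide)
  have hK₂ : I.Keeps τ₂ f :=
    (h.keeps.frame F₁ (by decide) (by decide)).frame F₂ (by decide) (by decide)
  have d₂ : τ₂.searchData = σ.searchData :=
    (F₂.searchData (by decide) (by decide)).trans d₁
  have rem₂ : τ₂.arr a_rem = σ.arr a_rem := congrArg SearchData.rem d₂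
  have left₂ : τ₂.reg r_left = σ.reg r_left :=
    (F₂.1 _ (by decide)).trans (F₁.1 _ (by decide))
  have m₂ : τ₂.reg r_arcs = σ.reg r_arcs := congrArg SearchData.M d₂
  have n₂ : τ₂.reg r_nodes = σ.reg r_nodes := congrArg SearchData.V d₂
  have hfV : τ₂.reg r_found < I.k₁ + I.k₂ + 2 := by
    have := hdem.1.2.1; rw [← hl.nodes]; exact this
  have hremle := h.rem_le
  -- the demand node
  refine (Does.seq (n := 9) (m := 160 * σ.reg r_nodes + 61)
    (Q := fun τ => τ.reg r_v = τ₂.reg r_found ∧ τ.arr a_rem =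
      Function.update (τ₂.arr a_rem) (τ₂.reg r_found) (τ₂.arr a_rem (τ₂.reg r_found) - 1))
    (Does.of_wp (by
      have := hremle (τ₂.reg r_found)
      rw [← rem₂] at this
      simp [Prog.wp, Expr.Fits, Expr.eval]
      omega) (by decide)) ?_).mono (by omega) fun _ _ h => h
  rintro τ₃ F₃ ⟨hv₃, hrem₃⟩
  have hl₃ : I.Layout τ₃ := hl₂.frame F₃ (by decide) (by decide)
  have hK₃ : I.Keeps τ₃ f := hK₂.frame F₃ (by decide) (by decide)
  have n₃ : τ₃.reg r_nodes = σ.reg r_nodes := (F₃.1 _ (by decide)).trans n₂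
  have m₃ : τ₃.reg r_arcs = σ.reg r_arcs := (F₃.1 _ (by decide)).trans m₂
  have hd₃ : τ₃.arr a_hd = σ.arr a_hd := (F₃.2 _ (by decide)).trans (congrArg SearchData.hd d₂)
  have rc₃ : τ₃.arr a_rc = σ.arr a_rc := (F₃.2 _ (by decide)).trans (congrArg SearchData.rc d₂)
  have resid₃ : τ₃.arr a_resid = σ.arr a_resid :=
    (F₃.2 _ (by decide)).trans (congrArg SearchData.resid d₂)
  have pi₃ : τ₃.arr a_pi = τ₂.arr a_pi := F₃.2 _ (by decide)
  have vis₃ : τ₃.arr a_vis = τ₂.arr a_vis := F₃.2 _ (by decide)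
  have par₃ : τ₃.arr a_par = τ₂.arr a_par := F₃.2 _ (by decide)
  have queue₃ : τ₃.arr a_queue = τ₂.arr a_queue := F₃.2 _ (by decide)
  have qt₃ : τ₃.reg r_qt = τ₂.reg r_qt := F₃.1 _ (by decide)
  have left₃ : τ₃.reg r_left = σ.reg r_left := (F₃.1 _ (by decide)).trans left₂
  -- Hubs have no remaining demand, so the reached node is a level of the second covariate.
  obtain ⟨t, ht⟩ : ∃ t : Fin I.k₂, I.k₁ + t = τ₂.reg r_found := by
    obtain ⟨h1, h2, h3⟩ := hdem.1
    change σ.reg r_k₁ ≤ _ at h1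
    change 0 < σ.arr a_rem _ at h3
    rw [hl.k₁] at h1
    have : ¬ I.k₁ + I.k₂ ≤ τ₂.reg r_found := fun hle => by rw [h.rem_hub _ hle] at h3; omega
    exact ⟨⟨τ₂.reg r_found - I.k₁, by omega⟩, by simp only; omega⟩
  have hslack₃ : Slack τ₃ := by
    intro r hr
    rw [resid₃, pi₃, hd₃, rc₃]
    exact hL'.slack r (by rw [m₃] at hr; exact hr)
  -- the path
  have hpush := pushLoop_does hW hreg hl₃ hK₃ hslack₃ (d := σ.searchData) m₃.symm n₃.symm
    hd₃.symm rc₃.symm resid₃.symm (qh := τ₂.reg r_qt) (k := τ₂.reg r_k)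
    (by rw [pi₃, vis₃, par₃, queue₃, qt₃, hv₃]; exact hS) (by rw [hv₃]; exact hdem.1)
    (y := .lev₂ t) (by rw [hv₃, ← ht]; rfl) (by rw [vis₃, hv₃]; exact hdem.2)
  rw [n₃] at hpush
  refine (hpush.seq (m := 60 * σ.reg r_nodes + 58) ?_).mono (by omega) fun _ _ h => h
  rintro τ₄ F₄ ⟨x, P, g, hx, hsup, hpath, htight, hK₄, hslack₄, hcnt⟩
  have hl₄ : I.Layout τ₄ := hl₃.frame F₄ (by decide) (by decide)
  have rem₄ : τ₄.arr a_rem = τ₃.arr a_rem := F₄.2 _ (by decide)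
  have left₄ : τ₄.reg r_left = σ.reg r_left := (F₄.1 _ (by decide)).trans left₃
  have n₄ : τ₄.reg r_nodes = σ.reg r_nodes := (F₄.1 _ (by decide)).trans n₃
  have m₄ : τ₄.reg r_arcs = σ.reg r_arcs := (F₄.1 _ (by decide)).trans m₃
  have pi₄ : τ₄.arr a_pi = τ₂.arr a_pi := (F₄.2 _ (by decide)).trans pi₃
  have vis₄ : τ₄.arr a_vis = τ₂.arr a_vis := (F₄.2 _ (by decide)).trans vis₃
  obtain ⟨s, hs⟩ : ∃ s : Fin I.k₁, (s : ℕ) = τ₄.reg r_v := by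
    have h1 := hsup.1
    change _ < σ.reg r_k₁ at h1
    rw [hl.k₁] at h1
    exact ⟨⟨_, h1⟩, rfl⟩
  have hxs : x = .lev₁ s := I.num_injective (by rw [hx, ← hs]; rfl)
  subst hxs
  have hleft := h.left
  -- The supply is numbered below `k₁` and the demand is not; so the two decrements affect different
  -- entries.
  have hst : τ₄.reg r_v ≠ τ₂.reg r_found := by omega
  have hrem₄ : τ₄.arr a_rem (τ₄.reg r_v) = σ.arr a_rem (τ₄.reg r_v) := by
    rw [rem₄, hrem₃, Function.update_of_ne hst, rem₂]
  refine (Does.seq (n := 12) (m := 60 * σ.reg r_nodes + 46)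
    (Q := fun τ => τ.reg r_v = 0 ∧ τ.reg r_left = τ₄.reg r_left - 1 ∧ τ.arr a_rem =
      Function.update (τ₄.arr a_rem) (τ₄.reg r_v) (τ₄.arr a_rem (τ₄.reg r_v) - 1))
    (Does.of_wp (by
      have := hremle (τ₄.reg r_v)
      rw [← hrem₄] at this
      simp [Prog.wp, Expr.Fits, Expr.eval]
      omega) (by decide)) ?_).mono (by omega) fun _ _ h => h
  rintro τ₅ F₅ ⟨hv₅, left₅, hrem₅⟩
  have hl₅ : I.Layout τ₅ := hl₄.frame F₅ (by decide) (by decide)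
  have hK₅ : I.Keeps τ₅ g := hK₄.frame F₅ (by decide) (by decide)
  have hcopy := copyLoop_does hW hreg hl₅ hK₅ hv₅
  have n₅ : τ₅.reg r_nodes = σ.reg r_nodes := (F₅.1 _ (by decide)).trans n₄
  have m₅ : τ₅.reg r_arcs = σ.reg r_arcs := (F₅.1 _ (by decide)).trans m₄
  rw [n₅] at hcopy
  refine hcopy.mono (by omega) fun τ F₆ hτ => ?_
  have hl₆ : I.Layout τ := hl₅.frame F₆ (by decide) (by decide)
  have hK₆ : I.Keeps τ g := hK₅.frame F₆ (by decide) (by decide)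
  have n₆ : τ.reg r_nodes = σ.reg r_nodes := (F₆.1 _ (by decide)).trans n₅
  have m₆ : τ.reg r_arcs = σ.reg r_arcs := (F₆.1 _ (by decide)).trans m₅
  have pi₆ : τ.arr a_pi = τ₂.arr a_pi :=
    (F₆.2 _ (by decide)).trans ((F₅.2 _ (by decide)).trans pi₄)
  have vis₆ : τ.arr a_vis = τ₂.arr a_vis :=
    (F₆.2 _ (by decide)).trans ((F₅.2 _ (by decide)).trans vis₄)
  have left₆ : τ.reg r_left = σ.reg r_left - 1 := by
    rw [F₆.1 r_left (by decide), left₅, left₄]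
  have rem₆ : ∀ v, τ.arr a_rem v = if v = (s : ℕ) ∨ v = I.k₁ + (t : ℕ) then σ.arr a_rem v - 1
      else σ.arr a_rem v := by
    intro v
    rw [F₆.2 a_rem (by decide), hrem₅, hrem₄, rem₄, hrem₃, rem₂]
    simp only [Function.update_apply, ← hs, ← ht]
    have : (s : ℕ) < I.k₁ := s.2
    by_cases e1 : v = (s : ℕ)
    · simp [e1]
    · by_cases e2 : v = I.k₁ + (t : ℕ)
      · simp [e2]
        omega
      · simp [e1, e2]
  have hspos : 0 < σ.arr a_rem s := by rw [hs]; exact hsup.2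
  have htpos : 0 < σ.arr a_rem (I.k₁ + t) := by rw [ht]; exact hdem.1.2.2
  have hR := remaining_augment hpath.1 hcnt
  -- Distinct heads force distinct arcs, so no arc gains more than one unit and the flow bound grows
  -- by at most one.
  have hPnd : P.Nodup := List.Nodup.of_map _ (List.nodup_cons.1 hpath.2).2
  have hsum₁ := sum_remaining₁ g
  have hsum₂ := sum_remaining₁ f
  constructor
  · refine ⟨hl₆, by rw [hτ]; exact hK₆, by omega, ⟨D', ?_, ?_, ?_, ?_⟩, ?_, ?_, ?_, ?_, ?_, ?_,
      ?_, ?_⟩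
    · intro r hr hpos
      have hr' : r < 2 * τ₄.reg r_arcs := by rw [m₄, ← m₆]; exact hr
      have e1 : τ.arr a_resid = τ₄.arr a_resid :=
        (F₆.2 _ (by decide)).trans (F₅.2 _ (by decide))
      have e2 : τ.arr a_hd = τ₄.arr a_hd := (F₆.2 _ (by decide)).trans (F₅.2 _ (by decide))
      have e3 : τ.arr a_rc = τ₄.arr a_rc := (F₆.2 _ (by decide)).trans (F₅.2 _ (by decide))
      simp only [Store.searchData, SearchData.tl] at hpos ⊢
      rw [e1] at hpos
      rw [e2, e3, pi₆, ← pi₄]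
      exact hslack₄ r hr' hpos
    -- Remaining supplies and demands only decrease, so every supply or demand after the step
    -- already was one before it and keeps its label.
    · intro v hv
      rw [pi₆]
      refine hL'.sup v ⟨?_, ?_⟩
      · have := hv.1
        simp only [Store.searchData, hl₆.k₁, hl.k₁] at this ⊢
        exact this
      · have := hv.2
        simp only [Store.searchData] at this ⊢
        rw [rem₆] at this
        split_ifs at this <;> omega
    · intro v hv
      rw [pi₆]
      refine hL'.dem v ⟨?_, ?_, ?_⟩
      · have := hv.1
        simp only [Store.searchData, hl₆.k₁, hl.k₁] at this ⊢
        exact this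
      · have := hv.2.1
        simp only [Store.searchData, n₆] at this ⊢
        exact this
      · have := hv.2.2
        simp only [Store.searchData] at this ⊢
        rw [rem₆] at this
        split_ifs at this <;> omega
    · intro v hv
      rw [pi₆]
      exact hL'.le v (by simp only [Store.searchData, n₆] at hv; exact hv)
    · rw [n₆, vis₆]; exact hvis₂
    · intro α
      have h1 := h.flow_le α
      rw [← hfdef] at h1
      have h2 := hcnt α
      have h3 := List.nodup_iff_count_le_one.1 hPnd (α, true)
      rw [hτ]
      omega
    · intro i
      rw [hτ, hR, rem₆, ← h.rem₁ i]
      have : (i : ℕ) < I.k₁ := i.2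
      by_cases e : i = s
      · subst e; simp; omega
      · have e' : (i : ℕ) ≠ s := fun h => e (Fin.ext h)
        rw [if_neg (by omega)]
        simp [Ne.symm e]
    · intro i
      rw [hτ, hR, rem₆]
      have hi := h.rem₂ i
      rw [← hfdef] at hi
      have : (s : ℕ) < I.k₁ := s.2
      by_cases e : i = t
      · subst e; simp; omega
      · have e' : (i : ℕ) ≠ t := fun h => e (Fin.ext h)
        rw [if_neg (by omega)]
        simp [Ne.symm e]
        omega
    · rw [hτ, hR, h.hub₁]; simp
    · rw [hτ, hR, h.hub₂]; simp
    · intro v hv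
      rw [rem₆]
      have := h.rem_hub v hv
      split_ifs <;> omega
    -- The amount sent across is computed from the remaining supplies: their total drops by one at
    -- the first node of the path, and the hub is unaffected.
    · rw [hτ]
      have h1 : ∑ i, I.network.remaining g (.lev₁ i) =
          ∑ i, I.network.remaining f (.lev₁ i) - 1 := by
        rw [Finset.sum_congr rfl fun i _ => hR (.lev₁ i), Finset.sum_sub_distrib]
        simp
      have h2 : I.network.remaining g .hub₁ = I.network.remaining f .hub₁ := by
        rw [hR]; simp
      rw [h1, h2] at hsum₁
      have h3 := h.cross
      rw [← hfdef] at h3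
      rw [← Nat.cast_sum] at hsum₁ hsum₂
      omega
  · refine ⟨.lev₁ s, .lev₂ t, P, 1, one_pos, ?_, ?_, ?_,
      Network.resCapGE_of_isResWalk hpath.1, ?_⟩
    · rw [← h.rem₁ s]; exact_mod_cast hspos
    · rw [← h.rem₂ t]; exact_mod_cast htpos
    · rw [pi₃] at htight
      exact (h.potential hL').isShortest hpath htight
    · intro α
      rw [hτ, hcnt α]; push_cast; ring

end Code

/-! ### Building the adjacency tables -/

open Instance

/-- Uniqueness of quotient and remainder. It makes the flattened two-dimensional tables free of
collisions as long as row entries stay below the stride. -/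
theorem pair_inj {B v v' k k' : ℕ} (hk : k < B) (hk' : k' < B)
    (h : v * B + k = v' * B + k') : v = v' ∧ k = k' := by
  have h1 : (v * B + k) / B = v := by
    rw [mul_comm, Nat.mul_add_div (by omega), Nat.div_eq_of_lt hk, add_zero]
  have h2 : (v' * B + k') / B = v' := by
    rw [mul_comm, Nat.mul_add_div (by omega), Nat.div_eq_of_lt hk', add_zero]
  have e : v = v' := by rw [← h1, ← h2, h]
  subst e
  exact ⟨rfl, by omega⟩

/-- The two new residual arcs are appended to the lists of the two end nodes. A degree is at most `2
* M` and hence below the stride, so the new cells of the table differ from all occupied ones; that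
the ends differ keeps the two new cells apart. -/
theorem SearchData.Graph.addArc {d d' : SearchData} (h : d.Graph) {s t : ℕ} (hs : s < d.V)
    (ht : t < d.V) (hst : s ≠ t) {B : ℕ} {A A' : ℕ → ℕ} (hB : 2 * d.M + 2 ≤ B)
    (hA : ∀ v k, d.adj v k = A (v * B + k)) (hA' : ∀ v k, d'.adj v k = A' (v * B + k))
    (eV : d'.V = d.V) (eM : d'.M = d.M + 1)
    (ehd : d'.hd = Function.update (Function.update d.hd (2 * d.M) t) (2 * d.M + 1) s)
    (edeg : d'.deg = Function.update (Function.update d.deg s (d.deg s + 1)) t (d.deg t + 1))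
    (eA : A' = Function.update (Function.update A (s * B + d.deg s) (2 * d.M))
      (t * B + d.deg t) (2 * d.M + 1)) : d'.Graph := by
  have hhd : ∀ r < 2 * d.M, d'.hd r = d.hd r := fun r hr => by
    rw [ehd, Function.update_of_ne (by omega), Function.update_of_ne (by omega)]
  have hhd0 : d'.hd (2 * d.M) = t := by
    rw [ehd, Function.update_of_ne (by omega), Function.update_self]
  have hhd1 : d'.hd (2 * d.M + 1) = s := by rw [ehd, Function.update_self]
  have htl : ∀ r < 2 * d.M, d'.tl r = d.tl r := fun r hr => hhd _ (mate_lt hr)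
  have htl0 : d'.tl (2 * d.M) = s := by rw [SearchData.tl, mate_even, hhd1]
  have htl1 : d'.tl (2 * d.M + 1) = t := by rw [SearchData.tl, mate_odd, hhd0]
  have hdeg : ∀ v, d'.deg v = d.deg v + (if v = s then 1 else 0) + if v = t then 1 else 0 := by
    intro v
    rw [edeg]
    simp only [Function.update_apply]
    split_ifs with h1 h2 h2 <;> first | omega | (subst_vars; omega)
  have hle : ∀ v < d.V, d.deg v ≤ 2 * d.M := fun v hv => h.deg_le hv
  have hadj : ∀ v < d.V, ∀ k < d.deg v, d'.adj v k = d.adj v k := fun v hv k hk => by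
    have h1 := hle v hv
    have h2 := hle s hs
    have h3 := hle t ht
    rw [hA', hA, eA, Function.update_of_ne, Function.update_of_ne]
    · intro e
      obtain ⟨rfl, rfl⟩ := pair_inj (by omega) (by omega) e
      omega
    · intro e
      obtain ⟨rfl, rfl⟩ := pair_inj (by omega) (by omega) e
      omega
  have hadjs : d'.adj s (d.deg s) = 2 * d.M := by
    have h2 := hle s hs
    have h3 := hle t ht
    rw [hA', eA, Function.update_of_ne, Function.update_self]
    intro e
    exact hst (pair_inj (by omega) (by omega) e).1
  have hadjt : d'.adj t (d.deg t) = 2 * d.M + 1 := by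
    rw [hA', eA, Function.update_self]
  have hcases : ∀ v, ∀ k < d'.deg v,
      k < d.deg v ∨ (v = s ∧ k = d.deg s) ∨ (v = t ∧ k = d.deg t) := by
    intro v k hk
    rw [hdeg] at hk
    by_cases h1 : v = s
    · subst h1
      rw [if_pos rfl, if_neg hst] at hk
      by_cases h3 : k < d.deg v
      · exact .inl h3
      · exact .inr (.inl ⟨rfl, by omega⟩)
    · by_cases h2 : v = t
      · subst h2
        rw [if_neg h1, if_pos rfl] at hk
        by_cases h3 : k < d.deg v
        · exact .inl h3
        · exact .inr (.inr ⟨rfl, by omega⟩)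
      · rw [if_neg h1, if_neg h2] at hk
        exact .inl (by omega)
  refine ⟨fun r hr => ?_, fun v hv k hk => ?_, fun v hv k hk => ?_, fun r hr => ?_, ?_⟩
  · rw [eM] at hr
    rw [eV]
    by_cases h0 : r = 2 * d.M
    · rw [h0, hhd0]; exact ht
    by_cases h1 : r = 2 * d.M + 1
    · rw [h1, hhd1]; exact hs
    rw [hhd r (by omega)]; exact h.hd_lt r (by omega)
  · rw [eV] at hv
    rw [eM]
    rcases hcases v k hk with h1 | ⟨rfl, rfl⟩ | ⟨rfl, rfl⟩
    · rw [hadj v hv k h1]; have := h.adj_lt v hv k h1; omega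
    · rw [hadjs]; omega
    · rw [hadjt]; omega
  · rw [eV] at hv
    rcases hcases v k hk with h1 | ⟨rfl, rfl⟩ | ⟨rfl, rfl⟩
    · rw [hadj v hv k h1, htl _ (h.adj_lt v hv k h1)]; exact h.tl_adj v hv k h1
    · rw [hadjs, htl0]
    · rw [hadjt, htl1]
  · rw [eM] at hr
    by_cases h0 : r = 2 * d.M
    · subst h0
      refine ⟨d.deg s, ?_, ?_⟩
      · rw [htl0, hdeg, if_pos rfl]; omega
      · rw [htl0, hadjs]
    by_cases h1 : r = 2 * d.M + 1
    · subst h1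
      refine ⟨d.deg t, ?_, ?_⟩
      · rw [htl1, hdeg, if_pos rfl]; omega
      · rw [htl1, hadjt]
    have hr' : r < 2 * d.M := by omega
    obtain ⟨k, hk, e⟩ := h.adj_mem r hr'
    have hV : d.tl r < d.V := h.hd_lt _ (mate_lt hr')
    refine ⟨k, ?_, ?_⟩
    · rw [htl r hr', hdeg]; omega
    · rw [htl r hr', hadj _ hV k hk, e]
  · rw [eV, eM, Finset.sum_congr rfl fun v _ => hdeg v, Finset.sum_add_distrib,
      Finset.sum_add_distrib, h.sum_deg, Finset.sum_ite_eq', Finset.sum_ite_eq',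
      if_pos (Finset.mem_range.2 hs), if_pos (Finset.mem_range.2 ht)]
    ring

namespace Code

/-- `τ` arises from `σ` by adding an arc. -/
structure Added (σ τ : Store) (s t c : ℕ) : Prop where
  graph : τ.searchData.Graph
  arcs : τ.reg r_arcs = σ.reg r_arcs + 1
  hd_fwd : τ.arr a_hd (2 * σ.reg r_arcs) = t
  hd_bwd : τ.arr a_hd (2 * σ.reg r_arcs + 1) = s
  rc_fwd : τ.arr a_rc (2 * σ.reg r_arcs) = 1 + c
  rc_bwd : τ.arr a_rc (2 * σ.reg r_arcs + 1) = 1 - c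
  hd_old : ∀ r < 2 * σ.reg r_arcs, τ.arr a_hd r = σ.arr a_hd r
  rc_old : ∀ r < 2 * σ.reg r_arcs, τ.arr a_rc r = σ.arr a_rc r

/-- For costs at most `1` the shifted backward cost `1 - c` involves no truncation. -/
theorem addArc_does {W : ℕ} {σ : Store} (hG : σ.searchData.Graph)
    (hs : σ.reg r_s < σ.reg r_nodes) (ht : σ.reg r_t < σ.reg r_nodes)
    (hst : σ.reg r_s ≠ σ.reg r_t) (hc : σ.reg r_c ≤ 1)
    (hB : 2 * σ.reg r_arcs + 2 ≤ σ.reg r_stride)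
    (hW : σ.reg r_nodes * σ.reg r_stride + 2 * σ.reg r_stride + σ.reg r_nodes + 10 ≤ W) :
    Does W addArc σ 70 fun τ => Added σ τ (σ.reg r_s) (σ.reg r_t) (σ.reg r_c) := by
  have h1 := Nat.mul_le_mul_right (σ.reg r_stride) hs.le
  have h2 := Nat.mul_le_mul_right (σ.reg r_stride) ht.le
  have h3 : σ.arr a_deg (σ.reg r_s) ≤ 2 * σ.reg r_arcs := hG.deg_le hs
  have h4 : σ.arr a_deg (σ.reg r_t) ≤ 2 * σ.reg r_arcs := hG.deg_le ht
  have hup : Function.update (σ.arr a_deg) (σ.reg r_s) (σ.arr a_deg (σ.reg r_s) + 1) (σ.reg r_t) =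
    σ.arr a_deg (σ.reg r_t) := Function.update_of_ne (Ne.symm hst) _ _
  have main : Does W addArc σ 70 fun τ => τ.reg r_arcs = σ.reg r_arcs + 1 ∧
      τ.arr a_hd = Function.update (Function.update (σ.arr a_hd) (2 * σ.reg r_arcs) (σ.reg r_t))
        (2 * σ.reg r_arcs + 1) (σ.reg r_s) ∧
      τ.arr a_rc = Function.update (Function.update (σ.arr a_rc) (2 * σ.reg r_arcs)
        (1 + σ.reg r_c)) (2 * σ.reg r_arcs + 1) (1 - σ.reg r_c) ∧
      τ.arr a_deg = Function.update (Function.update (σ.arr a_deg) (σ.reg r_s)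
        (σ.arr a_deg (σ.reg r_s) + 1)) (σ.reg r_t) (σ.arr a_deg (σ.reg r_t) + 1) ∧
      τ.arr a_adj = Function.update (Function.update (σ.arr a_adj)
        (σ.reg r_s * σ.reg r_stride + σ.arr a_deg (σ.reg r_s)) (2 * σ.reg r_arcs))
        (σ.reg r_t * σ.reg r_stride + σ.arr a_deg (σ.reg r_t)) (2 * σ.reg r_arcs + 1) := by
    refine Does.of_wp ?_ (by decide)
    simp [addArc, Prog.wp, Expr.Fits, Expr.eval, hup]
    repeat' apply And.intro
    all_goals omega
  refine main.mono le_rfl ?_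
  rintro τ F ⟨e1, e2, e3, e4, e5⟩
  have eV : τ.reg r_nodes = σ.reg r_nodes := F.1 _ (by decide)
  have eB : τ.reg r_stride = σ.reg r_stride := F.1 _ (by decide)
  refine ⟨?_, e1, ?_, ?_, ?_, ?_, fun r hr => ?_, fun r hr => ?_⟩
  · exact hG.addArc hs ht hst (B := σ.reg r_stride) (A := σ.arr a_adj) (A' := τ.arr a_adj) hB
      (fun v k => rfl) (fun v k => by simp only [Store.searchData, eB]) eV e1 e2 e4 e5
  · rw [e2, Function.update_of_ne (by omega), Function.update_self]
  · rw [e2, Function.update_self]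
  · rw [e3, Function.update_of_ne (by omega), Function.update_self]
  · rw [e3, Function.update_self]
  · rw [e2, Function.update_of_ne (by omega), Function.update_of_ne (by omega)]
  · rw [e3, Function.update_of_ne (by omega), Function.update_of_ne (by omega)]

/-! ### Counting the treatment samples -/

theorem card_filter_lt_succ {n j : ℕ} (hj : j < n) (p : Fin n → Prop) [DecidablePred p] :
    (Finset.univ.filter fun x : Fin n => (x : ℕ) < j + 1 ∧ p x).card =
      (Finset.univ.filter fun x : Fin n => (x : ℕ) < j ∧ p x).card +
        if p ⟨j, hj⟩ then 1 else 0 := by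
  have hset : (Finset.univ.filter fun x : Fin n => (x : ℕ) < j + 1 ∧ p x) =
      (Finset.univ.filter fun x : Fin n => (x : ℕ) < j ∧ p x) ∪
        if p ⟨j, hj⟩ then {⟨j, hj⟩} else ∅ := by
    ext x
    simp only [Finset.mem_union, Finset.mem_filter, Finset.mem_univ, true_and]
    constructor
    · rintro ⟨h1, h2⟩
      rcases Nat.lt_succ_iff_lt_or_eq.1 h1 with h | h
      · exact .inl ⟨h, h2⟩
      · right
        have : x = ⟨j, hj⟩ := Fin.ext h
        subst this
        simp [h2]
    · rintro (⟨h1, h2⟩ | h)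
      · exact ⟨by omega, h2⟩
      · split_ifs at h with hp
        · rw [Finset.mem_singleton] at h
          subst h
          exact ⟨by simp, hp⟩
        · simp at h
  rw [hset, Finset.card_union_of_disjoint]
  · split_ifs <;> simp
  · rw [Finset.disjoint_left]
    intro x hx hx'
    simp only [Finset.mem_filter, Finset.mem_univ, true_and] at hx
    split_ifs at hx'
    · rw [Finset.mem_singleton] at hx'
      subst hx'
      simp at hx
    · simp at hx'

theorem countLoop_does {I : Instance} {W : ℕ} (hW : I.WordOK W) (hreg : I.Regular)
    {σ₀ : Store} (hnT : σ₀.reg r_nT = I.nT) (hk₁ : σ₀.reg r_k₁ = I.k₁)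
    (ht₁ : ∀ j : Fin I.nT, σ₀.arr a_treat₁ j = I.treat₁ j)
    (ht₂ : ∀ j : Fin I.nT, σ₀.arr a_treat₂ j = I.treat₂ j)
    (hrem : ∀ v, σ₀.arr a_rem v = 0) (hv : σ₀.reg r_v = 0) :
    Does W countLoop σ₀ (I.nT * 50 + 4) fun τ =>
      (∀ i : Fin I.k₁, τ.arr a_rem i = I.ell₁ i) ∧
      (∀ i : Fin I.k₂, τ.arr a_rem (I.k₁ + i) = I.ell₂ i) ∧
      ∀ v, I.k₁ + I.k₂ ≤ v → τ.arr a_rem v = 0 := by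
  have hlin := hW.linear hreg
  have hsize := hreg.size_ge
  refine (Does.loop (b := 46) (n := I.nT) (fun n σ =>
    σ.reg r_v + n = I.nT ∧
    (∀ i : Fin I.k₁, σ.arr a_rem i =
      (Finset.univ.filter fun x : Fin I.nT => (x : ℕ) < σ.reg r_v ∧ I.treat₁ x = i).card) ∧
    (∀ i : Fin I.k₂, σ.arr a_rem (I.k₁ + i) =
      (Finset.univ.filter fun x : Fin I.nT => (x : ℕ) < σ.reg r_v ∧ I.treat₂ x = i).card) ∧
    ∀ v, I.k₁ + I.k₂ ≤ v → σ.arr a_rem v = 0) ?_ ?_).mono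
      (m := I.nT * 50 + 4) (by simp only [Expr.time]; omega) (fun _ _ h => h)
  · rw [hv]; simp [hrem]
  rintro n σ hF ⟨hn, h1, h2, h3⟩
  have enT : σ.reg r_nT = I.nT := (hF.1 _ (by decide)).trans hnT
  have ek₁ : σ.reg r_k₁ = I.k₁ := (hF.1 _ (by decide)).trans hk₁
  refine ⟨?_, fun hc => ?_, fun hc => ?_⟩
  · simp only [Expr.Fits, Op.eval_lt, Expr.eval]
    exact ⟨by omega, by omega, ite_one_zero_le (by omega) _⟩
  · have hlt : σ.reg r_v < I.nT := by
      simp [Expr.eval, enT] at hc; omega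
    refine ⟨n - 1, by omega, Does.of_wp ?_ (by decide)⟩
    obtain ⟨x, hx⟩ : ∃ x : Fin I.nT, (x : ℕ) = σ.reg r_v := ⟨⟨_, hlt⟩, rfl⟩
    have e1 : σ.arr a_treat₁ (σ.reg r_v) = I.treat₁ x := by
      rw [hF.2 a_treat₁ (by decide), ← hx, ht₁]
    have e2 : σ.arr a_treat₂ (σ.reg r_v) = I.treat₂ x := by
      rw [hF.2 a_treat₂ (by decide), ← hx, ht₂]
    have hxe : x = ⟨σ.reg r_v, hlt⟩ := Fin.ext hx
    have b1 : σ.arr a_rem (I.treat₁ x) ≤ I.nT := by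
      rw [h1]; simpa using Finset.card_filter_le (Finset.univ : Finset (Fin I.nT)) _
    have b2 : σ.arr a_rem (I.k₁ + I.treat₂ x) ≤ I.nT := by
      rw [h2]; simpa using Finset.card_filter_le (Finset.univ : Finset (Fin I.nT)) _
    have l1 : (I.treat₁ x : ℕ) < I.k₁ := (I.treat₁ x).2
    have l2 : (I.treat₂ x : ℕ) < I.k₂ := (I.treat₂ x).2
    have hup : Function.update (σ.arr a_rem) (I.treat₁ x : ℕ)
        (σ.arr a_rem (I.treat₁ x) + 1) (I.k₁ + (I.treat₂ x : ℕ)) =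
          σ.arr a_rem (I.k₁ + I.treat₂ x) := Function.update_of_ne (by omega) _ _
    have f1 : ∀ i : Fin I.k₁, Function.update (Function.update (σ.arr a_rem) (I.treat₁ x : ℕ)
        (σ.arr a_rem (I.treat₁ x) + 1)) (I.k₁ + (I.treat₂ x : ℕ))
        (σ.arr a_rem (I.k₁ + I.treat₂ x) + 1) i =
        (Finset.univ.filter fun x : Fin I.nT =>
          (x : ℕ) < σ.reg r_v + 1 ∧ I.treat₁ x = i).card := by
      intro i
      rw [card_filter_lt_succ hlt fun x => I.treat₁ x = i, ← hxe, ← h1,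
        Function.update_of_ne (by omega), Function.update_apply]
      by_cases e : I.treat₁ x = i
      · subst e; simp
      · rw [if_neg e, if_neg (fun h => e (Fin.ext h.symm))]; simp
    have f2 : ∀ i : Fin I.k₂, Function.update (Function.update (σ.arr a_rem) (I.treat₁ x : ℕ)
        (σ.arr a_rem (I.treat₁ x) + 1)) (I.k₁ + (I.treat₂ x : ℕ))
        (σ.arr a_rem (I.k₁ + I.treat₂ x) + 1) (I.k₁ + i) =
        (Finset.univ.filter fun x : Fin I.nT =>
          (x : ℕ) < σ.reg r_v + 1 ∧ I.treat₂ x = i).card := by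
      intro i
      rw [card_filter_lt_succ hlt fun x => I.treat₂ x = i, ← hxe, ← h2, Function.update_apply]
      by_cases e : I.treat₂ x = i
      · subst e; simp
      · rw [if_neg e, if_neg (fun h => e (Fin.ext (by omega))),
          Function.update_of_ne (by omega)]; simp
    have f3 : ∀ v, I.k₁ + I.k₂ ≤ v → Function.update (Function.update (σ.arr a_rem)
        (I.treat₁ x : ℕ) (σ.arr a_rem (I.treat₁ x) + 1)) (I.k₁ + (I.treat₂ x : ℕ))
        (σ.arr a_rem (I.k₁ + I.treat₂ x) + 1) v = 0 := fun v hv => by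
      rw [Function.update_of_ne (by omega), Function.update_of_ne (by omega), h3 v hv]
    simp [countBody, Prog.wp, Expr.Fits, Expr.eval, e1, e2, ek₁, hup, -Order.lt_add_one_iff]
    repeat' (first | exact f1 | exact f2 | exact f3 | apply And.intro)
    all_goals omega
  · have hge : σ.reg r_v = I.nT := by
      simp [Expr.eval, enT] at hc; omega
    rw [hge] at h1 h2
    refine ⟨fun i => ?_, fun i => ?_, h3⟩
    · rw [h1, ell₁]; congr 1; ext x; simp
    · rw [h2, ell₂]; congr 1; ext x; simp

end Code

theorem Prog.Frame.graph {p : Prog} {σ τ : Store} (hF : p.Frame σ τ) (hG : σ.searchData.Graph)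
    (hr : ∀ r ∈ [r_stride, r_arcs, r_nodes], r ∉ p.regs)
    (ha : ∀ a ∈ [a_hd, a_adj, a_deg], a ∉ p.arrs) : τ.searchData.Graph := by
  simp only [List.mem_cons, List.not_mem_nil, or_false, forall_eq_or_imp, forall_eq] at hr ha
  have e1 := hF.1 _ hr.1
  have e2 := hF.1 _ hr.2.1
  have e3 := hF.1 _ hr.2.2
  have e4 := hF.2 _ ha.1
  have e5 := hF.2 _ ha.2.1
  have e6 := hF.2 _ ha.2.2
  obtain ⟨j1, j2, j3, j4, j5⟩ := hG
  simp only [Store.searchData, SearchData.tl] at j1 j2 j3 j4 j5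
  constructor <;> simp only [Store.searchData, SearchData.tl, e1, e2, e3, e4, e5, e6] <;>
    assumption

theorem Does.ite {W : ℕ} {c : Expr} {p q : Prog} {σ : Store} {n : ℕ} {Q : Store → Prop}
    (hc : c.Fits W σ) (hp : c.eval σ ≠ 0 → Does W p σ n Q) (hq : c.eval σ = 0 → Does W q σ n Q) :
    Does W (.ite c p q) σ (c.time + 1 + n) Q := by
  by_cases h : c.eval σ = 0
  · obtain ⟨T, τ, h1, h2, h3⟩ := hq h
    exact ⟨_, τ, .iteFalse _ _ _ _ _ _ hc h h1, by omega, h3⟩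
  · obtain ⟨T, τ, h1, h2, h3⟩ := hp h
    exact ⟨_, τ, .iteTrue _ _ _ _ _ _ hc h h1, by omega, h3⟩

/-! ### Initialization: the arcs at the levels -/

namespace Instance

/-- The registers with the sizes of the instance and of the tables. -/
structure Sizes (I : Instance) (σ : Store) : Prop where
  nT : σ.reg r_nT = I.nT
  nC : σ.reg r_nC = I.nC
  k₁ : σ.reg r_k₁ = I.k₁
  k₂ : σ.reg r_k₂ = I.k₂
  stride : σ.reg r_stride = 4 * (I.k₁ + I.k₂) + 2 * I.nC
  nodes : σ.reg r_nodes = I.k₁ + I.k₂ + 2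

variable {I : Instance}

theorem Sizes.frame {σ τ : Store} (h : I.Sizes σ) {p : Prog} (hF : p.Frame σ τ)
    (hr : ∀ r ∈ [r_nT, r_nC, r_k₁, r_k₂, r_stride, r_nodes], r ∉ p.regs) : I.Sizes τ := by
  simp only [List.mem_cons, List.not_mem_nil, or_false, forall_eq_or_imp, forall_eq] at hr
  obtain ⟨h1, h2, h3, h4, h5, h6⟩ := hr
  exact ⟨(hF.1 _ h1).trans h.nT, (hF.1 _ h2).trans h.nC, (hF.1 _ h3).trans h.k₁,
    (hF.1 _ h4).trans h.k₂, (hF.1 _ h5).trans h.stride, (hF.1 _ h6).trans h.nodes⟩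

theorem Sizes.table_le {W : ℕ} {σ : Store} (h : I.Sizes σ) (hW : I.WordOK W) (hreg : I.Regular) :
    σ.reg r_nodes * σ.reg r_stride + 2 * σ.reg r_stride + σ.reg r_nodes + 10 ≤ W := by
  have hlin := hW.linear hreg
  have hsize := hreg.size_ge
  have := hW.mul (a := σ.reg r_nodes) (b := σ.reg r_stride) (by rw [h.nodes]; omega)
    (by rw [h.stride]; omega)
  have e1 := h.nodes
  have e2 := h.stride
  generalize σ.reg r_nodes * σ.reg r_stride = P at *
  omega

/-- The hub next to the level node `w`. -/
def hubOf (I : Instance) (w : ℕ) : ℕ := I.k₁ + I.k₂ + (1 - if w < I.k₁ then 1 else 0)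

/-- The arcs at the first `v` level nodes are in the tables, with their capacities. -/
structure LevelArcs (I : Instance) (v : ℕ) (σ : Store) : Prop where
  hd_exc : ∀ w < v, σ.arr a_hd (4 * w) = w ∧ σ.arr a_hd (4 * w + 1) = I.hubOf w
  hd_def : ∀ w < v, σ.arr a_hd (4 * w + 2) = I.hubOf w ∧ σ.arr a_hd (4 * w + 3) = w
  rc_exc : ∀ w < v, σ.arr a_rc (4 * w) = 2 ∧ σ.arr a_rc (4 * w + 1) = 0
  rc_def : ∀ w < v, σ.arr a_rc (4 * w + 2) = 2 ∧ σ.arr a_rc (4 * w + 3) = 0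
  resid_exc : ∀ w < v, σ.arr a_resid (4 * w) = I.nT + 1 ∧ σ.arr a_resid (4 * w + 1) = 0
  resid_def : ∀ w < v, σ.arr a_resid (4 * w + 2) = I.nT + 1 ∧ σ.arr a_resid (4 * w + 3) = 0

end Instance

namespace Code

open Instance

/-- Level node `v` receives arcs `2 * v` and `2 * v + 1`, that is, the residual arcs from `4 * v` to
`4 * v + 3`. Only the two forward ones get a capacity; the backward ones must still be zero from the
start, which is why the vanishing of the later table is part of the induction. -/
theorem levelBody_does {I : Instance} {W v : ℕ} (hW : I.WordOK W) (hreg : I.Regular)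
    {σ : Store} (hS : I.Sizes σ) (hG : σ.searchData.Graph) (hv : σ.reg r_v = v)
    (hlt : v < I.k₁ + I.k₂) (harcs : σ.reg r_arcs = 2 * v) (hL : I.LevelArcs v σ)
    (hz : ∀ r, 4 * v ≤ r → σ.arr a_resid r = 0) :
    Does W levelBody σ 200 fun τ => τ.searchData.Graph ∧ τ.reg r_v = v + 1 ∧
      τ.reg r_arcs = 2 * (v + 1) ∧ I.LevelArcs (v + 1) τ ∧
      ∀ r, 4 * (v + 1) ≤ r → τ.arr a_resid r = 0 := by
  have hlin := hW.linear hreg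
  have hsize := hreg.size_ge
  have hhub : I.hubOf v < I.k₁ + I.k₂ + 2 := by unfold hubOf; omega
  have hhub' : I.k₁ + I.k₂ ≤ I.hubOf v := by unfold hubOf; omega
  have hA : Does W (r_h ←ᵉ .reg r_k₁ +ᵉ .reg r_k₂ +ᵉ (.lit 1 -ᵉ (.reg r_v <ᵉ .reg r_k₁)) ;;
      r_c ←ᵉ .lit 1 ;; r_s ←ᵉ .reg r_h ;; r_t ←ᵉ .reg r_v ;;
      .store a_resid (.lit 2 *ᵉ .reg r_arcs) (.reg r_nT +ᵉ .lit 1)) σ 25 fun τ =>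
      τ.reg r_h = I.hubOf v ∧ τ.reg r_c = 1 ∧ τ.reg r_s = I.hubOf v ∧ τ.reg r_t = v ∧
      τ.arr a_resid = Function.update (σ.arr a_resid) (4 * v) (I.nT + 1) := by
    refine Does.of_wp ?_ (by decide)
    simp [Prog.wp, Expr.Fits, Expr.eval, hv, hS.k₁, hS.k₂, hS.nT, harcs, hubOf,
      show 2 * (2 * v) = 4 * v by ring]
    repeat' apply And.intro
    all_goals first | omega | (split_ifs <;> omega)
  refine (hA.seq (m := 175) ?_).mono le_rfl fun _ _ h => h
  rintro σ₁ F₁ ⟨h1, c1, s1, t1, r1⟩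
  have S1 := hS.frame F₁ (by decide)
  have v1 : σ₁.reg r_v = v := (F₁.1 _ (by decide)).trans hv
  have a1 : σ₁.reg r_arcs = 2 * v := (F₁.1 _ (by decide)).trans harcs
  have g1 := F₁.graph hG (by decide) (by decide)
  refine ((addArc_does (W := W) g1 (by rw [s1, S1.nodes]; omega)
    (by rw [t1, S1.nodes]; omega) (by rw [s1, t1]; omega) (by rw [c1])
    (by rw [a1, S1.stride]; omega) (S1.table_le hW hreg)).seq (m := 105) ?_).mono le_rfl
      fun _ _ h => h
  rintro σ₂ F₂ A2
  rw [s1, t1, c1] at A2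
  have S2 := S1.frame F₂ (by decide)
  have v2 : σ₂.reg r_v = v := (F₂.1 _ (by decide)).trans v1
  have h2 : σ₂.reg r_h = I.hubOf v := (F₂.1 _ (by decide)).trans h1
  have c2 : σ₂.reg r_c = 1 := (F₂.1 _ (by decide)).trans c1
  have a2 : σ₂.reg r_arcs = 2 * v + 1 := by rw [A2.arcs, a1]
  have r2 : σ₂.arr a_resid = _ := (F₂.2 _ (by decide)).trans r1
  have hB : Does W (r_s ←ᵉ .reg r_v ;; r_t ←ᵉ .reg r_h ;;
      .store a_resid (.lit 2 *ᵉ .reg r_arcs) (.reg r_nT +ᵉ .lit 1)) σ₂ 25 fun τ =>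
      τ.reg r_s = v ∧ τ.reg r_t = I.hubOf v ∧
      τ.arr a_resid = Function.update (σ₂.arr a_resid) (4 * v + 2) (I.nT + 1) := by
    refine Does.of_wp ?_ (by decide)
    simp [Prog.wp, Expr.Fits, Expr.eval, v2, h2, S2.nT, a2,
      show 2 * (2 * v + 1) = 4 * v + 2 by ring]
    omega
  refine (hB.seq (m := 80) ?_).mono le_rfl fun _ _ h => h
  rintro σ₃ F₃ ⟨s3, t3, r3⟩
  have S3 := S2.frame F₃ (by decide)
  have v3 : σ₃.reg r_v = v := (F₃.1 _ (by decide)).trans v2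
  have c3 : σ₃.reg r_c = 1 := (F₃.1 _ (by decide)).trans c2
  have a3 : σ₃.reg r_arcs = 2 * v + 1 := (F₃.1 _ (by decide)).trans a2
  have g3 := F₃.graph A2.graph (by decide) (by decide)
  refine ((addArc_does (W := W) g3 (by rw [s3, S3.nodes]; omega)
    (by rw [t3, S3.nodes]; omega) (by rw [s3, t3]; omega) (by rw [c3])
    (by rw [a3, S3.stride]; omega) (S3.table_le hW hreg)).seq (m := 10) ?_).mono le_rfl
      fun _ _ h => h
  rintro σ₄ F₄ A4
  rw [s3, t3, c3] at A4
  have v4 : σ₄.reg r_v = v := (F₄.1 _ (by decide)).trans v3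
  have hC : Does W (r_v ←ᵉ .reg r_v +ᵉ .lit 1) σ₄ 10 fun τ => τ.reg r_v = v + 1 := by
    refine Does.of_wp ?_ (by decide)
    simp [Prog.wp, Expr.Fits, Expr.eval, v4]
    omega
  refine hC.mono le_rfl ?_
  rintro τ F₅ v5
  have e1 := F₅.2 a_hd (by decide)
  have e6 := F₅.1 r_arcs (by decide)
  have e7 := F₅.2 a_rc (by decide)
  have g5 := F₅.graph A4.graph (by decide) (by decide)
  have hhd : ∀ r < 4 * v, τ.arr a_hd r = σ.arr a_hd r := fun r hr => by
    rw [e1, A4.hd_old r (by omega), F₃.2 a_hd (by decide), A2.hd_old r (by omega),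
      F₁.2 a_hd (by decide)]
  have hrc : ∀ r < 4 * v, τ.arr a_rc r = σ.arr a_rc r := fun r hr => by
    rw [e7, A4.rc_old r (by omega), F₃.2 a_rc (by decide), A2.rc_old r (by omega),
      F₁.2 a_rc (by decide)]
  have hre : τ.arr a_resid = Function.update (Function.update (σ.arr a_resid) (4 * v)
      (I.nT + 1)) (4 * v + 2) (I.nT + 1) := by
    rw [F₅.2 a_resid (by decide), F₄.2 a_resid (by decide), r3, r2]
  have hre' : ∀ r, r ≠ 4 * v → r ≠ 4 * v + 2 → τ.arr a_resid r = σ.arr a_resid r :=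
    fun r h h' => by rw [hre, Function.update_of_ne h', Function.update_of_ne h]
  have x0 : τ.arr a_hd (4 * v) = v := by
    have := A2.hd_fwd
    rw [a1, show 2 * (2 * v) = 4 * v by ring] at this
    rw [e1, A4.hd_old _ (by omega), F₃.2 a_hd (by decide), this]
  have x1 : τ.arr a_hd (4 * v + 1) = I.hubOf v := by
    have := A2.hd_bwd
    rw [a1, show 2 * (2 * v) = 4 * v by ring] at this
    rw [e1, A4.hd_old _ (by omega), F₃.2 a_hd (by decide), this]
  have x2 : τ.arr a_hd (4 * v + 2) = I.hubOf v := by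
    have := A4.hd_fwd
    rw [a3, show 2 * (2 * v + 1) = 4 * v + 2 by ring] at this
    rw [e1, this]
  have x3 : τ.arr a_hd (4 * v + 3) = v := by
    have := A4.hd_bwd
    rw [a3, show 2 * (2 * v + 1) + 1 = 4 * v + 3 by ring] at this
    rw [e1, this]
  have y0 : τ.arr a_rc (4 * v) = 2 := by
    have := A2.rc_fwd
    rw [a1, show 2 * (2 * v) = 4 * v by ring] at this
    rw [e7, A4.rc_old _ (by omega), F₃.2 a_rc (by decide), this]
  have y1 : τ.arr a_rc (4 * v + 1) = 0 := by
    have := A2.rc_bwd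
    rw [a1, show 2 * (2 * v) = 4 * v by ring] at this
    rw [e7, A4.rc_old _ (by omega), F₃.2 a_rc (by decide), this]
  have y2 : τ.arr a_rc (4 * v + 2) = 2 := by
    have := A4.rc_fwd
    rw [a3, show 2 * (2 * v + 1) = 4 * v + 2 by ring] at this
    rw [e7, this]
  have y3 : τ.arr a_rc (4 * v + 3) = 0 := by
    have := A4.rc_bwd
    rw [a3, show 2 * (2 * v + 1) + 1 = 4 * v + 3 by ring] at this
    rw [e7, this]
  have z0 : τ.arr a_resid (4 * v) = I.nT + 1 := by
    rw [hre, Function.update_of_ne (by omega), Function.update_self]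
  have z2 : τ.arr a_resid (4 * v + 2) = I.nT + 1 := by rw [hre, Function.update_self]
  refine ⟨g5, v5, by rw [e6, A4.arcs, a3]; ring, ⟨?_, ?_, ?_, ?_, ?_, ?_⟩, fun r hr => ?_⟩
  · intro w hw
    rcases Nat.lt_succ_iff_lt_or_eq.1 hw with hw | rfl
    · rw [hhd _ (by omega), hhd _ (by omega)]; exact hL.hd_exc w hw
    · exact ⟨x0, x1⟩
  · intro w hw
    rcases Nat.lt_succ_iff_lt_or_eq.1 hw with hw | rfl
    · rw [hhd _ (by omega), hhd _ (by omega)]; exact hL.hd_def w hw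
    · exact ⟨x2, x3⟩
  · intro w hw
    rcases Nat.lt_succ_iff_lt_or_eq.1 hw with hw | rfl
    · rw [hrc _ (by omega), hrc _ (by omega)]; exact hL.rc_exc w hw
    · exact ⟨y0, y1⟩
  · intro w hw
    rcases Nat.lt_succ_iff_lt_or_eq.1 hw with hw | rfl
    · rw [hrc _ (by omega), hrc _ (by omega)]; exact hL.rc_def w hw
    · exact ⟨y2, y3⟩
  · intro w hw
    rcases Nat.lt_succ_iff_lt_or_eq.1 hw with hw | rfl
    · rw [hre' _ (by omega) (by omega), hre' _ (by omega) (by omega)]; exact hL.resid_exc w hw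
    · exact ⟨z0, by rw [hre' _ (by omega) (by omega)]; exact hz _ (by omega)⟩
  · intro w hw
    rcases Nat.lt_succ_iff_lt_or_eq.1 hw with hw | rfl
    · rw [hre' _ (by omega) (by omega), hre' _ (by omega) (by omega)]; exact hL.resid_def w hw
    · exact ⟨z2, by rw [hre' _ (by omega) (by omega)]; exact hz _ (by omega)⟩
  · rw [hre' _ (by omega) (by omega)]; exact hz _ (by omega)

theorem levelLoop_does {I : Instance} {W : ℕ} (hW : I.WordOK W) (hreg : I.Regular)
    {σ₀ : Store} (hS : I.Sizes σ₀) (hv : σ₀.reg r_v = 0) (harcs : σ₀.reg r_arcs = 0)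
    (hdeg : ∀ v, σ₀.arr a_deg v = 0) (hres : ∀ r, σ₀.arr a_resid r = 0) :
    Does W levelLoop σ₀ ((I.k₁ + I.k₂) * 210 + 10) fun τ => τ.searchData.Graph ∧
      τ.reg r_arcs = 2 * (I.k₁ + I.k₂) ∧ I.LevelArcs (I.k₁ + I.k₂) τ ∧
      ∀ r, 4 * (I.k₁ + I.k₂) ≤ r → τ.arr a_resid r = 0 := by
  have hlin := hW.linear hreg
  have hsize := hreg.size_ge
  refine (Does.loop (b := 200) (n := I.k₁ + I.k₂) (fun n σ =>
    σ.reg r_v + n = I.k₁ + I.k₂ ∧ σ.searchData.Graph ∧ σ.reg r_arcs = 2 * σ.reg r_v ∧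
    I.LevelArcs (σ.reg r_v) σ ∧ ∀ r, 4 * σ.reg r_v ≤ r → σ.arr a_resid r = 0) ?_ ?_).mono
      (m := (I.k₁ + I.k₂) * 210 + 10) (by simp only [Expr.time]; omega) (fun _ _ h => h)
  · refine ⟨by omega, ⟨?_, ?_, ?_, ?_, ?_⟩, by omega, ?_, fun r _ => hres r⟩
    · simp [Store.searchData, harcs]
    · simp [Store.searchData, hdeg]
    · simp [Store.searchData, hdeg]
    · simp [Store.searchData, harcs]
    · simp [Store.searchData, harcs, hdeg]
    · rw [hv]
      exact ⟨fun w h => absurd h (by omega), fun w h => absurd h (by omega),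
        fun w h => absurd h (by omega), fun w h => absurd h (by omega),
        fun w h => absurd h (by omega), fun w h => absurd h (by omega)⟩
  rintro n σ hF ⟨hn, h1, h2, h3, h4⟩
  have S := hS.frame hF (by decide)
  refine ⟨?_, fun hc => ?_, fun hc => ?_⟩
  · simp only [Expr.Fits, Op.eval_lt, Op.eval_add, Expr.eval, S.k₁, S.k₂]
    exact ⟨by omega, ⟨by omega, by omega, by omega⟩, ite_one_zero_le (by omega) _⟩
  · have hlt : σ.reg r_v < I.k₁ + I.k₂ := by
      simp [Expr.eval, S.k₁, S.k₂] at hc; omega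
    refine ⟨n - 1, by omega, (levelBody_does hW hreg S h1 rfl hlt h2 h3 h4).mono le_rfl ?_⟩
    rintro τ - ⟨g, v, a, L, z⟩
    rw [← v] at a L z
    exact ⟨by omega, g, a, L, z⟩
  · have hge : σ.reg r_v = I.k₁ + I.k₂ := by
      simp [Expr.eval, S.k₁, S.k₂] at hc; omega
    rw [hge] at h2 h3 h4
    exact ⟨h1, h2, h3, h4⟩

end Code

/-! ### Initialization: the arcs of the level-intersections -/

namespace Instance

/-- The place of a control sample in the table of level-intersections. -/
def key (I : Instance) (x : Fin I.nC) : ℕ := I.ctrl₁ x * I.k₂ + I.ctrl₂ x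

/-- The level-intersections of the first `j` control samples have their arcs. -/
structure CellArcs (I : Instance) (j : ℕ) (σ : Store) : Prop where
  graph : σ.searchData.Graph
  arcs_ge : 2 * (I.k₁ + I.k₂) ≤ σ.reg r_arcs
  arcs_le : σ.reg r_arcs ≤ 2 * (I.k₁ + I.k₂) + j
  cell_ge : ∀ x : Fin I.nC, (x : ℕ) < j → 2 * (I.k₁ + I.k₂) ≤ σ.arr a_cell (I.key x)
  cell_lt : ∀ x : Fin I.nC, (x : ℕ) < j → σ.arr a_cell (I.key x) < σ.reg r_arcs
  cell_surj : ∀ a, 2 * (I.k₁ + I.k₂) ≤ a → a < σ.reg r_arcs →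
    ∃ x : Fin I.nC, (x : ℕ) < j ∧ σ.arr a_cell (I.key x) = a
  cell_zero : ∀ y, (∀ x : Fin I.nC, (x : ℕ) < j → I.key x ≠ y) → σ.arr a_cell y = 0
  hd : ∀ x : Fin I.nC, (x : ℕ) < j →
    σ.arr a_hd (2 * σ.arr a_cell (I.key x)) = I.k₁ + I.ctrl₂ x ∧
      σ.arr a_hd (2 * σ.arr a_cell (I.key x) + 1) = I.ctrl₁ x
  rc : ∀ r, 4 * (I.k₁ + I.k₂) ≤ r → r < 2 * σ.reg r_arcs → σ.arr a_rc r = 1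

/-- The first `j` control samples are filed under the arcs of their level-intersections. -/
structure Filed (I : Instance) (j : ℕ) (σ : Store) : Prop where
  odd : ∀ a, 2 * (I.k₁ + I.k₂) ≤ a → σ.arr a_resid (2 * a + 1) = 0
  mem : ∀ a, 2 * (I.k₁ + I.k₂) ≤ a → ∀ k < σ.arr a_resid (2 * a), ∃ x : Fin I.nC, (x : ℕ) < j ∧
    σ.arr a_samp (a * σ.reg r_stride + k) = x ∧ σ.arr a_cell (I.key x) = a
  inj : ∀ a, 2 * (I.k₁ + I.k₂) ≤ a → ∀ k < σ.arr a_resid (2 * a), ∀ k' < σ.arr a_resid (2 * a),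
    σ.arr a_samp (a * σ.reg r_stride + k) = σ.arr a_samp (a * σ.reg r_stride + k') → k = k'
  all : ∀ x : Fin I.nC, (x : ℕ) < j → ∃ k < σ.arr a_resid (2 * σ.arr a_cell (I.key x)),
    σ.arr a_samp (σ.arr a_cell (I.key x) * σ.reg r_stride + k) = x
  resid_le : ∀ a, 2 * (I.k₁ + I.k₂) ≤ a → σ.arr a_resid (2 * a) ≤ j
  samp_le : ∀ i, σ.arr a_samp i ≤ I.nC

variable {I : Instance}

theorem key_inj {x y : Fin I.nC} (h : I.key x = I.key y) :
    I.ctrl₁ x = I.ctrl₁ y ∧ I.ctrl₂ x = I.ctrl₂ y := by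
  obtain ⟨h1, h2⟩ := pair_inj (I.ctrl₂ x).2 (I.ctrl₂ y).2 h
  exact ⟨Fin.ext h1, Fin.ext h2⟩

theorem key_lt (x : Fin I.nC) : I.key x < I.k₁ * I.k₂ := by
  have h1 : ((I.ctrl₁ x : ℕ) + 1) * I.k₂ ≤ I.k₁ * I.k₂ := Nat.mul_le_mul_right _ (I.ctrl₁ x).2
  have h2 : (I.ctrl₂ x : ℕ) < I.k₂ := (I.ctrl₂ x).2
  rw [Nat.succ_mul] at h1
  unfold key
  omega

theorem LevelArcs.of_eq {v : ℕ} {σ τ : Store} (h : I.LevelArcs v σ)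
    (hhd : ∀ r < 4 * v, τ.arr a_hd r = σ.arr a_hd r)
    (hrc : ∀ r < 4 * v, τ.arr a_rc r = σ.arr a_rc r)
    (hres : ∀ r < 4 * v, τ.arr a_resid r = σ.arr a_resid r) : I.LevelArcs v τ := by
  constructor <;> intro w hw
  · rw [hhd _ (by omega), hhd _ (by omega)]; exact h.hd_exc w hw
  · rw [hhd _ (by omega), hhd _ (by omega)]; exact h.hd_def w hw
  · rw [hrc _ (by omega), hrc _ (by omega)]; exact h.rc_exc w hw
  · rw [hrc _ (by omega), hrc _ (by omega)]; exact h.rc_def w hw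
  · rw [hres _ (by omega), hres _ (by omega)]; exact h.resid_exc w hw
  · rw [hres _ (by omega), hres _ (by omega)]; exact h.resid_def w hw

/-- A sample whose level-intersection already has an arc. -/
theorem CellArcs.succ {j : ℕ} {σ : Store} (h : I.CellArcs j σ) {x : Fin I.nC} (hx : (x : ℕ) = j)
    (hc : σ.arr a_cell (I.key x) ≠ 0) : I.CellArcs (j + 1) σ := by
  obtain ⟨y, hy, e⟩ : ∃ y : Fin I.nC, (y : ℕ) < j ∧ I.key y = I.key x := by
    by_contra! hne
    exact hc (h.cell_zero _ hne)
  have hcase : ∀ z : Fin I.nC, (z : ℕ) < j + 1 → ∃ y : Fin I.nC, (y : ℕ) < j ∧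
      I.key y = I.key z := by
    intro z hz
    rcases Nat.lt_succ_iff_lt_or_eq.1 hz with hz | hz
    · exact ⟨z, hz, rfl⟩
    · have : z = x := Fin.ext (by omega)
      exact this ▸ ⟨y, hy, e⟩
  refine { h with
    arcs_le := by have := h.arcs_le; omega
    cell_ge := fun z hz => ?_, cell_lt := fun z hz => ?_, cell_surj := fun a h1 h2 => ?_
    cell_zero := fun y hy => h.cell_zero y fun x hx => hy x (by omega), hd := fun z hz => ?_ }
  · obtain ⟨y, hy, e⟩ := hcase z hz
    rw [← e]; exact h.cell_ge y hy
  · obtain ⟨y, hy, e⟩ := hcase z hz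
    rw [← e]; exact h.cell_lt y hy
  · obtain ⟨x, hx, e⟩ := h.cell_surj a h1 h2
    exact ⟨x, by omega, e⟩
  · obtain ⟨y, hy, e⟩ := hcase z hz
    rw [← e, ← (key_inj e).1, ← (key_inj e).2]; exact h.hd y hy

end Instance

namespace Code

open Instance

/-- The entry `0` can mean "no arc yet" because arc numbers of cells start at `2 * (k₁ + k₂) > 0`.
-/
theorem cellArc_does {I : Instance} {W j : ℕ} (hW : I.WordOK W) (hreg : I.Regular)
    {σ : Store} (hS : I.Sizes σ) (hA : I.CellArcs j σ) {x : Fin I.nC} (hx : (x : ℕ) = j)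
    (hv : σ.reg r_v = j) (hh : σ.reg r_h = I.key x) (hc : σ.reg r_c = 0)
    (h₁ : σ.arr a_ctrl₁ j = I.ctrl₁ x) (h₂ : σ.arr a_ctrl₂ j = I.ctrl₂ x) :
    Does W (.ite (.load a_cell (.reg r_h) =ᵉ .lit 0)
      (.store a_cell (.reg r_h) (.reg r_arcs) ;;
        r_s ←ᵉ .load a_ctrl₁ (.reg r_v) ;; r_t ←ᵉ .reg r_k₁ +ᵉ .load a_ctrl₂ (.reg r_v) ;;
        addArc)
      .skip) σ 100 fun τ => I.CellArcs (j + 1) τ ∧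
        (∀ y : Fin I.nC, (y : ℕ) < j → τ.arr a_cell (I.key y) = σ.arr a_cell (I.key y)) ∧
        (∀ r < 4 * (I.k₁ + I.k₂), τ.arr a_hd r = σ.arr a_hd r) ∧
        ∀ r < 4 * (I.k₁ + I.k₂), τ.arr a_rc r = σ.arr a_rc r := by
  have hlin := hW.linear hreg
  have hsize := hreg.size_ge
  have hk := hreg.k₁_pos
  have hkey : I.key x ≤ W := by
    have h1 := hW.mul (a := I.k₁) (b := I.k₂) (by omega) (by omega)
    have h2 := I.key_lt x
    generalize I.k₁ * I.k₂ = P at *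
    omega
  have harcs := hA.arcs_le
  have l1 : (I.ctrl₁ x : ℕ) < I.k₁ := (I.ctrl₁ x).2
  have l2 : (I.ctrl₂ x : ℕ) < I.k₂ := (I.ctrl₂ x).2
  have hcW : σ.arr a_cell (I.key x) ≤ W := by
    by_cases hne : ∃ y : Fin I.nC, (y : ℕ) < j ∧ I.key y = I.key x
    · obtain ⟨y, hy, e⟩ := hne
      have := hA.cell_lt y hy
      rw [← e]; omega
    · rw [hA.cell_zero _ fun y hy e => hne ⟨y, hy, e⟩]; omega
  refine (Does.ite (n := 90) ?_ (fun hz => ?_) (fun hz => ?_)).mono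
    (by simp only [Expr.time]; omega) fun _ _ h => h
  · simp only [Expr.Fits, Expr.eval, Op.eval_eq, hh]
    exact ⟨⟨hkey, hcW⟩, by omega, ite_one_zero_le (by omega) _⟩
  · have hz : σ.arr a_cell (I.key x) = 0 := by
      by_contra hne
      simp [Expr.eval, hh, hne] at hz
    -- An earlier sample of the same cell would have left a positive entry.
    have hnew : ∀ y : Fin I.nC, (y : ℕ) < j → I.key y ≠ I.key x := fun y hy e => by
      have := hA.cell_ge y hy
      rw [e] at this
      omega
    have hB : Does W (.store a_cell (.reg r_h) (.reg r_arcs)) σ 5 fun τ =>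
        τ.arr a_cell = Function.update (σ.arr a_cell) (I.key x) (σ.reg r_arcs) := by
      refine Does.of_wp ?_ (by decide)
      simp [Prog.wp, Expr.Fits, Expr.eval, hh]
      omega
    refine (hB.seq (m := 85) ?_).mono le_rfl fun _ _ h => h
    rintro σ₁ F₁ c1
    have hC : Does W (r_s ←ᵉ .load a_ctrl₁ (.reg r_v)) σ₁ 5 fun τ =>
        τ.reg r_s = I.ctrl₁ x := by
      refine Does.of_wp ?_ (by decide)
      simp [Prog.wp, Expr.Fits, Expr.eval, F₁.1 r_v (by decide), hv, F₁.2 a_ctrl₁ (by decide), h₁]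
      omega
    refine (hC.seq (m := 80) ?_).mono le_rfl fun _ _ h => h
    rintro σ₂ F₂ s2
    have S2 := (hS.frame F₁ (by decide)).frame F₂ (by decide)
    have hD : Does W (r_t ←ᵉ .reg r_k₁ +ᵉ .load a_ctrl₂ (.reg r_v)) σ₂ 10 fun τ =>
        τ.reg r_t = I.k₁ + I.ctrl₂ x := by
      refine Does.of_wp ?_ (by decide)
      simp [Prog.wp, Expr.Fits, Expr.eval, S2.k₁, F₂.1 r_v (by decide), F₁.1 r_v (by decide), hv,
        F₂.2 a_ctrl₂ (by decide), F₁.2 a_ctrl₂ (by decide), h₂]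
      omega
    refine (hD.seq (m := 70) ?_).mono le_rfl fun _ _ h => h
    rintro σ₃ F₃ t3
    have S3 := S2.frame F₃ (by decide)
    have s3 : σ₃.reg r_s = I.ctrl₁ x := (F₃.1 _ (by decide)).trans s2
    have c3 : σ₃.reg r_c = 0 := by
      rw [F₃.1 _ (by decide), F₂.1 _ (by decide), F₁.1 _ (by decide), hc]
    have a3 : σ₃.reg r_arcs = σ.reg r_arcs := by
      rw [F₃.1 _ (by decide), F₂.1 _ (by decide), F₁.1 _ (by decide)]
    have g3 := F₃.graph (F₂.graph (F₁.graph hA.graph (by decide) (by decide)) (by decide)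
      (by decide)) (by decide) (by decide)
    have hj : j < I.nC := hx ▸ x.2
    refine (addArc_does (W := W) g3 (by rw [s3, S3.nodes]; omega)
      (by rw [t3, S3.nodes]; omega) (by rw [s3, t3]; omega) (by rw [c3]; omega)
      (by rw [a3, S3.stride]; omega) (S3.table_le hW hreg)).mono le_rfl ?_
    rintro τ F₄ A
    rw [s3, t3, c3] at A
    have ea := A.arcs
    have ehf := A.hd_fwd
    have ehb := A.hd_bwd
    have erf := A.rc_fwd
    have erb := A.rc_bwd
    rw [a3] at ea ehf ehb erf erb
    have ehd : ∀ r < 2 * σ.reg r_arcs, τ.arr a_hd r = σ.arr a_hd r := fun r hr => by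
      rw [A.hd_old r (by omega), F₃.2 a_hd (by decide), F₂.2 a_hd (by decide),
        F₁.2 a_hd (by decide)]
    have erc : ∀ r < 2 * σ.reg r_arcs, τ.arr a_rc r = σ.arr a_rc r := fun r hr => by
      rw [A.rc_old r (by omega), F₃.2 a_rc (by decide), F₂.2 a_rc (by decide),
        F₁.2 a_rc (by decide)]
    have ecell : τ.arr a_cell =
        Function.update (σ.arr a_cell) (I.key x) (σ.reg r_arcs) := by
      rw [F₄.2 a_cell (by decide), F₃.2 a_cell (by decide), F₂.2 a_cell (by decide), c1]
    have eold : ∀ y : Fin I.nC, (y : ℕ) < j →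
        τ.arr a_cell (I.key y) = σ.arr a_cell (I.key y) := fun y hy => by
      rw [ecell, Function.update_of_ne (hnew y hy)]
    have enew : τ.arr a_cell (I.key x) = σ.reg r_arcs := by rw [ecell, Function.update_self]
    have hge := hA.arcs_ge
    have hcase : ∀ y : Fin I.nC, (y : ℕ) < j + 1 → (y : ℕ) < j ∨ y = x := fun y hy => by
      rcases Nat.lt_succ_iff_lt_or_eq.1 hy with hy | hy
      · exact .inl hy
      · exact .inr (Fin.ext (by omega))
    refine ⟨⟨A.graph, by omega, by omega, ?_, ?_, ?_, ?_, ?_, ?_⟩, eold,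
      fun r hr => ehd r (by omega), fun r hr => erc r (by omega)⟩
    · intro y hy
      rcases hcase y hy with hy | rfl
      · rw [eold y hy]; exact hA.cell_ge y hy
      · rw [enew]; exact hge
    · intro y hy
      rcases hcase y hy with hy | rfl
      · rw [eold y hy, ea]; exact (hA.cell_lt y hy).trans (by omega)
      · rw [enew, ea]; omega
    · intro a h1 h2
      by_cases e : a = σ.reg r_arcs
      · exact ⟨x, by omega, by rw [enew, e]⟩
      · obtain ⟨y, hy, e'⟩ := hA.cell_surj a h1 (by omega)
        exact ⟨y, by omega, by rw [eold y hy, e']⟩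
    · intro y hy
      rw [ecell, Function.update_of_ne (fun e => hy x (by omega) e.symm)]
      exact hA.cell_zero y fun z hz => hy z (by omega)
    · intro y hy
      rcases hcase y hy with hy | rfl
      · have := hA.cell_lt y hy
        rw [eold y hy, ehd _ (by omega), ehd _ (by omega)]
        exact hA.hd y hy
      · rw [enew, ehf, ehb]; exact ⟨rfl, rfl⟩
    · intro r h1 h2
      by_cases e : r < 2 * σ.reg r_arcs
      · rw [erc r e]; exact hA.rc r h1 e
      · by_cases e' : r = 2 * σ.reg r_arcs
        · rw [e', erf]
        · rw [show r = 2 * σ.reg r_arcs + 1 by omega, erb]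
  · have hz : σ.arr a_cell (I.key x) ≠ 0 := fun e => by
      simp [Expr.eval, hh, e] at hz
    refine Does.of_wp ?_ (by decide)
    exact ⟨hA.succ hx hz, fun _ _ => rfl, fun _ _ => rfl, fun _ _ => rfl⟩

/-- Filing a sample under the arc of its level-intersection. -/
theorem filed_succ {I : Instance} {j : ℕ} {σ τ : Store} (h : I.Filed j σ) {x : Fin I.nC}
    (hx : (x : ℕ) = j) (hcell : τ.arr a_cell = σ.arr a_cell)
    (hB : τ.reg r_stride = σ.reg r_stride) (hjB : j < σ.reg r_stride)
    (hge' : ∀ y : Fin I.nC, (y : ℕ) < j + 1 → 2 * (I.k₁ + I.k₂) ≤ σ.arr a_cell (I.key y))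
    (hsamp : τ.arr a_samp = Function.update (σ.arr a_samp) (σ.arr a_cell (I.key x) *
      σ.reg r_stride + σ.arr a_resid (2 * σ.arr a_cell (I.key x))) j)
    (hres : τ.arr a_resid = Function.update (σ.arr a_resid) (2 * σ.arr a_cell (I.key x))
      (σ.arr a_resid (2 * σ.arr a_cell (I.key x)) + 1)) : I.Filed (j + 1) τ := by
  have hge := hge' x (by omega)
  set b := σ.arr a_cell (I.key x) with hb
  have hself : τ.arr a_resid (2 * b) = σ.arr a_resid (2 * b) + 1 := by
    rw [hres, Function.update_self]
  have hother : ∀ r, r ≠ 2 * b → τ.arr a_resid r = σ.arr a_resid r := fun r hr => by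
    rw [hres, Function.update_of_ne hr]
  have hmono : ∀ r, σ.arr a_resid r ≤ τ.arr a_resid r := fun r => by
    by_cases e : r = 2 * b
    · rw [e, hself]; omega
    · rw [hother r e]
  have hnew : τ.arr a_samp (b * σ.reg r_stride + σ.arr a_resid (2 * b)) = j := by
    rw [hsamp, Function.update_self]
  -- A cell holds at most `j` samples, fewer than the stride, so the new entry does not collide with
  -- those of other cells; in its own cell it comes right after the old ones.
  have hold : ∀ a, 2 * (I.k₁ + I.k₂) ≤ a → ∀ k < σ.arr a_resid (2 * a),
      τ.arr a_samp (a * σ.reg r_stride + k) = σ.arr a_samp (a * σ.reg r_stride + k) := by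
    intro a ha k hk
    have h1 := h.resid_le a ha
    have h2 := h.resid_le b hge
    rw [hsamp, Function.update_of_ne]
    intro e
    obtain ⟨rfl, rfl⟩ := pair_inj (by omega) (by omega) e
    omega
  have hcase : ∀ a, ∀ k < τ.arr a_resid (2 * a), k < σ.arr a_resid (2 * a) ∨
      (a = b ∧ k = σ.arr a_resid (2 * b)) := by
    intro a k hk
    by_cases e : a = b
    · subst e
      rw [hself] at hk
      by_cases h1 : k < σ.arr a_resid (2 * b)
      · exact .inl h1
      · exact .inr ⟨rfl, by omega⟩
    · rw [hother _ (by omega)] at hk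
      exact .inl hk
  -- Samples filed earlier have numbers below `j`, so filing `j` creates no repetition.
  have hlt : ∀ a, 2 * (I.k₁ + I.k₂) ≤ a → ∀ k < σ.arr a_resid (2 * a),
      σ.arr a_samp (a * σ.reg r_stride + k) ≠ j := fun a ha k hk e => by
    obtain ⟨y, hy, e', -⟩ := h.mem a ha k hk
    omega
  refine ⟨fun a ha => ?_, fun a ha k hk => ?_, fun a ha k hk k' hk' e => ?_, fun y hy => ?_,
    fun a ha => ?_, fun i => ?_⟩
  · rw [hother _ (by omega)]; exact h.odd a ha
  · rw [hB, hcell]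
    rcases hcase a k hk with hk | ⟨rfl, rfl⟩
    · obtain ⟨y, hy, e1, e2⟩ := h.mem a ha k hk
      exact ⟨y, by omega, by rw [hold a ha k hk, e1], e2⟩
    · exact ⟨x, by omega, by rw [hnew, hx], hb.symm⟩
  · rw [hB] at e
    rcases hcase a k hk with h1 | ⟨h3, rfl⟩ <;> rcases hcase a k' hk' with h2 | ⟨h3', rfl⟩
    · rw [hold a ha k h1, hold a ha k' h2] at e
      exact h.inj a ha k h1 k' h2 e
    · rw [hold a ha k h1, h3', hnew] at e
      exact absurd (h3' ▸ e) (hlt a ha k h1)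
    · rw [hold a ha k' h2, h3, hnew] at e
      exact absurd (h3 ▸ e.symm) (hlt a ha k' h2)
    · rfl
  · rw [hcell, hB]
    by_cases e : (y : ℕ) < j
    · obtain ⟨k, hk, e⟩ := h.all y e
      exact ⟨k, hk.trans_le (hmono _), by rw [hold _ (hge' y hy) k hk, e]⟩
    · have : y = x := Fin.ext (by omega)
      subst this
      rw [← hb]
      exact ⟨_, by rw [hself]; exact Nat.lt_succ_self _, by rw [hnew, hx]⟩
  · by_cases e : a = b
    · subst e; rw [hself]; have := h.resid_le b ha; omega
    · rw [hother _ (by omega)]; have := h.resid_le a ha; omega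
  · rw [hsamp, Function.update_apply]
    split_ifs
    · have := x.2; omega
    · exact h.samp_le i

/-- The control samples before `j` are dealt with. -/
structure CellInv (I : Instance) (j : ℕ) (σ : Store) : Prop where
  arcs : I.CellArcs j σ
  filed : I.Filed j σ
  levels : I.LevelArcs (I.k₁ + I.k₂) σ

theorem cellBody_does {I : Instance} {W j : ℕ} (hW : I.WordOK W) (hreg : I.Regular)
    {σ : Store} (hS : I.Sizes σ) (h : CellInv I j σ) {x : Fin I.nC} (hx : (x : ℕ) = j)
    (hv : σ.reg r_v = j) (hc : σ.reg r_c = 0)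
    (h₁ : σ.arr a_ctrl₁ j = I.ctrl₁ x) (h₂ : σ.arr a_ctrl₂ j = I.ctrl₂ x) :
    Does W cellBody σ 160 fun τ => CellInv I (j + 1) τ ∧ τ.reg r_v = j + 1 := by
  have hlin := hW.linear hreg
  have hsize := hreg.size_ge
  have hj : j < I.nC := hx ▸ x.2
  have l1 : (I.ctrl₁ x : ℕ) < I.k₁ := (I.ctrl₁ x).2
  have l2 : (I.ctrl₂ x : ℕ) < I.k₂ := (I.ctrl₂ x).2
  have hA : Does W (r_h ←ᵉ .load a_ctrl₁ (.reg r_v) *ᵉ .reg r_k₂ +ᵉ .load a_ctrl₂ (.reg r_v)) σ 10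
      fun τ => τ.reg r_h = I.key x := by
    refine Does.of_wp ?_ (by decide)
    have h3 := hW.mul (a := I.ctrl₁ x) (b := I.k₂) (by omega) (by omega)
    simp [Prog.wp, Expr.Fits, Expr.eval, hv, h₁, h₂, hS.k₂, key]
    generalize (I.ctrl₁ x : ℕ) * I.k₂ = P at *
    omega
  refine (hA.seq (m := 150) ?_).mono le_rfl fun _ _ h => h
  rintro σ₁ F₁ k1
  have S1 := hS.frame F₁ (by decide)
  have v1 : σ₁.reg r_v = j := (F₁.1 _ (by decide)).trans hv
  have A1 : I.CellArcs j σ₁ := by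
    have e1 := F₁.1 r_arcs (by decide)
    have e2 := F₁.2 a_cell (by decide)
    have e3 := F₁.2 a_hd (by decide)
    have e4 := F₁.2 a_rc (by decide)
    obtain ⟨i1, i2, i3, i4, i5, i6, i7, i8, i9⟩ := h.arcs
    refine ⟨F₁.graph i1 (by decide) (by decide), ?_, ?_, ?_, ?_, ?_, ?_, ?_, ?_⟩ <;>
      simp only [e1, e2, e3, e4] <;> assumption
  refine ((cellArc_does hW hreg S1 A1 hx v1 k1 ((F₁.1 _ (by decide)).trans hc)
    (by rw [F₁.2 a_ctrl₁ (by decide), h₁]) (by rw [F₁.2 a_ctrl₂ (by decide), h₂])).seq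
      (m := 50) ?_).mono le_rfl fun _ _ h => h
  rintro σ₂ F₂ ⟨A2, c2, hd2, rc2⟩
  have S2 := S1.frame F₂ (by decide)
  have v2 : σ₂.reg r_v = j := (F₂.1 _ (by decide)).trans v1
  have k2 : σ₂.reg r_h = I.key x := (F₂.1 _ (by decide)).trans k1
  have e1 : σ₂.arr a_resid = σ.arr a_resid :=
    (F₂.2 _ (by decide)).trans (F₁.2 _ (by decide))
  have e2 : σ₂.arr a_samp = σ.arr a_samp :=
    (F₂.2 _ (by decide)).trans (F₁.2 _ (by decide))
  have e3 : σ₂.reg r_stride = σ.reg r_stride := by rw [S2.stride, hS.stride]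
  have c2' : ∀ y : Fin I.nC, (y : ℕ) < j → σ₂.arr a_cell (I.key y) = σ.arr a_cell (I.key y) :=
    fun y hy => by rw [c2 y hy, F₁.2 a_cell (by decide)]
  have f2 : I.Filed j σ₂ := by
    refine ⟨?_, ?_, ?_, ?_, ?_, ?_⟩
    · rw [e1]; exact h.filed.odd
    · rw [e1, e2, e3]
      intro a ha k hk
      obtain ⟨y, hy, h1, h2⟩ := h.filed.mem a ha k hk
      exact ⟨y, hy, h1, by rw [c2' y hy, h2]⟩
    · rw [e1, e2, e3]; exact h.filed.inj
    · intro y hy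
      rw [e1, e2, e3, c2' y hy]; exact h.filed.all y hy
    · rw [e1]; exact h.filed.resid_le
    · rw [e2]; exact h.filed.samp_le
  have L2 : I.LevelArcs (I.k₁ + I.k₂) σ₂ := h.levels.of_eq
    (fun r hr => by rw [hd2 r hr, F₁.2 a_hd (by decide)])
    (fun r hr => by rw [rc2 r hr, F₁.2 a_rc (by decide)]) (fun r _ => by rw [e1])
  have hge := A2.cell_ge x (by omega)
  have hlt := A2.cell_lt x (by omega)
  have hle := A2.arcs_le
  have hr := f2.resid_le _ hge
  have hst := S2.stride
  have hmul := hW.mul (a := σ₂.arr a_cell (I.key x)) (b := σ₂.reg r_stride) (by omega)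
    (by omega)
  have hkey : I.key x ≤ W := by
    have h1 := hW.mul (a := I.k₁) (b := I.k₂) (by omega) (by omega)
    have h2 := I.key_lt x
    generalize I.k₁ * I.k₂ = P at *
    omega
  have hB : Does W (r_r ←ᵉ .load a_cell (.reg r_h) ;;
      .store a_samp (.reg r_r *ᵉ .reg r_stride +ᵉ .load a_resid (.lit 2 *ᵉ .reg r_r)) (.reg r_v) ;;
      .store a_resid (.lit 2 *ᵉ .reg r_r) (.load a_resid (.lit 2 *ᵉ .reg r_r) +ᵉ .lit 1) ;;
      r_v ←ᵉ .reg r_v +ᵉ .lit 1) σ₂ 50 fun τ => τ.reg r_v = j + 1 ∧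
      τ.arr a_samp = Function.update (σ₂.arr a_samp) (σ₂.arr a_cell (I.key x) *
        σ₂.reg r_stride + σ₂.arr a_resid (2 * σ₂.arr a_cell (I.key x))) j ∧
      τ.arr a_resid = Function.update (σ₂.arr a_resid) (2 * σ₂.arr a_cell (I.key x))
        (σ₂.arr a_resid (2 * σ₂.arr a_cell (I.key x)) + 1) := by
    refine Does.of_wp ?_ (by decide)
    simp [Prog.wp, Expr.Fits, Expr.eval, v2, k2]
    generalize σ₂.arr a_cell (I.key x) * σ₂.reg r_stride = P at *
    repeat' apply And.intro
    all_goals omega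
  refine hB.mono le_rfl ?_
  rintro τ F₃ ⟨v3, s3, r3⟩
  refine ⟨⟨?_, ?_, ?_⟩, v3⟩
  · have e1 := F₃.1 r_arcs (by decide)
    have e2 := F₃.2 a_cell (by decide)
    have e3 := F₃.2 a_hd (by decide)
    have e4 := F₃.2 a_rc (by decide)
    obtain ⟨i1, i2, i3, i4, i5, i6, i7, i8, i9⟩ := A2
    refine ⟨F₃.graph i1 (by decide) (by decide), ?_, ?_, ?_, ?_, ?_, ?_, ?_, ?_⟩ <;>
      simp only [e1, e2, e3, e4] <;> assumption
  · exact filed_succ f2 hx (F₃.2 _ (by decide)) (F₃.1 _ (by decide)) (by omega) A2.cell_ge s3 r3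
  · refine L2.of_eq (fun r _ => by rw [F₃.2 a_hd (by decide)])
      (fun r _ => by rw [F₃.2 a_rc (by decide)]) fun r hr => ?_
    rw [r3, Function.update_of_ne (by omega)]

theorem cellLoop_does {I : Instance} {W : ℕ} (hW : I.WordOK W) (hreg : I.Regular)
    {σ₀ : Store} (hS : I.Sizes σ₀) (h0 : CellInv I 0 σ₀) (hv : σ₀.reg r_v = 0)
    (hc : σ₀.reg r_c = 0) (h₁ : ∀ x : Fin I.nC, σ₀.arr a_ctrl₁ x = I.ctrl₁ x)
    (h₂ : ∀ x : Fin I.nC, σ₀.arr a_ctrl₂ x = I.ctrl₂ x) :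
    Does W cellLoop σ₀ (I.nC * 170 + 10) fun τ => CellInv I I.nC τ := by
  have hlin := hW.linear hreg
  have hsize := hreg.size_ge
  refine (Does.loop (b := 160) (n := I.nC) (fun n σ =>
    σ.reg r_v + n = I.nC ∧ CellInv I (σ.reg r_v) σ) ?_ ?_).mono
      (m := I.nC * 170 + 10) (by simp only [Expr.time]; omega) (fun _ _ h => h)
  · rw [hv]; exact ⟨by omega, h0⟩
  rintro n σ hF ⟨hn, h⟩
  have S := hS.frame hF (by decide)
  refine ⟨?_, fun hc' => ?_, fun hc' => ?_⟩
  · simp only [Expr.Fits, Op.eval_lt, Expr.eval, S.nC]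
    exact ⟨by omega, by omega, ite_one_zero_le (by omega) _⟩
  · have hlt : σ.reg r_v < I.nC := by
      simp [Expr.eval, S.nC] at hc'; omega
    refine ⟨n - 1, by omega, (cellBody_does hW hreg S h (x := ⟨_, hlt⟩) rfl rfl
      ((hF.1 _ (by decide)).trans hc) ?_ ?_).mono le_rfl ?_⟩
    · rw [hF.2 a_ctrl₁ (by decide)]; exact h₁ ⟨_, hlt⟩
    · rw [hF.2 a_ctrl₂ (by decide)]; exact h₂ ⟨_, hlt⟩
    · rintro τ - ⟨h1, h2⟩
      rw [← h2] at h1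
      exact ⟨by omega, h1⟩
  · have hge : σ.reg r_v = I.nC := by
      simp [Expr.eval, S.nC] at hc'; omega
    rw [hge] at h
    exact h

end Code

/-! ### The stored network after initialization -/

namespace Instance

variable {I : Instance}

theorem exists_key (c : {c : Fin I.k₁ × Fin I.k₂ // 0 < I.u c.1 c.2}) :
    ∃ x : Fin I.nC, I.ctrl₁ x = c.1.1 ∧ I.ctrl₂ x = c.1.2 ∧
      (c.1.1 : ℕ) * I.k₂ + c.1.2 = I.key x := by
  have hc := c.2
  rw [u, cellCount, Finset.card_pos] at hc
  obtain ⟨x, hx⟩ := hc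
  simp only [Finset.mem_filter, Finset.mem_univ, true_and] at hx
  exact ⟨x, hx.1, hx.2, by rw [key, hx.1, hx.2]⟩

theorem exists_cell (x : Fin I.nC) : ∃ c : {c : Fin I.k₁ × Fin I.k₂ // 0 < I.u c.1 c.2},
    I.ctrl₁ x = c.1.1 ∧ I.ctrl₂ x = c.1.2 ∧ (c.1.1 : ℕ) * I.k₂ + c.1.2 = I.key x :=
  ⟨⟨(I.ctrl₁ x, I.ctrl₂ x), by rw [u, cellCount, Finset.card_pos]; exact ⟨x, by simp⟩⟩,
    rfl, rfl, rfl⟩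

end Instance

namespace Code

open Instance

namespace CellInv

variable {I : Instance} {σ : Store}

/-- The two stored end nodes of the arc reveal the levels of the cell. -/
theorem cell_inj (h : CellInv I I.nC σ) {x y : Fin I.nC}
    (e : σ.arr a_cell (I.key x) = σ.arr a_cell (I.key y)) :
    I.ctrl₁ x = I.ctrl₁ y ∧ I.ctrl₂ x = I.ctrl₂ y := by
  obtain ⟨h1, h2⟩ := h.arcs.hd x x.2
  obtain ⟨h3, h4⟩ := h.arcs.hd y y.2
  rw [e] at h1 h2
  exact ⟨Fin.ext (by omega), Fin.ext (by omega)⟩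

/-- The forward capacity counted up during filing is the number of filed samples. Once all samples
are filed they are exactly the members of the cell, each filed once. -/
theorem resid_eq (h : CellInv I I.nC σ) (x : Fin I.nC) :
    σ.arr a_resid (2 * σ.arr a_cell (I.key x)) = I.u (I.ctrl₁ x) (I.ctrl₂ x) := by
  have hge := h.arcs.cell_ge x x.2
  set a := σ.arr a_cell (I.key x) with ha
  choose g hg using h.filed.mem a hge
  have : Finset.univ.image (fun k : Fin (σ.arr a_resid (2 * a)) => g k k.2) =
      Finset.univ.filter fun j => I.ctrl₁ j = I.ctrl₁ x ∧ I.ctrl₂ j = I.ctrl₂ x := by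
    ext y
    simp only [Finset.mem_image, Finset.mem_univ, true_and, Finset.mem_filter]
    constructor
    · rintro ⟨k, rfl⟩
      exact h.cell_inj ((hg k k.2).2.2.trans ha)
    · rintro ⟨h1, h2⟩
      have hk : I.key y = I.key x := by rw [key, key, h1, h2]
      obtain ⟨k, hk', e⟩ := h.filed.all y y.2
      rw [hk, ← ha] at hk' e
      refine ⟨⟨k, hk'⟩, Fin.ext ?_⟩
      rw [← e]; exact (hg k hk').2.1.symm
  rw [u, cellCount, ← this, Finset.card_image_of_injective, Finset.card_univ, Fintype.card_fin]
  intro k k' e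
  apply Fin.ext
  apply h.filed.inj a hge k k.2 k' k'.2
  rw [(hg k k.2).2.1, (hg k' k'.2).2.1]
  exact congrArg Fin.val e

/-- Level arcs and cell arcs occupy disjoint ranges of numbers and together exhaust all of them. For
the second covariate, the arc from the hub is the deficit and the arc to the hub the excess, the
reverse of the first covariate. -/
theorem layout (h : CellInv I I.nC σ) (hS : I.Sizes σ) : I.Layout σ := by
  have hge := h.arcs.arcs_ge
  have hcross : ∀ c, 2 * (I.k₁ + I.k₂) ≤ I.code (σ.arr a_cell) (.cross c) := by
    intro c
    obtain ⟨x, -, -, e⟩ := exists_key c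
    simp only [code, e]
    exact h.arcs.cell_ge x x.2
  have hub₁ : ∀ i : Fin I.k₁, I.hubOf i = I.k₁ + I.k₂ := fun i => by
    rw [hubOf, if_pos i.2]; omega
  have hub₂ : ∀ i : Fin I.k₂, I.hubOf (I.k₁ + i) = I.k₁ + I.k₂ + 1 := fun i => by
    rw [hubOf, if_neg (by omega)]
  refine ⟨hS.nT, hS.nC, hS.k₁, hS.k₂, hS.stride, hS.nodes, h.arcs.graph, ?_, ?_, ?_, hcross, ?_, ?_,
    ?_, ?_, h.filed.samp_le, ?_, ?_⟩
  · intro α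
    cases α with
    | cross c =>
      obtain ⟨x, -, -, e⟩ := exists_key c
      simp only [code, e]
      exact h.arcs.cell_lt x x.2
    | _ i => simp only [code]; omega
  · intro α β e
    cases α with
    | cross c =>
      have h1 := hcross c
      cases β with
      | cross c' =>
        obtain ⟨x, h1, h2, ex⟩ := exists_key c
        obtain ⟨y, h3, h4, ey⟩ := exists_key c'
        simp only [code, ex, ey] at e
        obtain ⟨h5, h6⟩ := h.cell_inj e
        rw [show c = c' from Subtype.ext (Prod.ext (by rw [← h1, ← h3, h5])
          (by rw [← h2, ← h4, h6]))]
      | _ i => rw [e] at h1; simp only [code] at h1; omega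
    | _ i =>
      cases β with
      | cross c => have h1 := hcross c; rw [← e] at h1; simp only [code] at h1; omega
      | _ i' =>
        simp only [code] at e
        first
        | (congr 1; apply Fin.ext; omega)
        | omega
  · intro a ha
    by_cases h1 : a < 2 * (I.k₁ + I.k₂)
    · rcases Nat.even_or_odd' a with ⟨w, rfl | rfl⟩
      · by_cases h2 : w < I.k₁
        · exact ⟨.exc₁ ⟨w, h2⟩, rfl⟩
        · exact ⟨.def₂ ⟨w - I.k₁, by omega⟩, by simp only [code]; omega⟩
      · by_cases h2 : w < I.k₁
        · exact ⟨.def₁ ⟨w, h2⟩, rfl⟩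
        · exact ⟨.exc₂ ⟨w - I.k₁, by omega⟩, by simp only [code]; omega⟩
    · obtain ⟨x, -, hx⟩ := h.arcs.cell_surj a (by omega) ha
      obtain ⟨c, -, -, e⟩ := exists_cell x
      exact ⟨.cross c, by simp only [code, e, hx]⟩
  · intro α
    cases α with
    | cross c =>
      obtain ⟨x, -, h2, e⟩ := exists_key c
      simp only [code, e, network, num, (h.arcs.hd x x.2).1, h2]
    | exc₁ i =>
      have := (h.levels.hd_exc i (by omega)).1
      simp only [code, network, num]; refine Eq.trans ?_ this; congr 1; ring
    | def₁ i =>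
      have := (h.levels.hd_def i (by omega)).1
      rw [hub₁] at this
      simp only [code, network, num]; refine Eq.trans ?_ this; congr 1; ring
    | exc₂ i =>
      have := (h.levels.hd_def (I.k₁ + i) (by omega)).1
      rw [hub₂] at this
      simp only [code, network, num]; refine Eq.trans ?_ this; congr 1; ring
    | def₂ i =>
      have := (h.levels.hd_exc (I.k₁ + i) (by omega)).1
      simp only [code, network, num]; refine Eq.trans ?_ this; congr 1; ring
  · intro α
    cases α with
    | cross c =>
      obtain ⟨x, h1, -, e⟩ := exists_key c
      simp only [code, e, network, num, (h.arcs.hd x x.2).2, h1]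
    | exc₁ i =>
      have := (h.levels.hd_exc i (by omega)).2
      rw [hub₁] at this
      simp only [code, network, num]; refine Eq.trans ?_ this; congr 1; ring
    | def₁ i =>
      have := (h.levels.hd_def i (by omega)).2
      simp only [code, network, num]; refine Eq.trans ?_ this; congr 1; ring
    | exc₂ i =>
      have := (h.levels.hd_def (I.k₁ + i) (by omega)).2
      simp only [code, network, num]; refine Eq.trans ?_ this; congr 1; ring
    | def₂ i =>
      have := (h.levels.hd_exc (I.k₁ + i) (by omega)).2
      rw [hub₂] at this
      simp only [code, network, num]; refine Eq.trans ?_ this; congr 1; ring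
  · intro α
    cases α with
    | cross c =>
      obtain ⟨x, -, -, e⟩ := exists_key c
      have h1 := h.arcs.cell_ge x x.2
      have h2 := h.arcs.cell_lt x x.2
      simp only [code, e, network, h.arcs.rc _ (show 4 * (I.k₁ + I.k₂) ≤ _ by omega)
        (show 2 * σ.arr a_cell (I.key x) < _ by omega)]
      rfl
    | exc₁ i =>
      have := (h.levels.rc_exc i (by omega)).1
      simp only [code, network, show 2 * (2 * (i : ℕ)) = 4 * i by ring, this]; rfl
    | def₁ i =>
      have := (h.levels.rc_def i (by omega)).1
      simp only [code, network, show 2 * (2 * (i : ℕ) + 1) = 4 * i + 2 by ring, this]; rfl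
    | exc₂ i =>
      have := (h.levels.rc_def (I.k₁ + i) (by omega)).1
      simp only [code, network,
        show 2 * (2 * (I.k₁ + (i : ℕ)) + 1) = 4 * (I.k₁ + i) + 2 by ring, this]; rfl
    | def₂ i =>
      have := (h.levels.rc_exc (I.k₁ + i) (by omega)).1
      simp only [code, network,
        show 2 * (2 * (I.k₁ + (i : ℕ))) = 4 * (I.k₁ + i) by ring, this]; rfl
  · intro α
    cases α with
    | cross c =>
      obtain ⟨x, -, -, e⟩ := exists_key c
      have h1 := h.arcs.cell_ge x x.2
      have h2 := h.arcs.cell_lt x x.2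
      simp only [code, e, network, h.arcs.rc _ (show 4 * (I.k₁ + I.k₂) ≤ _ by omega)
        (show 2 * σ.arr a_cell (I.key x) + 1 < _ by omega)]
      rfl
    | exc₁ i =>
      have := (h.levels.rc_exc i (by omega)).2
      simp only [code, network, show 2 * (2 * (i : ℕ)) = 4 * i by ring, this]; rfl
    | def₁ i =>
      have := (h.levels.rc_def i (by omega)).2
      simp only [code, network, show 2 * (2 * (i : ℕ) + 1) + 1 = 4 * i + 3 by ring, this]; rfl
    | exc₂ i =>
      have := (h.levels.rc_def (I.k₁ + i) (by omega)).2
      simp only [code, network,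
        show 2 * (2 * (I.k₁ + (i : ℕ)) + 1) + 1 = 4 * (I.k₁ + i) + 3 by ring, this]; rfl
    | def₂ i =>
      have := (h.levels.rc_exc (I.k₁ + i) (by omega)).2
      simp only [code, network,
        show 2 * (2 * (I.k₁ + (i : ℕ))) = 4 * (I.k₁ + i) by ring, this]; rfl
  · intro c k hk
    obtain ⟨x, h1, h2, e⟩ := exists_key c
    simp only [code, e]
    rw [← h1, ← h2, ← h.resid_eq x] at hk
    obtain ⟨y, -, h3, h4⟩ := h.filed.mem _ (h.arcs.cell_ge x x.2) k hk
    obtain ⟨h5, h6⟩ := h.cell_inj h4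
    exact ⟨y, h3, by rw [h5, h1], by rw [h6, h2]⟩
  · intro c k hk k' hk' e'
    obtain ⟨x, h1, h2, e⟩ := exists_key c
    simp only [code, e] at e'
    rw [← h1, ← h2, ← h.resid_eq x] at hk hk'
    exact h.filed.inj _ (h.arcs.cell_ge x x.2) k hk k' hk' e'

/-- For the zero flow the forward capacity of a cell is its full size, so no position reaches the
threshold, in agreement with the empty selection. -/
theorem keeps (h : CellInv I I.nC σ) (hsel : ∀ i, σ.arr a_sel i = 0) :
    I.Keeps σ fun _ => 0 := by
  have hge := h.arcs.arcs_ge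
  refine ⟨?_, ?_, ?_, ?_⟩
  · intro α
    cases α with
    | cross c =>
      obtain ⟨x, -, -, e⟩ := exists_key c
      simp only [code, e]
      exact h.filed.odd _ (h.arcs.cell_ge x x.2)
    | exc₁ i =>
      rw [← (h.levels.resid_exc i (by omega)).2]; simp only [code]; congr 1; ring
    | def₁ i =>
      rw [← (h.levels.resid_def i (by omega)).2]; simp only [code]; congr 1; ring
    | exc₂ i =>
      rw [← (h.levels.resid_def (I.k₁ + i) (by omega)).2]; simp only [code]; congr 1; ring
    | def₂ i =>
      rw [← (h.levels.resid_exc (I.k₁ + i) (by omega)).2]; simp only [code]; congr 1; ring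
  · intro α
    cases α with
    | cross c =>
      obtain ⟨x, h1, h2, e⟩ := exists_key c
      simp only [code, e, capN, h.resid_eq x, h1, h2, add_zero]
    | exc₁ i =>
      simp only [capN]
      rw [← (h.levels.resid_exc i (by omega)).1]; simp only [code, add_zero]; congr 1; ring
    | def₁ i =>
      simp only [capN]
      rw [← (h.levels.resid_def i (by omega)).1]; simp only [code, add_zero]; congr 1; ring
    | exc₂ i =>
      simp only [capN]
      rw [← (h.levels.resid_def (I.k₁ + i) (by omega)).1]
      simp only [code, add_zero]; congr 1; ring
    | def₂ i =>
      simp only [capN]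
      rw [← (h.levels.resid_exc (I.k₁ + i) (by omega)).1]
      simp only [code, add_zero]; congr 1; ring
  · intro r hr
    rcases Nat.even_or_odd' r with ⟨a, rfl | rfl⟩
    · by_contra hne
      -- A positive capacity beyond the arcs would come from a filed sample, but its cell has a
      -- genuine arc number.
      obtain ⟨x, hx, -, e⟩ := h.filed.mem a (by omega) 0 (by omega)
      have := h.arcs.cell_lt x hx
      omega
    · exact h.filed.odd a (by omega)
  · intro c k hk
    obtain ⟨x, h1, h2, e⟩ := exists_key c
    simp only [code, e, hsel, h.resid_eq x, h1, h2]
    rw [if_neg (by omega)]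

/-- Zero labels are valid for the zero flow: the only residual arcs of negative cost are the
backward level arcs, and these have no capacity yet. -/
theorem labels (h : CellInv I I.nC σ) (hpi : ∀ v, σ.arr a_pi v = 0) :
    σ.searchData.Labels (σ.arr a_pi) 0 := by
  refine ⟨fun r hr hpos => ?_, fun v _ => hpi v, fun v _ => hpi v, fun v _ => (hpi v).le⟩
  simp only [hpi, zero_add]
  change 0 < σ.arr a_resid r at hpos
  change 1 ≤ σ.arr a_rc r
  by_cases h1 : 4 * (I.k₁ + I.k₂) ≤ r
  · rw [h.arcs.rc r h1 hr]
  · obtain ⟨w, hw⟩ : ∃ w, r = 4 * w ∨ r = 4 * w + 1 ∨ r = 4 * w + 2 ∨ r = 4 * w + 3 :=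
      ⟨r / 4, by omega⟩
    have hlt : w < I.k₁ + I.k₂ := by omega
    have r1 := h.levels.resid_exc w hlt
    have r2 := h.levels.resid_def w hlt
    have c1 := h.levels.rc_exc w hlt
    have c2 := h.levels.rc_def w hlt
    rcases hw with rfl | rfl | rfl | rfl <;> omega

end CellInv

/-- The remaining supplies equal the level sizes because nothing has been sent; flow, labels and
marks are the zeros of the input store that initialization leaves alone. -/
theorem init_does {I : Instance} {W : ℕ} (hW : I.WordOK W) (hreg : I.Regular) :
    Does W init I.input (210 * (I.nT + I.nC + I.k₁ + I.k₂) + 100) fun τ =>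
      I.Inv 0 τ ∧ ∀ b, I.storedFlow τ b = 0 := by
  have hlin := hW.linear hreg
  have hsize := hreg.size_ge
  have i0 : I.input.reg r_nT = I.nT := rfl
  have i1 : I.input.reg r_nC = I.nC := rfl
  have i2 : I.input.reg r_k₁ = I.k₁ := rfl
  have i3 : I.input.reg r_k₂ = I.k₂ := rfl
  have hA : Does W (setup ;; r_v ←ᵉ .lit 0) I.input 40 fun τ => I.Sizes τ ∧
      τ.reg r_left = I.nT ∧ τ.reg r_v = 0 := by
    have main : Does W (setup ;; r_v ←ᵉ .lit 0) I.input 40 fun τ =>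
        τ.reg r_stride = 4 * (I.k₁ + I.k₂) + 2 * I.nC ∧ τ.reg r_nodes = I.k₁ + I.k₂ + 2 ∧
        τ.reg r_left = I.nT ∧ τ.reg r_v = 0 := by
      refine Does.of_wp ?_ (by decide)
      simp [setup, Prog.wp, Expr.Fits, Expr.eval, i0, i1, i2, i3]
      repeat' apply And.intro
      all_goals omega
    refine main.mono le_rfl ?_
    rintro τ F ⟨h1, h2, h3, h4⟩
    exact ⟨⟨F.1 _ (by decide), F.1 _ (by decide), F.1 _ (by decide), F.1 _ (by decide), h1, h2⟩,
      h3, h4⟩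
  refine (hA.seq (m := I.nT * 50 + 4 + (10 + ((I.k₁ + I.k₂) * 210 + 10 +
    (10 + (I.nC * 170 + 10))))) ?_).mono (by omega) fun _ _ h => h
  rintro σ₁ F₁ ⟨S1, l1, v1⟩
  refine (countLoop_does hW hreg S1.nT S1.k₁ (fun j => ?_) (fun j => ?_) (fun v => ?_) v1).seq ?_
  · rw [F₁.2 _ (by decide)]; simp [input]
  · rw [F₁.2 _ (by decide)]; simp [input]
  · rw [F₁.2 _ (by decide)]; simp [input]
  rintro σ₂ F₂ ⟨rem₁, rem₂, rem₃⟩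
  have hB : Does W (r_v ←ᵉ .lit 0) σ₂ 10 fun τ => τ.reg r_v = 0 := by
    refine Does.of_wp ?_ (by decide)
    simp [Prog.wp, Expr.Fits, Expr.eval]
  refine hB.seq ?_
  rintro σ₃ F₃ v3
  have S3 := (S1.frame F₂ (by decide)).frame F₃ (by decide)
  refine (levelLoop_does hW hreg S3 v3 ?_ (fun v => ?_) (fun v => ?_)).seq ?_
  · rw [F₃.1 _ (by decide), F₂.1 _ (by decide), F₁.1 _ (by decide)]; rfl
  · rw [F₃.2 _ (by decide), F₂.2 _ (by decide), F₁.2 _ (by decide)]; rfl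
  · rw [F₃.2 _ (by decide), F₂.2 _ (by decide), F₁.2 _ (by decide)]; rfl
  rintro σ₄ F₄ ⟨g4, a4, L4, z4⟩
  have hC : Does W (r_v ←ᵉ .lit 0 ;; r_c ←ᵉ .lit 0) σ₄ 10 fun τ =>
      τ.reg r_v = 0 ∧ τ.reg r_c = 0 := by
    refine Does.of_wp ?_ (by decide)
    simp [Prog.wp, Expr.Fits, Expr.eval]
  refine hC.seq ?_
  rintro σ₅ F₅ ⟨v5, c5⟩
  have S5 := (S3.frame F₄ (by decide)).frame F₅ (by decide)
  have a5 : σ₅.reg r_arcs = 2 * (I.k₁ + I.k₂) := (F₅.1 _ (by decide)).trans a4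
  have z5 : ∀ r, 4 * (I.k₁ + I.k₂) ≤ r → σ₅.arr a_resid r = 0 := fun r hr => by
    rw [F₅.2 _ (by decide), z4 r hr]
  have s5 : ∀ i, σ₅.arr a_samp i = 0 := fun i => by
    rw [F₅.2 _ (by decide), F₄.2 _ (by decide), F₃.2 _ (by decide), F₂.2 _ (by decide),
      F₁.2 _ (by decide)]; rfl
  have cell5 : ∀ i, σ₅.arr a_cell i = 0 := fun i => by
    rw [F₅.2 _ (by decide), F₄.2 _ (by decide), F₃.2 _ (by decide), F₂.2 _ (by decide),
      F₁.2 _ (by decide)]; rfl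
  have inv5 : CellInv I 0 σ₅ := by
    refine ⟨⟨F₅.graph g4 (by decide) (by decide), by omega, by omega, fun x h => by omega,
      fun x h => by omega, fun a h1 h2 => by omega, fun y _ => cell5 y, fun x h => by omega,
      fun r h1 h2 => by omega⟩, ⟨fun a ha => z5 _ (by omega), fun a ha k hk => ?_,
      fun a ha k hk => ?_, fun x h => by omega, fun a ha => ?_, fun i => ?_⟩, ?_⟩
    · rw [z5 _ (by omega)] at hk; omega
    · rw [z5 _ (by omega)] at hk; omega
    · rw [z5 _ (by omega)]
    · rw [s5]; omega
    · exact L4.of_eq (fun r _ => by rw [F₅.2 _ (by decide)])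
        (fun r _ => by rw [F₅.2 _ (by decide)]) (fun r _ => by rw [F₅.2 _ (by decide)])
  refine (cellLoop_does hW hreg S5 inv5 v5 c5 (fun x => ?_) (fun x => ?_)).mono le_rfl ?_
  · rw [F₅.2 _ (by decide), F₄.2 _ (by decide), F₃.2 _ (by decide), F₂.2 _ (by decide),
      F₁.2 _ (by decide)]; simp [input]
  · rw [F₅.2 _ (by decide), F₄.2 _ (by decide), F₃.2 _ (by decide), F₂.2 _ (by decide),
      F₁.2 _ (by decide)]; simp [input]
  rintro τ F₆ h
  have S6 := S5.frame F₆ (by decide)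
  have hzero : ∀ a ∈ [a_sel, a_exc₁, a_def₁, a_exc₂, a_def₂, a_pi, a_vis], ∀ i, τ.arr a i = 0 := by
    intro a ha i
    simp only [List.mem_cons, List.not_mem_nil, or_false] at ha
    rcases ha with rfl | rfl | rfl | rfl | rfl | rfl | rfl <;>
    · rw [F₆.2 _ (by decide), F₅.2 _ (by decide), F₄.2 _ (by decide), F₃.2 _ (by decide),
        F₂.2 _ (by decide), F₁.2 _ (by decide)]
      rfl
  have hsel : I.storedSelection τ = ∅ := by
    simp [storedSelection, hzero a_sel (by simp)]
  have hflow : I.storedFlow τ = fun _ => 0 := by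
    funext b
    cases b with
    | cross c => simp [storedFlow, hsel, cellCount]
    | exc₁ i => exact hzero _ (by simp) _
    | def₁ i => exact hzero _ (by simp) _
    | exc₂ i => exact hzero _ (by simp) _
    | def₂ i => exact hzero _ (by simp) _
  have hrem : ∀ v, I.network.remaining (I.storedFlow τ) v = I.network.supply v := fun v => by
    simp [Network.remaining, hflow, Network.netOut]
  have erem : τ.arr a_rem = σ₂.arr a_rem := by
    rw [F₆.2 _ (by decide), F₅.2 _ (by decide), F₄.2 _ (by decide), F₃.2 _ (by decide)]
  have eleft : τ.reg r_left = I.nT := by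
    rw [F₆.1 _ (by decide), F₅.1 _ (by decide), F₄.1 _ (by decide), F₃.1 _ (by decide),
      F₂.1 _ (by decide), l1]
  refine ⟨⟨h.layout S6, ?_, by omega, ⟨0, h.labels (hzero _ (by simp))⟩, fun v _ => ?_, fun α => ?_,
    fun i => ?_, fun i => ?_, ?_, ?_, fun v hv => ?_, ?_⟩, fun b => by rw [hflow]⟩
  · rw [hflow]; exact h.keeps (hzero _ (by simp))
  · rw [hzero _ (by simp)]; omega
  · rw [hflow]
  · rw [hrem, erem, rem₁]; rfl
  · rw [hrem, erem, rem₂]; simp [network]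
  · rw [hrem]; rfl
  · rw [hrem]; rfl
  · rw [erem]; exact rem₃ v hv
  · simp [hflow]

end Code

/-! ## Optimality and running time -/

namespace Instance

variable {I : Instance}

theorem Regular.wordOK (h : I.Regular) : I.WordOK (I.wordBound 8) := by
  have h1 := h.size_ge
  unfold WordOK wordBound
  generalize I.nT + I.nC + I.k₁ + I.k₂ = s at *
  -- The exponent `8` suffices since `s ≥ 4`: six factors absorb the constant `100`.
  calc 100 * (s * s) ≤ 4 ^ 6 * (s * s) := Nat.mul_le_mul_right _ (by norm_num)
    _ ≤ s ^ 6 * (s * s) := Nat.mul_le_mul_right _ (Nat.pow_le_pow_left h1 6)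
    _ = s ^ 8 := by ring

/-- After `nT` iterations the remaining supplies add up to zero, and so do the remaining demands;
being natural numbers, all of them vanish. -/
theorem Inv.feasible {σ : Store} (h : I.Inv I.nT σ) :
    I.network.Feasible fun b => (I.storedFlow σ b : ℝ) := by
  have hr : ∀ v, I.network.remaining (I.storedFlow σ) v = 0 := by
    intro v
    cases v with
    | lev₁ i =>
      have h1 := h.sum_rem₁
      rw [Nat.sub_self, Finset.sum_eq_zero_iff] at h1
      rw [← h.rem₁ i, h1 i (Finset.mem_univ _)]; rfl
    | lev₂ i =>
      have h1 := h.sum_rem₂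
      rw [Nat.sub_self, Finset.sum_eq_zero_iff] at h1
      have h2 := h.rem₂ i
      rw [h1 i (Finset.mem_univ _)] at h2
      omega
    | hub₁ => exact h.hub₁
    | hub₂ => exact h.hub₂
  refine ⟨fun a => ⟨Nat.cast_nonneg _, fun u hu => ?_⟩, fun v => ?_⟩
  · cases a with
    | cross c =>
      have h1 := h.keeps.fwd (.cross c)
      have h2 : I.u c.1.1 c.1.2 = u := ENat.natCast_inj.1 hu
      simp only [capN] at h1
      exact Nat.cast_le.2 (show I.storedFlow σ (.cross c) ≤ u by omega)
    | _ => exact absurd hu (by simp [network])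
  · have h1 := hr v
    rw [Network.remaining, sub_eq_zero] at h1
    rw [h1]
    simp [Network.netOut]

/-- The labels of the last search are the dual certificate for the final flow. -/
theorem Inv.optimal {σ : Store} (h : I.Inv I.nT σ) :
    I.network.Optimal fun b => (I.storedFlow σ b : ℝ) := by
  obtain ⟨D, hD⟩ := h.labels
  exact (h.potential hD).optimal h.feasible

/-- The stored selection is no worse than any solution of (MI). -/
theorem Inv.imbalance_le {σ : Store} (h : I.Inv I.nT σ) :
    (I.storedSelection σ).card = I.nT ∧
      ∀ w, I.MIFeasible w → (I.imbalance (I.storedSelection σ) : ℝ) ≤ I.MIObjective w := by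
  obtain ⟨v, hv, e⟩ := I.bijOn_toFlow.surjOn h.feasible
  obtain ⟨h1, h2⟩ := I.imbalance_le_objective hv (I.storedSelection σ) fun i₁ i₂ => by
    by_cases hu : 0 < I.u i₁ i₂
    · exact congrFun e (.cross ⟨(i₁, i₂), hu⟩)
    · have := I.cellCount_le_u (I.storedSelection σ) i₁ i₂
      rw [I.x_eq_zero_of_feasible hv i₁ i₂ (by omega),
        show I.cellCount (I.storedSelection σ) i₁ i₂ = 0 by omega, Nat.cast_zero]
  refine ⟨h1, fun w hw => h2.trans ?_⟩
  rw [← totalCost_toFlow, ← totalCost_toFlow, e]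
  exact h.optimal.2 _ (I.bijOn_toFlow.mapsTo hw)

theorem optimalSelection_of_le {S : Finset (Fin I.nC)} (hS : S.card = I.nT)
    (h : ∀ w, I.MIFeasible w → (I.imbalance S : ℝ) ≤ I.MIObjective w) : I.OptimalSelection S := by
  refine ⟨hS, fun S' hS' => ?_⟩
  have := h _ (I.feasible_ofSelection S' hS')
  rw [objective_ofSelection] at this
  exact_mod_cast this

/-- The selection `S₀` closes the integrality gap: it shows that the minimum over selections is also
a lower bound for the whole linear program. -/
theorem optimalSelection_iff {S₀ : Finset (Fin I.nC)} (hS₀ : S₀.card = I.nT)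
    (h : ∀ w, I.MIFeasible w → (I.imbalance S₀ : ℝ) ≤ I.MIObjective w) (S : Finset (Fin I.nC)) :
    I.OptimalSelection S ↔ I.MIOptimal (I.ofSelection S) := by
  constructor
  · rintro ⟨h1, h2⟩
    refine ⟨I.feasible_ofSelection S h1, fun w hw => ?_⟩
    rw [objective_ofSelection]
    exact le_trans (by exact_mod_cast h2 S₀ hS₀) (h w hw)
  · rintro ⟨h1, h2⟩
    refine optimalSelection_of_le (I.imbalance_le_objective h1 S fun _ _ => rfl).1 fun w hw => ?_
    rw [← objective_ofSelection]
    exact h2 w hw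

theorem card_node_le (hreg : I.Regular) : Fintype.card I.Node ≤ Fintype.card I.Arc := by
  have := hreg.k₁_pos
  have := hreg.k₂_pos
  rw [card_node, card_arc]
  omega

end Instance

namespace Code

open Instance

/-- The stores between the iterations of the algorithm. -/
theorem exists_stores {I : Instance} {W : ℕ} (hW : I.WordOK W) (hreg : I.Regular) :
    ∃ (σ : ℕ → Store) (t₀ : ℕ) (t : ℕ → ℕ), Run W init I.input t₀ (σ 0) ∧
      t₀ ≤ 210 * (I.nT + I.nC + I.k₁ + I.k₂) + 100 ∧ (∀ b, I.storedFlow (σ 0) b = 0) ∧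
      (∀ i ≤ I.nT, I.Inv i (σ i)) ∧
      ∀ i < I.nT, Run W body (σ i) (t i) (σ (i + 1)) ∧ t i ≤ 2600 * Fintype.card I.Arc ∧
        I.network.SSPStep (I.storedFlow (σ i)) (I.storedFlow (σ (i + 1))) := by
  obtain ⟨t₀, σ₀, h1, h2, h3, h4⟩ := init_does hW hreg
  -- The statement is made for all stores, with a dummy value outside the invariant, so that choice
  -- yields total functions that can be iterated.
  have hbody : ∀ n s, ∃ T τ, n < I.nT → I.Inv n s →
      Run W body s T τ ∧ T ≤ 2600 * Fintype.card I.Arc ∧ I.Inv (n + 1) τ ∧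
        I.network.SSPStep (I.storedFlow s) (I.storedFlow τ) := by
    intro n s
    by_cases h : n < I.nT ∧ I.Inv n s
    · obtain ⟨T, τ, h1, h2, h3, h4⟩ := body_does hW hreg h.2 h.1
      refine ⟨T, τ, fun _ _ => ⟨h1, h2.trans ?_, h3, h4⟩⟩
      have e1 := h.2.layout.card_arc
      have e2 := h.2.layout.nodes
      have e3 := card_node_le hreg
      rw [card_node, ← e2] at e3
      have := hreg.k₁_pos
      omega
    · exact ⟨0, s, fun h1 h2 => absurd ⟨h1, h2⟩ h⟩
  choose T F hF using hbody
  let σ : ℕ → Store := fun i => Nat.rec σ₀ (fun n s => F n s) i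
  have hInv : ∀ i ≤ I.nT, I.Inv i (σ i) := by
    intro i
    induction i with
    | zero => exact fun _ => h3
    | succ n ih => exact fun hn => (hF n (σ n) hn (ih (by omega))).2.2.1
  refine ⟨σ, t₀, fun i => T i (σ i), h1, h2, h4, hInv, fun i hi => ?_⟩
  obtain ⟨g1, g2, -, g4⟩ := hF i (σ i) hi (hInv i hi.le)
  exact ⟨g1, g2, g4⟩

/-- Induction on the number of iterations still to come, since a run of a loop is built from its
end. The two extra steps per round are the evaluation of the test and the branch. -/
theorem run_loop {I : Instance} {W b : ℕ} (hW : I.nT ≤ W) {σ : ℕ → Store} {t : ℕ → ℕ}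
    (hInv : ∀ i ≤ I.nT, I.Inv i (σ i))
    (hrun : ∀ i < I.nT, Run W body (σ i) (t i) (σ (i + 1)) ∧ t i ≤ b) (k : ℕ) (hk : k ≤ I.nT) :
    ∃ T ≤ k * (b + 2) + 2, Run W (.loop (.reg r_left) body) (σ (I.nT - k)) T (σ I.nT) := by
  have hfit : ∀ i ≤ I.nT, (Expr.reg r_left).Fits W (σ i) := fun i hi => by
    have := (hInv i hi).left
    simp only [Expr.Fits]; omega
  induction k with
  | zero =>
    refine ⟨2, by omega, ?_⟩
    rw [Nat.sub_zero]
    refine .loopDone _ _ _ (hfit _ le_rfl) ?_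
    have := (hInv I.nT le_rfl).left
    simp only [Expr.eval]; omega
  | succ k ih =>
    obtain ⟨T, hT, hR⟩ := ih (by omega)
    obtain ⟨h1, h2⟩ := hrun (I.nT - (k + 1)) (by omega)
    rw [show I.nT - (k + 1) + 1 = I.nT - k by omega] at h1
    refine ⟨_, ?_, .loopStep _ _ _ _ _ _ _ (hfit _ (by omega)) ?_ h1 hR⟩
    · simp only [Expr.time]
      rw [Nat.succ_mul]
      omega
    · have := (hInv (I.nT - (k + 1)) (by omega)).left
      simp only [Expr.eval]; omega

end Code

end MinImbalance

/-! ### The main theorem -/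

theorem mainTheorem4 :
    -- (MI) is a minimum cost network flow problem, and it is the min-imbalance problem
    (∀ I : Instance, I.Regular →
      (Set.BijOn I.toFlow {v | I.MIFeasible v} {f | I.network.Feasible f} ∧
        ∀ v, I.network.totalCost (I.toFlow v) = I.MIObjective v) ∧
      (∀ S : Finset (Fin I.nC), S.card = I.nT →
        I.MIFeasible (I.ofSelection S) ∧ I.MIObjective (I.ofSelection S) = I.imbalance S) ∧
      (∀ v, I.MIFeasible v → ∀ s : Fin I.k₁ → Fin I.k₂ → ℕ, (∀ i₁ i₂, v.x i₁ i₂ = s i₁ i₂) →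
        ∃ S : Finset (Fin I.nC), S.card = I.nT ∧ (∀ i₁ i₂, I.cellCount S i₁ i₂ = s i₁ i₂) ∧
          (I.imbalance S : ℝ) ≤ I.MIObjective v) ∧
      (∀ S : Finset (Fin I.nC), I.OptimalSelection S ↔ I.MIOptimal (I.ofSelection S))) ∧
    -- the size of the network
    (∃ C : ℕ, ∀ I : Instance, I.Regular →
      Fintype.card I.Node ≤ C * (I.k₁ + I.k₂) ∧
      Fintype.card I.Arc ≤ C * min I.nC (I.k₁ * I.k₂)) ∧
    -- successive shortest paths on this network: a program, its correctness and running time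
    (∃ (a : ℕ) (C : ℝ) (init body : Prog) (test : Expr), ∀ I : Instance, I.Regular →
      ∃ (T : ℕ) (m : ℕ) (σ : ℕ → Store) (t₀ : ℕ) (t : ℕ → ℕ),
        Run (I.wordBound a) (.seq init (.loop test body)) I.input T (σ m) ∧
        (T : ℝ) ≤ C * (I.nT * (I.nC + I.nT * Real.log I.nT)) ∧
        I.OptimalSelection (I.storedSelection (σ m)) ∧
        I.network.Optimal (fun b => (I.storedFlow (σ m) b : ℝ)) ∧
        Run (I.wordBound a) init I.input t₀ (σ 0) ∧
        (∀ b, I.storedFlow (σ 0) b = 0) ∧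
        m ≤ I.nT ∧
        (∀ i < m, test.eval (σ i) ≠ 0 ∧
          Run (I.wordBound a) body (σ i) (t i) (σ (i + 1)) ∧
          I.network.SSPStep (I.storedFlow (σ i)) (I.storedFlow (σ (i + 1))) ∧
          (t i : ℝ) ≤ C * (Fintype.card I.Arc +
            Fintype.card I.Node * Real.log (Fintype.card I.Node))) ∧
        test.eval (σ m) = 0) := by
  refine ⟨fun I hreg => ⟨⟨I.bijOn_toFlow, I.totalCost_toFlow⟩, fun S hS =>
    ⟨I.feasible_ofSelection S hS, I.objective_ofSelection S⟩, fun v hv s hs => ?_, ?_⟩,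
    ⟨9, fun I hreg => ⟨?_, hreg.card_arc_le⟩⟩,
    -- The constant `30000` covers the `2600` per arc of one iteration as well as the total: `23402
    -- * nT * nC` for the iterations and a linear term below `2000 * nC` for the rest.
    8, 30000, Code.init, Code.body, .reg r_left, fun I hreg => ?_⟩
  · obtain ⟨S, hS⟩ := I.exists_selection s fun i₁ i₂ => by
      have := (hv.2.2.2.2.2.2 i₁ i₂).2
      rw [hs] at this
      exact_mod_cast this
    obtain ⟨h1, h2⟩ := I.imbalance_le_objective hv S fun i₁ i₂ => by rw [hs, hS]
    exact ⟨S, h1, hS, h2⟩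
  -- The reference selection for the equivalence of optimality is the output of the algorithm.
  · obtain ⟨σ, -, -, -, -, -, hInv, -⟩ := Code.exists_stores hreg.wordOK hreg
    obtain ⟨h1, h2⟩ := (hInv I.nT le_rfl).imbalance_le
    exact Instance.optimalSelection_iff h1 h2
  · have := hreg.k₁_pos
    rw [I.card_node]
    omega
  · have hW := hreg.wordOK
    obtain ⟨σ, t₀, t, hinit, ht₀, hzero, hInv, hstep⟩ := Code.exists_stores hW hreg
    have hlin := hW.linear hreg
    have hm := hInv I.nT le_rfl
    obtain ⟨T, hT, hloop⟩ := Code.run_loop (by omega) hInv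
      (fun i hi => ⟨(hstep i hi).1, (hstep i hi).2.1⟩) I.nT le_rfl
    rw [Nat.sub_self] at hloop
    obtain ⟨h1, h2⟩ := hm.imbalance_le
    refine ⟨t₀ + T, I.nT, σ, t₀, t, .seq _ _ _ _ _ _ _ hinit hloop, ?_,
      Instance.optimalSelection_of_le h1 h2, hm.optimal, hinit, hzero, le_rfl, fun i hi => ?_, ?_⟩
    · have hn : 1 ≤ I.nT := hreg.1
      have hn' : I.nT ≤ I.nC := hreg.2.1
      have e1 := hreg.card_arc_le
      have e2 := min_le_left I.nC (I.k₁ * I.k₂)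
      have e3 := hreg.k₁_le
      have e4 := hreg.k₂_le
      have hA : Fintype.card I.Arc ≤ 9 * I.nC := by omega
      have e5 : I.nT * (2600 * Fintype.card I.Arc + 2) ≤ I.nT * (23402 * I.nC) :=
        Nat.mul_le_mul_left _ (by omega)
      have e6 : I.nC ≤ I.nT * I.nC := Nat.le_mul_of_pos_left _ hn
      have e7 : I.nT * (23402 * I.nC) = 23402 * (I.nT * I.nC) := by ring
      have hnat : t₀ + T ≤ 30000 * (I.nT * I.nC) := by
        generalize I.nT * I.nC = P at *
        omega
      -- The bound already holds without the logarithmic term, which only has to be nonnegative.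
      have hlog : 0 ≤ (I.nT : ℝ) * (I.nT * Real.log I.nT) :=
        mul_nonneg (Nat.cast_nonneg _)
          (mul_nonneg (Nat.cast_nonneg _) (Real.log_natCast_nonneg _))
      have hreal : ((t₀ + T : ℕ) : ℝ) ≤ 30000 * (I.nT * I.nC) := by exact_mod_cast hnat
      rw [mul_add]
      linarith
    · obtain ⟨g1, g2, g3⟩ := hstep i hi
      refine ⟨?_, g1, g3, ?_⟩
      · have := (hInv i hi.le).left
        simp only [Expr.eval]; omega
      · have hlog : 0 ≤ (Fintype.card I.Node : ℝ) * Real.log (Fintype.card I.Node) :=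
          mul_nonneg (Nat.cast_nonneg _) (Real.log_natCast_nonneg _)
        have hA : (0 : ℝ) ≤ Fintype.card I.Arc := Nat.cast_nonneg _
        have hreal : ((t i : ℕ) : ℝ) ≤ 2600 * Fintype.card I.Arc := by exact_mod_cast g2
        linarith
    · have := hm.left
      simp only [Expr.eval]; omega
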